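/- Let $G$ be a compact, simply connected, simple Lie group of rank $n$, let $\mathfrak g$ be the complexification of its Lie algebra (a finite-dimensional simple complex Lie algebra) and $\mathfrak h\subset\mathfrak g$ a Cartan subalgebra. Let $\Delta\subset\mathfrak h^*$ be the set of roots, and let $\mathfrak t\subset\mathfrak h$ be the real span of the co-roots and $\mathfrak t^*$ the real span of the roots, with the natural pairing $\langle\cdot,\cdot\rangle$, so that $x\mapsto\exp(2\pi i x)$ maps $\mathfrak t$ onto a maximal torus of $G$. Let $\alpha_1,\dots,\alpha_n$ be simple roots with co-roots $\check\alpha_1,\dots,\check\alpha_n$. Let $-\alpha_0=\sum_j m_j\alpha_j$ be the highest root, let $\sum_j\check m_j\check\alpha_j$ be the highest co-root (the highest root of the dual root system), and let $h=1+m_1+\cdots+m_n$ be the Coxeter number. Let $\omega_j\in\mathfrak t^*$ be the fundamental weights, $\langle\omega_j,\check\alpha_k\rangle=\delta_{jk}$, and $\rho=\omega_1+\cdots+\omega_n$. Let $W$ be the Weyl group, with the sign character $w\mapsto(-1)^{l(w)}=\det w$, and let $$\check P=\{y\in\mathfrak t\mid\langle\alpha,y\rangle\in\mathbb Z\text{ for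 all }\alpha\in\Delta\},\quad F=\{x\in\mathfrak t\mid\langle\alpha_j,x\rangle\ge0\ (1\le j\le n),\ \langle-\alpha_0,x\rangle\le1\},$$ and let $F^\circ$ be the set obtained from $F$ by making all the inequalities strict. For $N\ge1$ let $F_N=F\cap\frac1N\check P$ and $F^\circ_N=F^\circ\cap\frac1N\check P$ be the sets of points of adjoint order $N$ (meaning $\mathrm{Ad}(\exp(2\pi i x))^N=1$) in $F$ and $F^\circ$; put $F_0=\{0\}$. A point $x\in\mathfrak t$ is regular if the centralizer of $\exp(2\pi i x)$ has dimension $n$. For $\lambda=\sum_j\lambda_j\omega_j$ with integers $\lambda_j\ge0$, the $m$-degree of $\lambda$, and of the monomial $X_1^{\lambda_1}\cdots X_n^{\lambda_n}$, is $\sum_j\lambda_j\check m_j$. For such $\lambda$ and $x\in\mathfrak t$ let $$S_{\lambda+\rho}(x)=\sum_{w\in W}(-1)^{l(w)}e^{2\pi i\langle w(\lambda+\rho),x\rangle},\qquad \chi_\lambda(x)=\operatorname{tr}_{L(\lambda)}\exp(2\pi i x)=\sum_\mu\dim L(\lambda)^\mu\,e^{2\pi i\langle\mu,x\rangle},$$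 where $L(\lambda)$ is the finite-dimensional irreducible representation with highest weight $\lambda$ and $\mu$ runs over its weights. **Theorem.** Let $M\ge0$ be an integer. The regular points of $F$ of adjoint order $M+h$ are exactly the points of $F^\circ_{M+h}$. This set is finite, and its number of elements equals the number of monomials in $\mathbb C[X_1,\dots,X_n]$ of $m$-degree at most $M$, and also equals the number of elements of $F_M$: $|F^\circ_{M+h}|=|F_M|$. Moreover, every $x\in F^\circ_{M+h}$ is a common zero of all the functions $S_{\lambda+\rho}$ and of all the characters $\chi_\lambda$ for which $\lambda=\sum_j\lambda_j\omega_j$ (with integers $\lambda_j\ge0$) has $m$-degree exactly $M+1$. -/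

import Mathlib

noncomputable section

namespace EFO

open Module

section RootData

/-! ### Constructions from a real root system `P` with a simple system `b`

`V` plays the role of `𝔱*` and `T` that of `𝔱`. -/

variable {ι V T : Type*} [Finite ι] [AddCommGroup V] [Module ℝ V] [AddCommGroup T] [Module ℝ T]
  {P : RootPairing ι ℝ V T}

/-- The natural pairing `⟨v, x⟩` of `𝔱*` and `𝔱`. -/
def pair (P : RootPairing ι ℝ V T) (v : V) (x : T) : ℝ := P.toLinearMap v x

/-- The (index of the) highest root `-α₀`, that is, the root of greatest height. -/
def highestRoot [Nonempty ι] (b : P.Base) : ι :=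
  (Finite.exists_max b.height).choose

/-- The mark `m_j`: the coefficient of the simple root `α_j` in the highest root `-α₀`.
These coefficients are positive integers, so that `Int.toNat` only changes the type. -/
def mark [Nonempty ι] (b : P.Base) (j : b.support) : ℕ :=
  (b.toWeightBasisInt.repr (P.rootSpanMem ℤ (highestRoot b)) j).toNat

/-- The co-mark `m̌_j`: the mark of the dual root system, that is, the coefficient of the simple
co-root `α̌_j` in the highest co-root. -/
def comark [Nonempty ι] (b : P.Base) (j : b.support) : ℕ := mark b.flip j

/-- The Coxeter number `h = m₀ + m₁ + ⋯ + m_n`, where `m₀ = 1`. -/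
def coxeterNumber [Nonempty ι] (b : P.Base) : ℕ := 1 + ∑ j : b.support, mark b j

/-- The fundamental simplex `F` of the affine Weyl group. -/
def chamber [Nonempty ι] (b : P.Base) : Set T :=
  {x | (∀ j ∈ b.support, 0 ≤ pair P (P.root j) x) ∧ pair P (P.root (highestRoot b)) x ≤ 1}

/-- The interior `F°` of the simplex `F`. -/
def openChamber [Nonempty ι] (b : P.Base) : Set T :=
  {x | (∀ j ∈ b.support, 0 < pair P (P.root j) x) ∧ pair P (P.root (highestRoot b)) x < 1}

/-- The co-weight lattice `P̌`: the `ℤ`-dual of the root lattice. -/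
def coweightLattice (P : RootPairing ι ℝ V T) : Set T :=
  {y | ∀ i, ∃ z : ℤ, pair P (P.root i) y = z}

/-- The points of adjoint order (dividing) `N`: the set `(1/N) P̌`.
For `N = 0` the set is `{0}`, by the convention `1 / 0 = 0`. -/
def adjointOrder (P : RootPairing ι ℝ V T) (N : ℕ) : Set T :=
  {x | ∃ y ∈ coweightLattice P, x = (1 / (N : ℝ)) • y}

/-- `F_N`: the points of `F` of adjoint order `N`. -/
def chamberEFO [Nonempty ι] (b : P.Base) (N : ℕ) : Set T := chamber b ∩ adjointOrder P N

/-- `F°_N`: the points of `F°` of adjoint order `N`. -/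
def openChamberEFO [Nonempty ι] (b : P.Base) (N : ℕ) : Set T := openChamber b ∩ adjointOrder P N

/-- The `m`-degree `∑ λ_j m̌_j` of `λ = (λ_1, …, λ_n)`. -/
def mDegree [Nonempty ι] (b : P.Base) (l : b.support →₀ ℕ) : ℕ := Finsupp.weight (comark b) l

/-- The monomials `X^λ` of `ℂ[X_1, …, X_n]` of `m`-degree at most `M`, where `X_j` has
degree `m̌_j`. -/
def monomialsLE [Nonempty ι] (b : P.Base) (M : ℕ) : Set (MvPolynomial b.support ℂ) :=
  {p | ∃ l : b.support →₀ ℕ, mDegree b l ≤ M ∧ p = MvPolynomial.monomial l 1}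

/-- The fundamental weight `ω_j`, defined by `⟨ω_j, α̌_k⟩ = δ_jk`. -/
def fundamentalWeight [P.IsRootSystem] (b : P.Base) (j : b.support) : V :=
  P.toLinearMap.toPerfPair.symm (b.toCoweightBasis.coord j)

/-- The dominant weight `λ = ∑ λ_j ω_j`. -/
def dominantWeight [P.IsRootSystem] (b : P.Base) (l : b.support →₀ ℕ) : V :=
  ∑ j, (l j : ℝ) • fundamentalWeight b j

/-- The weight `ρ = ∑ ω_j`. -/
def rho [P.IsRootSystem] (b : P.Base) : V := ∑ j, fundamentalWeight b j

lemma finite_weylGroup (P : RootPairing ι ℝ V T) [P.IsRootSystem] : Finite P.weylGroup := by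
  refine Finite.of_injective (fun w => P.weylGroupToPerm w) ?_
  intro g g' h
  apply Subtype.ext
  apply RootPairing.Equiv.weightHom_injective P
  apply LinearEquiv.toLinearMap_injective
  refine LinearMap.ext_on_range (v := P.root) RootPairing.IsRootSystem.span_root_eq_top ?_
  intro i
  have h1 := P.weylGroup_apply_root g i
  have h2 := P.weylGroup_apply_root g' i
  have h3 : P.weylGroupToPerm g = P.weylGroupToPerm g' := h
  rw [h3, ← h2] at h1
  exact h1

instance (P : RootPairing ι ℝ V T) [P.IsRootSystem] : Fintype P.weylGroup :=
  @Fintype.ofFinite _ (finite_weylGroup P)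

/-- The sign `(-1)^{l(w)}`: the determinant of `w` on `𝔱*`, which is the homomorphism
`W → {±1}` that sends every reflection to `-1`. -/
def sign (P : RootPairing ι ℝ V T) (w : P.weylGroup) : ℝ :=
  LinearMap.det (P.weylGroupRootRep w)

/-- The `S`-function `S_μ(x) = ∑_{w ∈ W} (-1)^{l(w)} e^{2πi⟨wμ, x⟩}`. -/
def sFunction (P : RootPairing ι ℝ V T) [P.IsRootSystem] (μ : V) (x : T) : ℂ :=
  ∑ w : P.weylGroup, (sign P w : ℂ) *
    Complex.exp (2 * Real.pi * Complex.I * (pair P (w • μ) x : ℂ))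

end RootData

section LieAlgebra

/-! ### The root system and the characters of a complex simple Lie algebra -/

variable {𝔤 : Type*} [LieRing 𝔤] [LieAlgebra ℂ 𝔤] [FiniteDimensional ℂ 𝔤] [LieAlgebra.IsSimple ℂ 𝔤]
  (H : LieSubalgebra ℂ 𝔤) [H.IsCartanSubalgebra]

/-- The real form `𝔱 ⊆ H`, the real span of the co-roots. -/
abbrev realCartan : Submodule ℝ H :=
  Submodule.span ℝ (Set.range (LieAlgebra.IsKilling.rootSystem H).coroot)

/-- The real dual `𝔱*`, as the real span of the roots in the dual of `H`. -/
abbrev realDual : Submodule ℝ (Dual ℂ H) :=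
  Submodule.span ℝ (Set.range (LieAlgebra.IsKilling.rootSystem H).root)

/-- The roots and the co-roots of `𝔤` with respect to `H`, as a root system in the real vector
spaces `𝔱*` and `𝔱`. -/
abbrev realRootSystem : RootPairing H.root ℝ (realDual H) (realCartan H) :=
  (LieAlgebra.IsKilling.rootSystem H).restrictScalars ℝ

instance : Nonempty H.root := by
  have h := RootPairing.IsIrreducible.nontrivial (LieAlgebra.IsKilling.rootSystem H)
  by_contra hne
  rw [not_nonempty_iff] at hne
  have h1 := (inferInstance : (LieAlgebra.IsKilling.rootSystem H).IsRootSystem).span_root_eq_top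
  rw [Set.range_eq_empty, Submodule.span_empty] at h1
  exact bot_ne_top h1

variable {H}

/-- The Lie algebra of the centralizer of `exp(2πix)`, complexified: `Ad(exp(2πix))` acts on the
root space of `α` (the space `H` for `α = 0`) as the scalar `e^{2πi⟨α, x⟩}`, and this is its
space of fixed points. -/
def centralizer (x : realCartan H) : Submodule ℂ 𝔤 :=
  ⨆ α : LieModule.Weight ℂ H 𝔤, ⨆ _ : Complex.exp (2 * Real.pi * Complex.I * α (x : H)) = 1,
    (LieAlgebra.rootSpace H α).toSubmodule

/-- The point `x`, or the element `exp(2πix)`, is regular: its centralizer has dimension `n`,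
the rank. -/
def IsRegular (x : realCartan H) : Prop := finrank ℂ (centralizer x) = finrank ℂ H

variable (H) in
/-- The character `χ_L(x) = tr_L exp(2πix) = ∑_μ dim L^μ e^{2πi⟨μ, x⟩}` of a representation `L`,
where `μ` runs over the weights of `L`. -/
def character (L : Type*) [AddCommGroup L] [Module ℂ L] [LieRingModule 𝔤 L] [LieModule ℂ 𝔤 L]
    [FiniteDimensional ℂ L] (x : realCartan H) : ℂ :=
  ∑ μ : LieModule.Weight ℂ H L, (finrank ℂ (LieModule.weightSpace L (μ : H → ℂ)) : ℂ) *
    Complex.exp (2 * Real.pi * Complex.I * μ (x : H))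

/-- `λ` is the highest weight of the representation `L`: it is a weight, and every weight of `L`
has the form `λ - β` with `β` a sum of positive roots. -/
def IsHighestWeight (b : (realRootSystem H).Base) (l : realDual H)
    (L : Type*) [AddCommGroup L] [Module ℂ L] [LieRingModule 𝔤 L] [LieModule ℂ 𝔤 L] : Prop :=
  LieModule.weightSpace L ((l : Dual ℂ H) : H → ℂ) ≠ ⊥ ∧
    ∀ μ : Dual ℂ H, LieModule.weightSpace L (μ : H → ℂ) ≠ ⊥ →
      ∃ β ∈ AddSubmonoid.closure ((realRootSystem H).root '' {i | b.IsPos i}),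
        μ = (l : Dual ℂ H) - (β : Dual ℂ H)

end LieAlgebra

end EFO

end

/-! All but the characters takes place in the real root system. The centralizer of a point is `H`
together with the root spaces of the roots that are integral there, and the highest root bounds
every root coefficientwise (`rootCoeff_le_highestRoot`), so on `F` regular means interior
(`isRegular_iff`, `mem_openChamber_iff`). In the coordinates `k_j = N⟨α_j, x⟩` an interior point of
adjoint order `N` is a vector of positive integers with `∑ m_j k_j < N`. Subtracting one from every
coordinate lowers the sum by `h - 1`, which gives `|F°_{M+h}| = |F_M|`.

Monomials are counted by the same kind of simplex, but with co-marks in place of marks; comparing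
the two is the heart of the count. The Weyl group acts on `P̌/NQ̌`, with `Q̌` the co-root lattice.
Every class has a representative, up to this action, in the closed alcove `N F`, and the action is
free on the classes from the open one. Hence `|W|` times the number of interior points is the number
of classes fixed by no reflection, and this is also `∑ det(w) |Fix w|`, since a stabilizer that
contains a reflection contributes zero (`sum_signPair_mul_card_fixed`). The pairing `e^{2πi⟨v,
y⟩/N}` puts `P̌/NQ̌` in duality with the corresponding quotient for the dual root system, so `w`
fixes equally many classes in both (`card_fixed_eq_of_bicharacter`), and the interior counts agree
for every `N` (`encard_openPoints_flip`). The least `N` with an interior point is the Coxeter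
number; so the two Coxeter numbers agree as well (`sum_comark_eq`).

For `λ` of `m`-degree `M + 1`, the pairing of `λ + ρ` with the highest co-root is therefore `(M + 1)
+ (h - 1) = M + h`. The corresponding reflection moves `λ + ρ` by `M + h` times a root. At a point
of adjoint order `M + h` this does not affect the exponentials, while the sign changes, so `S_{λ+ρ}
= -S_{λ+ρ}` (`sFunction_eq_zero_of_pair_coroot`).

For characters it suffices to know that the product of `χ_λ` with the Weyl denominator involves only
exponentials of conjugates of `λ + ρ` (`evalAt_eq_zero_of_casimir`). The Casimir operator makes this
product an eigenvector of the Laplacian `e^v ↦ (v, v) e^v`; it is antisymmetric with top exponent `λ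
+ ρ`, and no other dominant exponent below `λ + ρ` has the same length. Its value at `x` is then a
combination of values `± S_{λ+ρ}(x) = 0`, and the denominator is nonzero at a regular point. -/

noncomputable section

namespace EFO

open Module

set_option linter.unusedSectionVars false

/-! ### Coefficients of roots in the simple roots, and the highest root. -/

section RootCoefficients

variable {ι V T : Type*} [Finite ι] [AddCommGroup V] [Module ℝ V] [AddCommGroup T] [Module ℝ T]
  {P : RootPairing ι ℝ V T} (b : P.Base)

/-- The coefficient of the simple root `α_j` in the root `α_i`. -/
def rootCoeff (i : ι) (j : b.support) : ℤ := b.toWeightBasisInt.repr (P.rootSpanMem ℤ i) j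

lemma root_eq_sum_rootCoeff (i : ι) :
    P.root i = ∑ j : b.support, rootCoeff b i j • P.root j := by
  have h := congrArg Subtype.val (b.toWeightBasisInt.sum_repr (P.rootSpanMem ℤ i))
  rw [AddSubmonoidClass.coe_finsetSum] at h
  simpa [rootCoeff] using h.symm

lemma rootCoeff_unique {i : ι} {f : b.support → ℤ}
    (h : P.root i = ∑ j : b.support, f j • P.root j) (j : b.support) : rootCoeff b i j = f j := by
  have hli : LinearIndependent ℤ (fun j : b.support ↦ P.root j) :=
    b.linearIndepOn_root.restrict_scalars' ℤ
  rw [root_eq_sum_rootCoeff b i] at h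
  exact congrFun (Fintype.linearIndependent_iffₛ.mp hli _ _ h |> funext) j

lemma rootCoeff_eq_of_sum {i : ι} {f : ι → ℤ}
    (h : P.root i = ∑ j ∈ b.support, f j • P.root j) (j : b.support) : rootCoeff b i j = f j := by
  refine rootCoeff_unique b (f := fun j ↦ f j) ?_ j
  rw [h, ← b.support.sum_coe_sort]

lemma height_eq_sum_rootCoeff (i : ι) : b.height i = ∑ j, rootCoeff b i j := by
  obtain ⟨f, -, -, hf⟩ := b.exists_root_eq_sum_int i
  rw [RootPairing.Base.height_eq_sum hf, ← b.support.sum_coe_sort]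
  exact Finset.sum_congr rfl fun j _ ↦ (rootCoeff_eq_of_sum b hf j).symm

lemma rootCoeff_nonneg_or_nonpos (i : ι) :
    (∀ j, 0 ≤ rootCoeff b i j) ∨ (∀ j, rootCoeff b i j ≤ 0) := by
  obtain ⟨f, -, h | h, hf⟩ := b.exists_root_eq_sum_int i
  · exact Or.inl fun j ↦ by rw [rootCoeff_eq_of_sum b hf]; exact h.le j
  · exact Or.inr fun j ↦ by rw [rootCoeff_eq_of_sum b hf]; exact h.le j

variable {b} in
lemma rootCoeff_nonneg {i : ι} (hi : b.IsPos i) (j : b.support) : 0 ≤ rootCoeff b i j := by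
  rcases rootCoeff_nonneg_or_nonpos b i with h | h
  · exact h j
  · have := height_eq_sum_rootCoeff b i ▸ (b.isPos_iff.mp hi)
    exact absurd this (not_lt.mpr (Finset.sum_nonpos fun j _ ↦ h j))

variable {b} in
lemma rootCoeff_nonpos {i : ι} (hi : ¬ b.IsPos i) (j : b.support) : rootCoeff b i j ≤ 0 := by
  rcases rootCoeff_nonneg_or_nonpos b i with h | h
  · refine absurd (b.isPos_iff'.mpr ?_) hi
    rw [height_eq_sum_rootCoeff]
    exact Finset.sum_nonneg fun j _ ↦ h j
  · exact h j

lemma rootCoeff_self (j : b.support) : rootCoeff b j j = 1 := by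
  classical
  refine (rootCoeff_unique b (f := Pi.single j 1) ?_ j).trans (by simp)
  simp [Pi.single_apply]

lemma rootCoeff_ne_zero (i : ι) : ∃ j, rootCoeff b i j ≠ 0 := by
  by_contra! h
  exact P.ne_zero i (by rw [root_eq_sum_rootCoeff b i]; simp [h])

lemma rootCoeff_add {i k : ι} {j : b.support} (h : P.root k = P.root i + P.root j)
    (l : b.support) : rootCoeff b i l ≤ rootCoeff b k l := by
  classical
  have := rootCoeff_unique b (i := k) (f := fun l ↦ rootCoeff b i l + if l = j then 1 else 0)
    (by simpa [add_smul, Finset.sum_add_distrib, h] using root_eq_sum_rootCoeff b i) l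
  rw [this]
  split_ifs <;> simp

lemma pairingIn_eq_sum_rootCoeff [P.IsCrystallographic] (i k : ι) :
    P.pairingIn ℤ i k = ∑ j, rootCoeff b i j * P.pairingIn ℤ j k := by
  have h := congrArg (P.coroot' k) (root_eq_sum_rootCoeff b i)
  have : (P.pairingIn ℤ i k : ℝ) = ∑ j, (rootCoeff b i j : ℝ) * P.pairingIn ℤ j k := by
    simp only [map_sum, map_zsmul, RootPairing.root_coroot'_eq_pairing,
      ← P.algebraMap_pairingIn ℤ, zsmul_eq_mul] at h
    simpa using h
  exact_mod_cast this

lemma mark_eq_toNat [Nonempty ι] (j : b.support) :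
    mark b j = (rootCoeff b (highestRoot b) j).toNat := rfl

lemma height_le_highestRoot [Nonempty ι] (i : ι) : b.height i ≤ b.height (highestRoot b) :=
  (Finite.exists_max b.height).choose_spec i

lemma isPos_highestRoot [Nonempty ι] : b.IsPos (highestRoot b) := by
  obtain ⟨j, hj⟩ := b.support_nonempty
  exact b.isPos_iff.mpr ((b.isPos_iff.mp (b.isPos_of_mem_support hj)).trans_le
    (height_le_highestRoot b j))

lemma mark_eq [Nonempty ι] (j : b.support) : (mark b j : ℤ) = rootCoeff b (highestRoot b) j := by
  rw [mark_eq_toNat, Int.toNat_of_nonneg (rootCoeff_nonneg (isPos_highestRoot b) j)]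

variable [P.IsCrystallographic]

/-- A positive root which is maximal with respect to adding simple roots is dominant. -/
lemma pairingIn_nonneg_of_maximal {i : ι} (hi : b.IsPos i)
    (hmax : ∀ k, ∀ j : b.support, P.root k ≠ P.root i + P.root j) (j : b.support) :
    0 ≤ P.pairingIn ℤ i j := by
  by_contra! h
  -- A negative pairing makes the sum a root unless the two roots are opposite, which positivity of
  -- the coefficients excludes.
  obtain ⟨k, hk⟩ := P.root_add_root_mem_of_pairingIn_neg h (by
    intro h0
    have h1 : P.root j = ∑ l : b.support, (-rootCoeff b i l) • P.root l := by
      simp only [neg_smul, Finset.sum_neg_distrib, ← root_eq_sum_rootCoeff, h0, neg_neg]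
    have := rootCoeff_unique b h1 j
    have := rootCoeff_self b j
    have := rootCoeff_nonneg hi j
    omega)
  exact hmax k j hk

variable [P.IsReduced] [P.IsIrreducible]

/-- Irreducibility spreads positivity along the Dynkin diagram. If the coefficient vanished at a
neighbour `m` of the support, the pairing with the co-root of `m` would be a sum of nonpositive
terms, one of them negative, against dominance. -/
lemma rootCoeff_pos_of_dominant {i : ι} (hi : b.IsPos i)
    (hdom : ∀ j : b.support, 0 ≤ P.pairingIn ℤ i j) (j : b.support) : 0 < rootCoeff b i j := by
  obtain ⟨k, hk⟩ := rootCoeff_ne_zero b i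
  have hk : 0 < rootCoeff b i k := (rootCoeff_nonneg hi k).lt_of_ne' hk
  refine b.induction_on_cartanMatrix (fun j ↦ 0 < rootCoeff b i j) hk ?_
  intro l m hl hlm
  by_contra! hm
  have hm0 : rootCoeff b i m = 0 := le_antisymm hm (rootCoeff_nonneg hi m)
  have hne : l ≠ m := by rintro rfl; omega
  have hlm' : P.pairingIn ℤ l m ≠ 0 := fun h ↦ hlm (P.pairingIn_eq_zero_iff.mp h)
  refine absurd (hdom m) (not_le.mpr ?_)
  rw [pairingIn_eq_sum_rootCoeff b]
  refine Finset.sum_neg' (fun k _ ↦ ?_) ⟨l, Finset.mem_univ _, ?_⟩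
  · rcases eq_or_ne k m with rfl | hkm
    · simp [hm0]
    · exact mul_nonpos_of_nonneg_of_nonpos (rootCoeff_nonneg hi k)
        (b.pairingIn_le_zero_of_ne (fun h ↦ hkm (Subtype.ext h)) k.2 m.2)
  · exact mul_neg_of_pos_of_neg hl ((b.pairingIn_le_zero_of_ne
      (fun h ↦ hne (Subtype.ext h)) l.2 m.2).lt_of_ne hlm')

variable [Nonempty ι]

/-- The highest root dominates every root coefficientwise. -/
lemma rootCoeff_le_highestRoot (i : ι) (j : b.support) :
    rootCoeff b i j ≤ rootCoeff b (highestRoot b) j := by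
  by_cases hi : b.IsPos i
  swap
  · exact (rootCoeff_nonpos hi j).trans (rootCoeff_nonneg (isPos_highestRoot b) j)
  -- A root `k` of greatest height among the positive roots above `i` will turn out to be the
  -- highest root. Neither of the two can be raised by a simple root, so both are dominant.
  let S := {k : ι // b.IsPos k ∧ ∀ j, rootCoeff b i j ≤ rootCoeff b k j}
  have : Nonempty S := ⟨⟨i, hi, fun _ ↦ le_rfl⟩⟩
  obtain ⟨⟨k, hk, hik⟩, hmax⟩ := Finite.exists_max (fun k : S ↦ b.height k.1)
  have hk1 : ∀ l, b.IsPos l → (∀ j, rootCoeff b k j ≤ rootCoeff b l j) →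
      b.height l ≤ b.height k := fun l hl h ↦ hmax ⟨l, hl, fun j ↦ (hik j).trans (h j)⟩
  have hkd := pairingIn_nonneg_of_maximal b hk (by
    intro l j hl
    have h1 := b.height_add hl
    have h2 := b.height_one_of_mem_support j.2
    have h3 := hk1 l (b.isPos_iff.mpr (by have := b.isPos_iff.mp hk; omega)) (rootCoeff_add b hl)
    omega)
  have hθd := pairingIn_nonneg_of_maximal b (isPos_highestRoot b) (by
    intro l j hl
    have h1 := b.height_add hl
    have h2 := b.height_one_of_mem_support j.2
    have h3 := height_le_highestRoot b l
    omega)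
  suffices k = highestRoot b from this ▸ hik j
  by_contra hne
  -- Both roots are dominant and `k` has full support, so they pair positively; hence, if distinct,
  -- they differ by a root.
  have hpos : 0 < P.pairingIn ℤ k (highestRoot b) := by
    rw [pairingIn_eq_sum_rootCoeff b]
    have hnn : ∀ j : b.support, 0 ≤ P.pairingIn ℤ j (highestRoot b) := by
      intro j
      rcases (hθd j).eq_or_lt with h | h
      · exact (P.pairingIn_eq_zero_iff.mp h.symm).ge
      · exact ((P.zero_lt_pairingIn_iff' ℤ).mp h).le
    obtain ⟨l, hl, hlp⟩ := (isPos_highestRoot b).exists_mem_support_pos_pairingIn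
    exact Finset.sum_pos' (fun j _ ↦ mul_nonneg (rootCoeff_nonneg hk j) (hnn j))
      ⟨⟨l, hl⟩, Finset.mem_univ _, mul_pos (rootCoeff_pos_of_dominant b hk hkd _) hlp⟩
  obtain ⟨m, hm⟩ := P.root_sub_root_mem_of_pairingIn_pos hpos hne
  have hθ := height_le_highestRoot b k
  have hsub := b.height_sub hm
  -- The difference is negative by height, so `k` lies below the highest root. Maximality of `k`
  -- then forces equal heights, but no root has height zero.
  have hmneg : ¬ b.IsPos m := by rw [b.isPos_iff]; omega
  have hcoef : ∀ j, rootCoeff b k j ≤ rootCoeff b (highestRoot b) j := by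
    intro j
    have := rootCoeff_unique b (i := m)
      (f := fun j ↦ rootCoeff b k j - rootCoeff b (highestRoot b) j)
      (by simp only [sub_smul, Finset.sum_sub_distrib, ← root_eq_sum_rootCoeff, hm]) j
    have := rootCoeff_nonpos hmneg j
    omega
  have h3 := hk1 _ (isPos_highestRoot b) hcoef
  exact b.height_ne_zero m (by omega)

lemma mark_pos (j : b.support) : 0 < mark b j := by
  have h1 := rootCoeff_le_highestRoot b j j
  rw [rootCoeff_self, ← mark_eq] at h1
  omega

end RootCoefficients

/-! ### The Weyl group acting on both spaces at once. -/

section WeylPairs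

variable {ι V T : Type*} [AddCommGroup V] [Module ℝ V] [AddCommGroup T] [Module ℝ T]
  (P : RootPairing ι ℝ V T)

/-- The reflection in a root, acting on both spaces of a root pairing. -/
def reflPair (i : ι) : (V ≃ₗ[ℝ] V) × (T ≃ₗ[ℝ] T) := (P.reflection i, P.coreflection i)

/-- The Weyl group, as a group of pairs of automorphisms of the two spaces. -/
def weylPairs : Subgroup ((V ≃ₗ[ℝ] V) × (T ≃ₗ[ℝ] T)) :=
  Subgroup.closure (Set.range (reflPair P))

lemma reflPair_mem (i : ι) : reflPair P i ∈ weylPairs P :=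
  Subgroup.subset_closure ⟨i, rfl⟩

lemma reflPair_mul_self (i : ι) : reflPair P i * reflPair P i = 1 := by
  ext x <;> simp [reflPair]

lemma reflPair_inv (i : ι) : (reflPair P i)⁻¹ = reflPair P i :=
  inv_eq_of_mul_eq_one_left (reflPair_mul_self P i)

variable {P}

lemma weylPairs_induction {p : (V ≃ₗ[ℝ] V) × (T ≃ₗ[ℝ] T) → Prop}
    (refl : ∀ i, p (reflPair P i)) (one : p 1)
    (mul : ∀ x y, p x → p y → p (x * y)) {w} (hw : w ∈ weylPairs P) : p w := by
  have h := hw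
  rw [weylPairs, ← Subgroup.mem_toSubmonoid, Subgroup.closure_toSubmonoid] at h
  induction h using Submonoid.closure_induction with
  | mem x hx =>
    rcases hx with ⟨i, rfl⟩ | ⟨i, hi⟩
    · exact refl i
    · rw [← inv_inv x, ← hi, reflPair_inv]; exact refl i
  | one => exact one
  | mul x y hx hy h1 h2 =>
    rw [← Subgroup.closure_toSubmonoid] at hx hy
    exact mul x y (h1 hx) (h2 hy)

lemma toLinearMap_weylPairs {w} (hw : w ∈ weylPairs P) :
    ∀ v x, P.toLinearMap (w.1 v) (w.2 x) = P.toLinearMap v x := by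
  refine weylPairs_induction (p := fun w ↦ ∀ v x, P.toLinearMap (w.1 v) (w.2 x) =
    P.toLinearMap v x) (fun i v x ↦ ?_) (fun _ _ ↦ rfl) (fun w w' h h' v x ↦ ?_) hw
  · simp only [reflPair, RootPairing.reflection_apply, RootPairing.coreflection_apply]
    simp only [map_sub, map_smul, LinearMap.sub_apply, LinearMap.smul_apply, smul_eq_mul,
      RootPairing.root_coroot_two]
    simp only [RootPairing.root', RootPairing.coroot',
      LinearMap.flip_apply]
    ring
  · exact (h _ _).trans (h' _ _)

lemma exists_index_weylPairs {w} (hw : w ∈ weylPairs P) :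
    ∀ i, ∃ k, w.1 (P.root i) = P.root k ∧ w.2 (P.coroot i) = P.coroot k := by
  refine weylPairs_induction (p := fun w ↦ ∀ i, ∃ k, w.1 (P.root i) = P.root k ∧
    w.2 (P.coroot i) = P.coroot k) (fun j i ↦ ?_) (fun i ↦ ⟨i, rfl, rfl⟩)
    (fun w w' h h' i ↦ ?_) hw
  · exact ⟨P.reflectionPerm j i, by simp [reflPair], by simp [reflPair]⟩
  · obtain ⟨k, hk1, hk2⟩ := h' i
    obtain ⟨l, hl1, hl2⟩ := h k
    exact ⟨l, by simp [hk1, hl1], by simp [hk2, hl2]⟩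

lemma coroot_of_weylPairs {w} (hw : w ∈ weylPairs P) {i k : ι}
    (h : w.1 (P.root i) = P.root k) : w.2 (P.coroot i) = P.coroot k := by
  obtain ⟨l, h1, h2⟩ := exists_index_weylPairs hw i
  rw [h2, P.root.injective (h1.symm.trans h)]

lemma reflPair_conj {w} (hw : w ∈ weylPairs P) {i k : ι} (h : w.1 (P.root i) = P.root k) :
    w * reflPair P i = reflPair P k * w := by
  have h' := coroot_of_weylPairs hw h
  have hp := toLinearMap_weylPairs hw
  refine Prod.ext (LinearEquiv.ext fun v ↦ ?_) (LinearEquiv.ext fun x ↦ ?_)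
  · have := hp v (P.coroot i)
    rw [h'] at this
    simp [reflPair, RootPairing.reflection_apply, h, RootPairing.coroot', this]
  · have := hp (P.root i) x
    rw [h] at this
    simp [reflPair, RootPairing.coreflection_apply, h', RootPairing.root', this]

lemma finite_weylPairs [Finite ι] [P.IsRootSystem] : Finite (weylPairs P) := by
  choose f hf1 hf2 using fun w : weylPairs P ↦ exists_index_weylPairs w.2
  refine Finite.of_injective f fun w w' h ↦ Subtype.ext (Prod.ext ?_ ?_)
  · refine LinearEquiv.toLinearMap_injective (LinearMap.ext_on_range (v := P.root)
      RootPairing.IsRootSystem.span_root_eq_top fun i ↦ ?_)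
    exact (hf1 w i).trans ((congrArg P.root (congrFun h i)).trans (hf1 w' i).symm)
  · refine LinearEquiv.toLinearMap_injective (LinearMap.ext_on_range (v := P.coroot)
      RootPairing.IsRootSystem.span_coroot_eq_top fun i ↦ ?_)
    exact (hf2 w i).trans ((congrArg P.coroot (congrFun h i)).trans (hf2 w' i).symm)

instance [Finite ι] [P.IsRootSystem] : Fintype (weylPairs P) :=
  @Fintype.ofFinite _ finite_weylPairs

/-- A reflection is a transvection, whose determinant is one plus the value of its functional on its
vector: here `1 - 2`. -/
lemma det_reflection_eq [Module.Finite ℝ V] (i : ι) :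
    LinearMap.det (P.reflection i : V →ₗ[ℝ] V) = -1 := by
  have : (P.reflection i : V →ₗ[ℝ] V) = LinearMap.transvection (-P.coroot' i) (P.root i) := by
    ext v
    simp [RootPairing.reflection_apply, LinearMap.transvection, sub_eq_add_neg]
  rw [this, LinearMap.transvection.det]
  simp
  norm_num

/-- The sign character on pairs. -/
def signPair (w : (V ≃ₗ[ℝ] V) × (T ≃ₗ[ℝ] T)) : ℝ := LinearMap.det (w.1 : V →ₗ[ℝ] V)

lemma signPair_mul (w w' : (V ≃ₗ[ℝ] V) × (T ≃ₗ[ℝ] T)) :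
    signPair (w * w') = signPair w * signPair w' := by
  simp only [signPair, Prod.fst_mul, LinearEquiv.mul_eq_trans, LinearEquiv.coe_trans,
    LinearMap.det_comp]

lemma signPair_one : signPair (1 : (V ≃ₗ[ℝ] V) × (T ≃ₗ[ℝ] T)) = 1 := by
  simp [signPair, LinearEquiv.one_eq_refl]

lemma signPair_reflPair [Module.Finite ℝ V] (i : ι) : signPair (reflPair P i) = -1 :=
  det_reflection_eq i

lemma reflPair_swap (i : ι) : (reflPair P i).swap = reflPair P.flip i := rfl

/-- Keeping both actions in one pair turns the passage to the dual root system into a swap of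
coordinates. -/
lemma swap_mem_weylPairs {w} (hw : w ∈ weylPairs P) : w.swap ∈ weylPairs P.flip :=
  weylPairs_induction (p := fun w ↦ w.swap ∈ weylPairs P.flip)
    (fun i ↦ reflPair_mem P.flip i) (one_mem _) (fun _ _ h h' ↦ mul_mem h h') hw

/-- On reflections both determinants are `-1`. This gives the alternating sums for a root system and
its dual the same signs. -/
lemma signPair_swap [Module.Finite ℝ V] [Module.Finite ℝ T] {w} (hw : w ∈ weylPairs P) :
    signPair w.swap = signPair w := by
  refine weylPairs_induction (p := fun w ↦ signPair w.swap = signPair w)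
    (fun i ↦ ?_) ?_ (fun w w' h h' ↦ ?_) hw
  · rw [reflPair_swap, signPair_reflPair, signPair_reflPair]
  · exact signPair_one.trans signPair_one.symm
  · rw [Prod.swap_mul, signPair_mul, signPair_mul, h, h']

variable (P) in
/-- The Weyl groups of a root pairing and its dual. -/
def weylPairsFlip : weylPairs P ≃ weylPairs P.flip where
  toFun w := ⟨w.1.swap, swap_mem_weylPairs w.2⟩
  invFun w := ⟨w.1.swap, swap_mem_weylPairs (P := P.flip) w.2⟩
  left_inv _ := rfl
  right_inv _ := rfl

/-! ### Words in simple reflections and the exchange condition. -/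

section Words

variable [Finite ι] (b : P.Base)

/-- A product of simple reflections. -/
def word (l : List b.support) : (V ≃ₗ[ℝ] V) × (T ≃ₗ[ℝ] T) :=
  (l.map fun j : b.support ↦ reflPair P (j : ι)).prod

lemma word_append (l l' : List b.support) : word b (l ++ l') = word b l * word b l' := by
  simp [word]

lemma word_cons (j : b.support) (l : List b.support) :
    word b (j :: l) = reflPair P j * word b l := by
  simp [word]

lemma word_mem (l : List b.support) : word b l ∈ weylPairs P :=
  Subgroup.list_prod_mem _ fun x hx ↦ by
    obtain ⟨i, -, rfl⟩ := List.mem_map.mp hx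
    exact reflPair_mem P i

variable {b} in
lemma isPos_neg_iff {i k : ι} (h : P.root k = -P.root i) : b.IsPos k ↔ ¬ b.IsPos i := by
  have h1 : b.height k = b.height i + (-2 : ℤ) • b.height i :=
    b.height_add_zsmul (by rw [h]; module)
  have h2 := b.height_ne_zero i
  rw [b.isPos_iff, b.isPos_iff, h1, smul_eq_mul]
  omega

variable [P.IsCrystallographic] [P.IsReduced]

/-- Every root is reached from simple roots by reflections, and the reflection in `s_j α` is the
conjugate by `s_j` of the reflection in `α`. -/
lemma exists_word_eq {w} (hw : w ∈ weylPairs P) : ∃ l, w = word b l := by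
  refine weylPairs_induction (p := fun w ↦ ∃ l, w = word b l) (fun i ↦ ?_) ⟨[], rfl⟩
    (fun w w' ⟨l, hl⟩ ⟨l', hl'⟩ ↦ ⟨l ++ l', by rw [word_append, hl, hl']⟩) hw
  refine b.induction_reflect i (p := fun i ↦ ∃ l, reflPair P i = word b l)
    (fun i ⟨l, hl⟩ ↦ ⟨l, ?_⟩) (fun j hj ↦ ⟨[⟨j, hj⟩], by simp [word]⟩)
    (fun i j ⟨l, hl⟩ hj ↦ ⟨⟨j, hj⟩ :: (l ++ [⟨j, hj⟩]), ?_⟩)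
  · have := reflPair_conj (P := P) (reflPair_mem P i) (i := i) (k := P.reflectionPerm i i)
      (by simp [reflPair])
    rw [← hl, ← mul_left_inj (reflPair P i), ← this]
  · have := reflPair_conj (P := P) (reflPair_mem P j) (i := i) (k := P.reflectionPerm j i)
      (by simp [reflPair])
    rw [word_cons, word_append, ← hl, ← mul_assoc, this, mul_assoc]
    simp [word, reflPair_mul_self]

/-- The exchange condition. -/
lemma exists_split_of_neg {i : ι} (hi : b.IsPos i) (l : List b.support) :
    ∀ {m : ι}, (word b l).1 (P.root i) = P.root m → ¬ b.IsPos m →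
    ∃ (l₁ : List b.support) (j : b.support) (l₂ : List b.support),
      l = l₁ ++ j :: l₂ ∧ (word b l₂).1 (P.root i) = P.root j := by
  induction l with
  | nil =>
    intro m hm hneg
    exact absurd (P.root.injective hm ▸ hi) hneg
  | cons j l ih =>
    intro m hm hneg
    obtain ⟨k, hk, -⟩ := exists_index_weylPairs (word_mem b l) i
    -- Letters act from right to left. If the root is still positive before `j` acts, then `j` makes
    -- it negative, and a simple reflection does this to no positive root but its own.
    by_cases hkp : b.IsPos k
    · refine ⟨[], j, l, rfl, ?_⟩
      by_cases hkj : k = j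
      · rw [hk, hkj]
      · refine absurd (hkp.reflectionPerm j.2 hkj) ?_
        have : P.root m = P.root (P.reflectionPerm j k) := by
          rw [← hm, word_cons]; simp [hk, reflPair]
        rwa [← P.root.injective this]
    · obtain ⟨l₁, j', l₂, rfl, h⟩ := ih hk hkp
      exact ⟨j :: l₁, j', l₂, rfl, h⟩

lemma word_eq_one_of_isPos (n : ℕ) : ∀ l : List b.support, l.length ≤ n →
    (∀ (j : b.support) (m : ι), (word b l).1 (P.root j) = P.root m → b.IsPos m) →
    word b l = 1 := by
  induction n with
  | zero => intro l hl _; simp [List.length_eq_zero_iff.mp (Nat.le_zero.mp hl), word]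
  | succ n ih =>
    intro l hl hpos
    rcases List.eq_nil_or_concat' l with rfl | ⟨l', k, rfl⟩
    · simp [word]
    obtain ⟨m, hm, -⟩ := exists_index_weylPairs (word_mem b l') k
    obtain ⟨m', hm', -⟩ := exists_index_weylPairs (word_mem b (l' ++ [k])) k
    have hmm : P.root m' = -P.root m := by
      rw [← hm', word_append, ← hm]; simp [word, reflPair]
    -- The last letter negates `α_k`, so the rest of the word must send `α_k` to a negative root,
    -- and the exchange condition applies to it.
    have hneg : ¬ b.IsPos m := (isPos_neg_iff hmm).mp (hpos k m' hm')
    obtain ⟨l₁, j, l₂, rfl, h⟩ := exists_split_of_neg b (b.isPos_of_mem_support k.2) l' hm hneg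
    -- Since `l₂ s_k = s_j l₂`, the letters `j` and `k` cancel.
    have key : word b (l₁ ++ j :: l₂ ++ [k]) = word b (l₁ ++ l₂) := by
      have := reflPair_conj (word_mem b l₂) h
      rw [word_append, word_append, word_append, word_cons, mul_assoc, mul_assoc]
      simp only [word, List.map_cons, List.map_nil, List.prod_cons, List.prod_nil, mul_one] at this ⊢
      rw [this, ← mul_assoc (reflPair P j), reflPair_mul_self, one_mul]
    rw [key] at hpos ⊢
    exact ih _ (by simp at hl ⊢; omega) hpos

/-- An element of the Weyl group preserving positivity of simple roots is trivial. -/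
lemma eq_one_of_isPos {w} (hw : w ∈ weylPairs P)
    (h : ∀ (j : b.support) (m : ι), w.1 (P.root j) = P.root m → b.IsPos m) : w = 1 := by
  obtain ⟨l, rfl⟩ := exists_word_eq b hw
  exact word_eq_one_of_isPos b _ l le_rfl h

end Words

end WeylPairs

/-! ### The canonical invariant form. -/

section InvariantForm

variable {ι V T : Type*} [Finite ι] [AddCommGroup V] [Module ℝ V] [AddCommGroup T] [Module ℝ T]
  (P : RootPairing ι ℝ V T) [P.IsRootSystem]

/-- The canonical invariant form on the coweight space. -/
def coForm (x y : T) : ℝ := letI := Fintype.ofFinite ι; ∑ i, pair P (P.root i) x * pair P (P.root i) y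

variable {P}

lemma coForm_add_left (x y z : T) : coForm P (x + y) z = coForm P x z + coForm P y z := by
  simp [coForm, pair, add_mul, Finset.sum_add_distrib]

lemma coForm_smul_left (c : ℝ) (x z : T) : coForm P (c • x) z = c * coForm P x z := by
  simp [coForm, pair, Finset.mul_sum, mul_assoc]

lemma coForm_comm (x y : T) : coForm P x y = coForm P y x := by
  simp [coForm, mul_comm]

lemma coForm_sub_left (x y z : T) : coForm P (x - y) z = coForm P x z - coForm P y z := by
  simp [coForm, pair, sub_mul, Finset.sum_sub_distrib]

lemma coForm_nonneg (x : T) : 0 ≤ coForm P x x :=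
  Finset.sum_nonneg fun _ _ ↦ mul_self_nonneg _

lemma eq_zero_of_forall_pair_root {x : T} (h : ∀ i, pair P (P.root i) x = 0) : x = 0 :=
  (RootPairing.eq_zero_iff_forall_coroot'_eq_zero (P := P.flip)).mpr h

lemma coForm_pos {x : T} (hx : x ≠ 0) : 0 < coForm P x x := by
  let := Fintype.ofFinite ι
  refine (coForm_nonneg x).lt_of_ne' fun h ↦ hx (eq_zero_of_forall_pair_root (P := P) fun i ↦ ?_)
  have := (Finset.sum_eq_zero_iff_of_nonneg (fun i _ ↦ mul_self_nonneg _)).mp h i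
    (Finset.mem_univ i)
  simpa using this

lemma pair_root_coreflection (i j : ι) (x : T) :
    pair P (P.root j) (P.coreflection i x) = pair P (P.root (P.reflectionPerm i j)) x := by
  have := toLinearMap_weylPairs (reflPair_mem P i) (P.root j) (P.coreflection i x)
  simp only [reflPair, RootPairing.coreflection_same] at this
  rw [pair, ← this, pair, RootPairing.root_reflectionPerm]

lemma coForm_coreflection (i : ι) (x y : T) :
    coForm P (P.coreflection i x) (P.coreflection i y) = coForm P x y := by
  let := Fintype.ofFinite ι
  simp only [coForm, pair_root_coreflection]
  exact Fintype.sum_equiv (P.reflectionPerm i) _ _ fun _ ↦ rfl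

lemma coreflection_eq (i : ι) (x : T) :
    P.coreflection i x = x - pair P (P.root i) x • P.coroot i := P.coreflection_apply i x

lemma pair_root_coroot_self (i : ι) : pair P (P.root i) (P.coroot i) = 2 := P.root_coroot_two i

/-- The form is invariant under the reflection, which negates the co-root. So the sign of the
product with a co-root is the sign of the root. -/
lemma two_mul_coForm_coroot (i : ι) (x : T) :
    2 * coForm P (P.coroot i) x = coForm P (P.coroot i) (P.coroot i) * pair P (P.root i) x := by
  have h := coForm_coreflection (P := P) i (P.coroot i) x
  have h1 : P.coreflection i (P.coroot i) = (-1 : ℝ) • P.coroot i := by simp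
  rw [h1, coForm_smul_left, coreflection_eq, coForm_comm, coForm_sub_left, coForm_smul_left,
    coForm_comm x] at h
  linarith

end InvariantForm

/-! ### The co-root lattice and its short elements. -/

section CorootLattice

variable {ι V T : Type*} [AddCommGroup V] [Module ℝ V] [AddCommGroup T] [Module ℝ T]
  (P : RootPairing ι ℝ V T)

/-- The co-root lattice. -/
def corootLattice : AddSubgroup T := AddSubgroup.closure (Set.range P.coroot)

variable {P}

lemma exists_int_of_mem_corootLattice [P.IsCrystallographic] {q : T} (hq : q ∈ corootLattice P)
    (i : ι) : ∃ z : ℤ, pair P (P.root i) q = z := by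
  induction hq using AddSubgroup.closure_induction with
  | mem x hx =>
    obtain ⟨j, rfl⟩ := hx
    exact ⟨P.pairingIn ℤ i j, (P.algebraMap_pairingIn ℤ i j).symm⟩
  | zero => exact ⟨0, by simp [pair]⟩
  | add x y _ _ hx hy =>
    obtain ⟨a, ha⟩ := hx
    obtain ⟨b, hb⟩ := hy
    exact ⟨a + b, by rw [pair] at *; simp [ha, hb]⟩
  | neg x _ hx =>
    obtain ⟨a, ha⟩ := hx
    exact ⟨-a, by rw [pair] at *; simp [ha]⟩

lemma exists_list_of_mem_corootLattice {q : T} (hq : q ∈ corootLattice P) :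
    ∃ l : List ι, q = (l.map P.coroot).sum := by
  induction hq using AddSubgroup.closure_induction with
  | mem x hx => obtain ⟨j, rfl⟩ := hx; exact ⟨[j], by simp⟩
  | zero => exact ⟨[], by simp⟩
  | add x y _ _ hx hy =>
    obtain ⟨l, rfl⟩ := hx
    obtain ⟨l', rfl⟩ := hy
    exact ⟨l ++ l', by simp⟩
  | neg x _ hx =>
    obtain ⟨l, rfl⟩ := hx
    refine ⟨l.map fun i ↦ P.reflectionPerm i i, ?_⟩
    rename_i hx
    clear hx
    induction l with
    | nil => simp
    | cons i l ih => simpa [add_comm] using ih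

lemma weylPairs_mem_corootLattice {w} (hw : w ∈ weylPairs P) {q : T} (hq : q ∈ corootLattice P) :
    w.2 q ∈ corootLattice P := by
  induction hq using AddSubgroup.closure_induction with
  | mem x hx =>
    obtain ⟨i, rfl⟩ := hx
    obtain ⟨k, -, hk⟩ := exists_index_weylPairs hw i
    exact hk ▸ AddSubgroup.subset_closure ⟨k, rfl⟩
  | zero => simp [zero_mem]
  | add x y _ _ hx hy => rw [map_add]; exact add_mem hx hy
  | neg x _ hx => rw [map_neg]; exact neg_mem hx

/-- The only element of the co-root lattice on which all roots take values in `{-1, 0, 1}` is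
zero. -/
lemma eq_zero_of_forall_abs_pair_le_one [Finite ι] [P.IsRootSystem] [P.IsCrystallographic] {q : T}
    (hq : q ∈ corootLattice P) (h : ∀ i, |pair P (P.root i) q| ≤ 1) : q = 0 := by
  classical
  obtain ⟨l, hl⟩ := exists_list_of_mem_corootLattice hq
  generalize hn : l.length = n
  induction n generalizing l q with
  | zero => simp [hl, List.length_eq_zero_iff.mp hn]
  | succ n ih =>
    by_contra hq0
    -- As `q` is the sum of the listed co-roots and `(q, q) > 0`, some listed co-root has positive
    -- product with `q`.
    obtain ⟨i, hil, hi⟩ : ∃ i ∈ l, 0 < pair P (P.root i) q := by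
      by_contra! hcon
      have key : ∀ l' : List ι, (∀ i ∈ l', pair P (P.root i) q ≤ 0) →
          coForm P (l'.map P.coroot).sum q ≤ 0 := by
        intro l' hl'
        induction l' with
        | nil => simp [coForm, pair]
        | cons i l' ih' =>
          rw [List.map_cons, List.sum_cons, coForm_add_left]
          have h1 := ih' fun j hj ↦ hl' j (List.mem_cons_of_mem _ hj)
          have h2 := two_mul_coForm_coroot (P := P) i q
          have h3 := mul_nonpos_of_nonneg_of_nonpos (coForm_nonneg (P := P) (P.coroot i))
            (hl' i List.mem_cons_self)
          linarith
      have := key l hcon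
      rw [← hl] at this
      exact absurd (coForm_pos (P := P) hq0) (not_lt.mpr this)
    have hi1 : pair P (P.root i) q = 1 := by
      obtain ⟨z, hz⟩ := exists_int_of_mem_corootLattice hq i
      have := h i
      rw [hz] at hi this ⊢
      rw [abs_of_pos hi] at this
      norm_cast at hi this ⊢
      omega
    -- Reflecting removes one listed co-root and keeps the bound on all roots. By induction the
    -- reflected element is zero, so `q` is a co-root, on which its own root takes the value 2.
    have hs : P.coreflection i q = q - P.coroot i := by rw [coreflection_eq, hi1, one_smul]
    have h0 := ih (q := P.coreflection i q) (weylPairs_mem_corootLattice (reflPair_mem P i) hq)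
      (fun j ↦ by rw [pair_root_coreflection]; exact h _) (l.erase i)
      (by
        rw [hs, hl, sub_eq_iff_eq_add', ← List.sum_cons, ← List.map_cons]
        exact ((List.perm_cons_erase hil).map _).sum_eq)
      (by rw [List.length_erase_of_mem hil]; omega)
    rw [hs, sub_eq_zero] at h0
    have := h i
    rw [h0, pair_root_coroot_self] at this
    norm_num at this

end CorootLattice

/-! ### Points of the simplex in integer coordinates. -/

section Coordinates

variable {ι V T : Type*} [Finite ι] [AddCommGroup V] [Module ℝ V] [AddCommGroup T] [Module ℝ T]
  {P : RootPairing ι ℝ V T} (b : P.Base)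

lemma pair_root_eq_sum (i : ι) (x : T) :
    pair P (P.root i) x = ∑ j : b.support, (rootCoeff b i j : ℝ) * pair P (P.root j) x := by
  have := congrArg (fun v ↦ pair P v x) (root_eq_sum_rootCoeff b i)
  simpa [pair] using this

variable [P.IsRootSystem]

lemma exists_pair_root_eq (k : b.support → ℝ) :
    ∃ x : T, ∀ j : b.support, pair P (P.root j) x = k j := by
  refine ⟨P.flip.toPerfPair.symm (b.toWeightBasis.constr ℝ k), fun j ↦ ?_⟩
  have := LinearMap.congr_fun (P.flip.toPerfPair.apply_symm_apply (b.toWeightBasis.constr ℝ k))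
    (P.root j)
  rw [← b.toWeightBasis_apply j, Basis.constr_basis] at this
  rw [← b.toWeightBasis_apply j]
  exact this

/-- The element of the coweight space with given values on the simple roots. -/
def ofCoords (k : b.support → ℝ) : T := (exists_pair_root_eq b k).choose

@[simp] lemma pair_root_ofCoords (k : b.support → ℝ) (j : b.support) :
    pair P (P.root j) (ofCoords b k) = k j := (exists_pair_root_eq b k).choose_spec j

lemma ext_pair_root {x y : T} (h : ∀ j : b.support, pair P (P.root j) x = pair P (P.root j) y) :
    x = y := by
  rw [← sub_eq_zero]
  refine eq_zero_of_forall_pair_root (P := P) fun i ↦ ?_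
  rw [pair, map_sub, sub_eq_zero]
  change pair P _ x = pair P _ y
  rw [pair_root_eq_sum b, pair_root_eq_sum b i y]
  simp [h]

lemma mem_coweightLattice_iff {y : T} :
    y ∈ coweightLattice P ↔ ∀ j : b.support, ∃ z : ℤ, pair P (P.root j) y = z := by
  refine ⟨fun h j ↦ h j, fun h i ↦ ?_⟩
  choose z hz using h
  refine ⟨∑ j, rootCoeff b i j * z j, ?_⟩
  rw [pair_root_eq_sum b]
  simp [hz]

variable [Nonempty ι]

lemma pair_highestRoot (x : T) :
    pair P (P.root (highestRoot b)) x = ∑ j : b.support, (mark b j : ℝ) * pair P (P.root j) x := by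
  rw [pair_root_eq_sum b]
  refine Finset.sum_congr rfl fun j _ ↦ ?_
  rw [← mark_eq]
  simp

/-- Lattice points of the closed simplex, in coordinates. -/
def closedPoints (m : b.support → ℕ) (M : ℕ) : Set (b.support → ℕ) := {k | ∑ j, m j * k j ≤ M}

/-- Lattice points of the open simplex, in coordinates. -/
def openPoints (m : b.support → ℕ) (N : ℕ) : Set (b.support → ℕ) :=
  {k | (∀ j, 0 < k j) ∧ ∑ j, m j * k j < N}

lemma finite_closedPoints {m : b.support → ℕ} (hm : ∀ j, 0 < m j) (M : ℕ) :
    (closedPoints b m M).Finite := by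
  refine (Set.Finite.pi' (fun _ : b.support ↦ Set.finite_Iic M)).subset fun k hk j ↦ ?_
  calc k j ≤ m j * k j := Nat.le_mul_of_pos_left _ (hm j)
    _ ≤ ∑ j, m j * k j := Finset.single_le_sum (f := fun j ↦ m j * k j) (fun _ _ ↦ Nat.zero_le _)
        (Finset.mem_univ j)
    _ ≤ M := hk

/-- Adding one to every coordinate raises the weighted sum by `∑ m_j`, and the remaining 1 turns `≤`
into `<`. The weights are arbitrary so that co-marks are covered too. -/
lemma openPoints_add_eq_image (m : b.support → ℕ) (M : ℕ) :
    openPoints b m (M + (1 + ∑ j, m j)) = (fun k j ↦ k j + 1) '' closedPoints b m M := by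
  ext k
  constructor
  · rintro ⟨h1, h2⟩
    refine ⟨fun j ↦ k j - 1, ?_, funext fun j ↦ Nat.sub_add_cancel (h1 j)⟩
    have : ∑ j, m j * k j = ∑ j, m j * (k j - 1) + ∑ j, m j := by
      rw [← Finset.sum_add_distrib]
      exact Finset.sum_congr rfl fun j _ ↦ by
        rw [← Nat.mul_succ, Nat.succ_eq_add_one, Nat.sub_add_cancel (h1 j)]
    simp only [closedPoints, Set.mem_ofPred_eq]
    omega
  · rintro ⟨k, hk, rfl⟩
    refine ⟨fun j ↦ Nat.succ_pos _, ?_⟩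
    simp only [closedPoints, Set.mem_ofPred_eq] at hk
    simp only [mul_add, mul_one, Finset.sum_add_distrib]
    omega

lemma encard_openPoints_add (m : b.support → ℕ) (M : ℕ) :
    (openPoints b m (M + (1 + ∑ j, m j))).encard = (closedPoints b m M).encard := by
  rw [openPoints_add_eq_image]
  refine Function.Injective.encard_image (fun k k' h ↦ funext fun j ↦ ?_) _
  simpa using congrFun h j

/-- The point of adjoint order `N` with given coordinates. -/
def efoPoint (N : ℕ) (k : b.support → ℕ) : T := (1 / (N : ℝ)) • ofCoords b (fun j ↦ (k j : ℝ))

lemma pair_root_efoPoint (N : ℕ) (k : b.support → ℕ) (j : b.support) :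
    pair P (P.root j) (efoPoint b N k) = k j / N := by
  have := pair_root_ofCoords b (fun j ↦ (k j : ℝ)) j
  rw [pair] at this
  rw [efoPoint, pair, map_smul, this, smul_eq_mul]
  ring

lemma efoPoint_injective {N : ℕ} (hN : 0 < N) : Function.Injective (efoPoint b N) := by
  intro k k' h
  funext j
  have := congrArg (pair P (P.root j)) h
  rw [pair_root_efoPoint, pair_root_efoPoint] at this
  have hN' : (N : ℝ) ≠ 0 := by positivity
  field_simp at this
  exact_mod_cast this

lemma efoPoint_mem_adjointOrder (N : ℕ) (k : b.support → ℕ) :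
    efoPoint b N k ∈ adjointOrder P N :=
  ⟨_, (mem_coweightLattice_iff b).mpr fun j ↦ ⟨k j, by simp⟩, rfl⟩

lemma exists_eq_efoPoint {N : ℕ} (hN : 0 < N) {x : T} (hx : x ∈ adjointOrder P N)
    (h : ∀ j ∈ b.support, 0 ≤ pair P (P.root j) x) : ∃ k, x = efoPoint b N k := by
  have hN' : (0 : ℝ) < N := by positivity
  obtain ⟨y, hy, rfl⟩ := hx
  choose z hz using hy
  have hz0 : ∀ j : b.support, 0 ≤ z j := by
    intro j
    have := h j j.2
    rw [pair, map_smul, smul_eq_mul] at this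
    change 0 ≤ 1 / (N : ℝ) * pair P (P.root j) y at this
    rw [hz] at this
    have := (mul_nonneg_iff_of_pos_left (by positivity)).mp this
    exact_mod_cast this
  refine ⟨fun j ↦ (z j).toNat, congrArg _ (ext_pair_root b fun j ↦ ?_)⟩
  have : (((z j).toNat : ℤ) : ℝ) = z j := by rw [Int.toNat_of_nonneg (hz0 j)]
  rw [pair_root_ofCoords, hz]
  exact_mod_cast this.symm

lemma pair_highestRoot_efoPoint (N : ℕ) (k : b.support → ℕ) :
    pair P (P.root (highestRoot b)) (efoPoint b N k) = (∑ j, mark b j * k j : ℕ) / N := by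
  rw [pair_highestRoot]
  simp [pair_root_efoPoint, Finset.sum_div, mul_div_assoc]

lemma openChamberEFO_eq_image {N : ℕ} (hN : 0 < N) :
    openChamberEFO b N = efoPoint b N '' openPoints b (mark b) N := by
  have hN' : (0 : ℝ) < N := by positivity
  ext x
  constructor
  · rintro ⟨⟨h1, h2⟩, hx⟩
    obtain ⟨k, rfl⟩ := exists_eq_efoPoint b hN hx fun j hj ↦ (h1 j hj).le
    refine ⟨k, ⟨fun j ↦ ?_, ?_⟩, rfl⟩
    · have := h1 j j.2
      rw [pair_root_efoPoint, div_pos_iff_of_pos_right hN'] at this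
      exact_mod_cast this
    · rw [pair_highestRoot_efoPoint, div_lt_one hN'] at h2
      exact_mod_cast h2
  · rintro ⟨k, ⟨h1, h2⟩, rfl⟩
    refine ⟨⟨fun j hj ↦ ?_, ?_⟩, efoPoint_mem_adjointOrder b N k⟩
    · have := h1 ⟨j, hj⟩
      rw [pair_root_efoPoint b N k ⟨j, hj⟩]
      positivity
    · rw [pair_highestRoot_efoPoint, div_lt_one hN']
      exact_mod_cast h2

lemma encard_openChamberEFO {N : ℕ} (hN : 0 < N) :
    (openChamberEFO b N).encard = (openPoints b (mark b) N).encard := by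
  rw [openChamberEFO_eq_image b hN]
  exact (efoPoint_injective b hN).encard_image _

lemma coxeterNumber_pos : 0 < coxeterNumber b := by rw [coxeterNumber]; omega

lemma encard_openChamberEFO_add (M : ℕ) :
    (openChamberEFO b (M + coxeterNumber b)).encard = (closedPoints b (mark b) M).encard := by
  rw [encard_openChamberEFO b (by have := coxeterNumber_pos b; omega), coxeterNumber,
    encard_openPoints_add]

variable [P.IsCrystallographic] [P.IsReduced] [P.IsIrreducible]

lemma encard_chamberEFO (M : ℕ) :
    (chamberEFO b M).encard = (closedPoints b (mark b) M).encard := by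
  -- For `M = 0` the convention `1 / 0 = 0` leaves only the origin, and positivity of the marks
  -- leaves only the zero vector.
  rcases Nat.eq_zero_or_pos M with rfl | hM
  · have h1 : chamberEFO b 0 = {0} := by
      ext x
      constructor
      · rintro ⟨-, y, -, rfl⟩; simp
      · rintro rfl
        exact ⟨⟨fun j _ ↦ by simp [pair], by simp [pair]⟩, 0, fun i ↦ ⟨0, by simp [pair]⟩, by simp⟩
    have h2 : closedPoints b (mark b) 0 = {0} := by
      ext k
      simp only [closedPoints, Set.mem_ofPred_eq, Set.mem_singleton_iff, Nat.le_zero,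
        Finset.sum_eq_zero_iff, Finset.mem_univ, true_imp_iff, mul_eq_zero, (mark_pos b _).ne',
        false_or]
      exact ⟨fun h ↦ funext h, fun h j ↦ congrFun h j⟩
    simp [h1, h2]
  · have hM' : (0 : ℝ) < M := by positivity
    rw [← (efoPoint_injective b hM).encard_image]
    congr 1
    ext x
    constructor
    · rintro ⟨⟨h1, h2⟩, hx⟩
      obtain ⟨k, rfl⟩ := exists_eq_efoPoint b hM hx h1
      refine ⟨k, ?_, rfl⟩
      rw [pair_highestRoot_efoPoint, div_le_one hM'] at h2
      exact_mod_cast h2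
    · rintro ⟨k, hk, rfl⟩
      refine ⟨⟨fun j hj ↦ ?_, ?_⟩, efoPoint_mem_adjointOrder b M k⟩
      · rw [pair_root_efoPoint b M k ⟨j, hj⟩]
        positivity
      · rw [pair_highestRoot_efoPoint, div_le_one hM']
        exact_mod_cast hk

lemma finite_openChamberEFO_add (M : ℕ) : (openChamberEFO b (M + coxeterNumber b)).Finite := by
  rw [← Set.encard_lt_top_iff, encard_openChamberEFO_add, Set.encard_lt_top_iff]
  exact finite_closedPoints b (mark_pos b) M

lemma encard_monomialsLE (M : ℕ) :
    (monomialsLE b M).encard = (closedPoints b (comark b) M).encard := by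
  have h1 : monomialsLE b M = (fun k : b.support → ℕ ↦
      MvPolynomial.monomial (Finsupp.equivFunOnFinite.symm k) (1 : ℂ)) ''
        closedPoints b (comark b) M := by
    have hdeg : ∀ k : b.support →₀ ℕ, mDegree b k = ∑ j, comark b j * k j := by
      intro k
      rw [mDegree, Finsupp.weight_apply, Finsupp.sum_fintype _ _ (by simp)]
      simp [mul_comm]
    ext p
    constructor
    · rintro ⟨l, hl, rfl⟩
      exact ⟨l, (hdeg l).symm.trans_le hl, by simp⟩
    · rintro ⟨k, hk, rfl⟩
      exact ⟨Finsupp.equivFunOnFinite.symm k, (hdeg _).trans_le (by simpa [closedPoints] using hk), rfl⟩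
  rw [h1]
  exact Function.Injective.encard_image
    ((MvPolynomial.monomial_left_injective one_ne_zero).comp (Equiv.injective _)) _

end Coordinates

/-! ### The Weyl group acting on co-weights modulo `N` times the co-roots. -/

section Quotient

variable {ι V T : Type*} [AddCommGroup V] [Module ℝ V] [AddCommGroup T] [Module ℝ T]
  (P : RootPairing ι ℝ V T)

/-- The co-weight lattice as a subgroup. -/
def coweightSubgroup : AddSubgroup T where
  carrier := coweightLattice P
  zero_mem' i := ⟨0, by simp [pair]⟩
  add_mem' {x y} hx hy i := by
    obtain ⟨a, ha⟩ := hx i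
    obtain ⟨b, hb⟩ := hy i
    exact ⟨a + b, by rw [pair] at *; simp [ha, hb]⟩
  neg_mem' {x} hx i := by
    obtain ⟨a, ha⟩ := hx i
    exact ⟨-a, by rw [pair] at *; simp [ha]⟩

variable {P} in
lemma weylPairs_mem_coweightSubgroup {w} (hw : w ∈ weylPairs P) {y : T}
    (hy : y ∈ coweightSubgroup P) : w.2 y ∈ coweightSubgroup P := by
  intro i
  obtain ⟨k, hk, -⟩ := exists_index_weylPairs (inv_mem hw) i
  obtain ⟨z, hz⟩ := hy k
  refine ⟨z, ?_⟩
  rw [← hz, ← hk, pair, pair, ← toLinearMap_weylPairs (inv_mem hw)]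
  simp

variable (N : ℕ)

/-- The multiples by `N` of the co-root lattice, inside the co-weight lattice. -/
def scaledCoroots : AddSubgroup (coweightSubgroup P) :=
  ((corootLattice P).map (nsmulAddMonoidHom N)).addSubgroupOf (coweightSubgroup P)

variable {P N} in
lemma mem_scaledCoroots {y : coweightSubgroup P} :
    y ∈ scaledCoroots P N ↔ ∃ q ∈ corootLattice P, (y : T) = N • q := by
  simp [scaledCoroots, AddSubgroup.mem_addSubgroupOf, eq_comm]

/-- The co-weight lattice modulo `N` times the co-root lattice. -/
abbrev CoweightQuotient : Type _ := coweightSubgroup P ⧸ scaledCoroots P N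

variable {P}

/-- The action of a Weyl group element on the co-weight lattice. -/
def coweightMap (w : weylPairs P) : coweightSubgroup P →+ coweightSubgroup P where
  toFun y := ⟨w.1.2 y, weylPairs_mem_coweightSubgroup w.2 y.2⟩
  map_zero' := by simp
  map_add' _ _ := by simp

@[simp] lemma coe_coweightMap (w : weylPairs P) (y : coweightSubgroup P) :
    (coweightMap w y : T) = w.1.2 y := rfl

/-- The action of a Weyl group element on the quotient of the co-weight lattice. -/
def quotientMap (w : weylPairs P) : CoweightQuotient P N →+ CoweightQuotient P N :=
  QuotientAddGroup.map _ _ (coweightMap w) (by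
    intro y hy
    obtain ⟨q, hq, h⟩ := mem_scaledCoroots.mp hy
    exact mem_scaledCoroots.mpr ⟨w.1.2 q, weylPairs_mem_corootLattice w.2 hq, by simp [h]⟩)

variable {N}

lemma quotientMap_mk (w : weylPairs P) (y : coweightSubgroup P) :
    quotientMap N w (y : CoweightQuotient P N) = (coweightMap w y : coweightSubgroup P) := rfl

lemma quotientMap_mul (w w' : weylPairs P) (a : CoweightQuotient P N) :
    quotientMap N (w * w') a = quotientMap N w (quotientMap N w' a) := by
  induction a using QuotientAddGroup.induction_on with
  | H y => rfl

lemma quotientMap_one (a : CoweightQuotient P N) : quotientMap N (1 : weylPairs P) a = a := by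
  induction a using QuotientAddGroup.induction_on with
  | H y => rfl

lemma mk_eq_mk_iff {y y' : coweightSubgroup P} :
    (y : CoweightQuotient P N) = y' ↔ ∃ q ∈ corootLattice P, (y' : T) = y + N • q := by
  rw [QuotientAddGroup.eq, mem_scaledCoroots]
  simp only [AddSubgroup.coe_add, NegMemClass.coe_neg, neg_add_eq_iff_eq_add]

/-- A Weyl group element as a reflection. -/
def reflElt (P : RootPairing ι ℝ V T) (i : ι) : weylPairs P := ⟨reflPair P i, reflPair_mem P i⟩

/-- A class is regular if no reflection fixes it. -/
def IsRegularClass (a : CoweightQuotient P N) : Prop := ∀ i, quotientMap N (reflElt P i) a ≠ a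

/-- Conjugation by `w⁻¹` takes a reflection fixing `w a` to a reflection fixing `a`. -/
lemma isRegularClass_quotientMap {a : CoweightQuotient P N} (ha : IsRegularClass a)
    (w : weylPairs P) : IsRegularClass (quotientMap N w a) := by
  intro i hi
  obtain ⟨k, hk, -⟩ := exists_index_weylPairs (w⁻¹).2 i
  have h : w⁻¹ * reflElt P i = reflElt P k * w⁻¹ := Subtype.ext (reflPair_conj (w⁻¹).2 hk)
  refine ha k ?_
  have := congrArg (quotientMap N w⁻¹) hi
  rw [← quotientMap_mul w⁻¹ (reflElt P i), h, quotientMap_mul (reflElt P k),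
    ← quotientMap_mul w⁻¹ w, inv_mul_cancel, quotientMap_one] at this
  exact this

end Quotient

/-! ### Linearity of the pairing. -/

section PairLemmas

variable {ι V T : Type*} [AddCommGroup V] [Module ℝ V] [AddCommGroup T] [Module ℝ T]
  {P : RootPairing ι ℝ V T}

lemma pair_add (v : V) (x y : T) : pair P v (x + y) = pair P v x + pair P v y := map_add _ _ _

lemma pair_sub (v : V) (x y : T) : pair P v (x - y) = pair P v x - pair P v y := map_sub _ _ _

lemma pair_smul (v : V) (c : ℝ) (x : T) : pair P v (c • x) = c * pair P v x := by simp [pair]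

lemma pair_nsmul (v : V) (n : ℕ) (x : T) : pair P v (n • x) = n * pair P v x := by simp [pair]

end PairLemmas

/-! ### The alcove as a fundamental domain. -/

section Alcove

variable {ι V T : Type*} [Finite ι] [AddCommGroup V] [Module ℝ V] [AddCommGroup T] [Module ℝ T]
  {P : RootPairing ι ℝ V T} (b : P.Base) [P.IsRootSystem] [Nonempty ι]

/-- The co-weights in the open simplex `N F°`. -/
def openAlcove (N : ℕ) : Set (coweightSubgroup P) :=
  {y | (∀ j : b.support, 0 < pair P (P.root j) y) ∧ pair P (P.root (highestRoot b)) y < N}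

/-- The co-weights in the closed simplex `N F`. -/
def closedAlcove (N : ℕ) : Set (coweightSubgroup P) :=
  {y | (∀ j : b.support, 0 ≤ pair P (P.root j) y) ∧ pair P (P.root (highestRoot b)) y ≤ N}

/-- The element on which all simple roots take the value one. -/
def coRho : T := ofCoords b fun _ ↦ 1

lemma pair_root_coRho (i : ι) : pair P (P.root i) (coRho b) = b.height i := by
  rw [pair_root_eq_sum b, height_eq_sum_rootCoeff]
  simp [coRho]

lemma height_highestRoot : b.height (highestRoot b) + 1 = coxeterNumber b := by
  rw [height_eq_sum_rootCoeff, coxeterNumber]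
  simp [mark_eq, add_comm]

/-- A quadratic function of co-weights, measuring the distance to an interior point of the
simplex `N F`. -/
def alcoveEnergy (N : ℕ) (y : T) : ℝ :=
  coForm P ((coxeterNumber b : ℝ) • y - (N : ℝ) • coRho b)
    ((coxeterNumber b : ℝ) • y - (N : ℝ) • coRho b)

/-- Roots are integral on co-weights and equal their heights on `coRho`, so the energy is a sum of
squares of integers. Being a natural number, it attains a minimum on each orbit. -/
lemma exists_nat_alcoveEnergy (N : ℕ) {y : T} (hy : y ∈ coweightLattice P) :
    ∃ n : ℕ, alcoveEnergy b N y = n := by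
  let := Fintype.ofFinite ι
  choose z hz using hy
  refine ⟨∑ i, ((coxeterNumber b * z i - N * b.height i) ^ 2).natAbs, ?_⟩
  simp only [alcoveEnergy, coForm, pair_sub, pair_smul, hz, pair_root_coRho]
  push_cast
  refine Finset.sum_congr rfl fun i _ ↦ ?_
  rw [Nat.cast_natAbs, abs_of_nonneg (sq_nonneg _)]
  push_cast
  ring

/-- The point is reflected in the hyperplane `α = kN`. The last two factors tell on which side of it
`y` and the centre `N ρ̌ / h` lie, so the energy drops when they are separated. -/
lemma alcoveEnergy_reflect (N : ℕ) (y : T) (i : ι) (k : ℝ) :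
    alcoveEnergy b N (P.coreflection i y + (k * N) • P.coroot i) = alcoveEnergy b N y +
      coForm P (P.coroot i) (P.coroot i) * coxeterNumber b * N * (pair P (P.root i) y - k * N) *
        (b.height i - coxeterNumber b * k) := by
  set h : ℝ := ((coxeterNumber b : ℕ) : ℝ)
  set c : ℝ := pair P (P.root i) y - k * N
  have h1 : h • (P.coreflection i y + (k * N) • P.coroot i) - (N : ℝ) • coRho b =
      (h • y - (N : ℝ) • coRho b) - (h * c) • P.coroot i := by
    rw [coreflection_eq]; module
  have h2 := two_mul_coForm_coroot (P := P) i (h • y - (N : ℝ) • coRho b)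
  have h3 : pair P (P.root i) (h • y - (N : ℝ) • coRho b) =
      h * (c + k * N) - N * b.height i := by
    rw [pair_sub, pair_smul, pair_smul, pair_root_coRho]; simp [c]
  rw [alcoveEnergy, alcoveEnergy, h1]
  generalize h • y - (N : ℝ) • coRho b = u at *
  rw [coForm_sub_left, coForm_comm u, coForm_comm _ (u - _), coForm_sub_left, coForm_sub_left,
    coForm_smul_left, coForm_smul_left, coForm_comm (P.coroot i) ((h * c) • _),
    coForm_comm u ((h * c) • _), coForm_smul_left, coForm_smul_left]
  rw [h3] at h2
  linear_combination (-h * c) * h2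

lemma coForm_coroot_pos (i : ι) : 0 < coForm P (P.coroot i) (P.coroot i) :=
  coForm_pos (P.flip.ne_zero i)

variable [P.IsCrystallographic]

/-- Every co-weight is conjugate under the affine Weyl group to one in the closed simplex. -/
lemma exists_closedAlcove {N : ℕ} (hN : 0 < N) (y : coweightSubgroup P) :
    ∃ w : weylPairs P, ∃ y' ∈ closedAlcove b N,
      (coweightMap w y : CoweightQuotient P N) = (y' : CoweightQuotient P N) := by
  choose E hE using fun y : coweightSubgroup P ↦ exists_nat_alcoveEnergy b N y.2
  let S : Set (coweightSubgroup P) := {y' | ∃ w : weylPairs P,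
    (coweightMap w y : CoweightQuotient P N) = (y' : CoweightQuotient P N)}
  have hS : S.Nonempty := ⟨coweightMap 1 y, 1, rfl⟩
  obtain ⟨w, hw⟩ : Function.argminOn E S hS ∈ S := Function.argminOn_mem E S hS
  set y' := Function.argminOn E S hS
  -- No affine reflection lowers the energy of a minimizer.
  have key : ∀ (i : ι) (k : ℕ), 0 ≤ (pair P (P.root i) y' - k * N) *
      (b.height i - coxeterNumber b * k) := by
    intro i k
    have hq : (k : ℤ) • P.coroot i ∈ corootLattice P :=
      zsmul_mem (AddSubgroup.subset_closure (Set.mem_range_self i)) _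
    have hmem : P.coreflection i (y' : T) + ((k : ℝ) * N) • P.coroot i ∈ coweightSubgroup P := by
      refine add_mem (weylPairs_mem_coweightSubgroup (reflPair_mem P i) y'.2) fun l ↦ ?_
      have hi : P.coroot i ∈ corootLattice P := AddSubgroup.subset_closure ⟨i, rfl⟩
      obtain ⟨z, hz⟩ := exists_int_of_mem_corootLattice hi l
      exact ⟨k * N * z, by rw [pair_smul, hz]; push_cast; ring⟩
    have hle : E y' ≤ E ⟨_, hmem⟩ := by
      refine Function.argminOn_le E S ⟨reflElt P i * w, ?_⟩
      have h1 : (coweightMap (reflElt P i * w) y : CoweightQuotient P N) =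
          coweightMap (reflElt P i) y' := by
        have := congrArg (quotientMap N (reflElt P i)) hw
        rwa [quotientMap_mk, quotientMap_mk] at this
      rw [h1, mk_eq_mk_iff]
      refine ⟨_, hq, ?_⟩
      simp only [coe_coweightMap, reflElt, reflPair]
      congr 1
      rw [mul_comm, mul_smul, natCast_zsmul, Nat.cast_smul_eq_nsmul, Nat.cast_smul_eq_nsmul]
    have hle' : (E y' : ℝ) ≤ E ⟨_, hmem⟩ := by exact_mod_cast hle
    rw [← hE, ← hE, alcoveEnergy_reflect, le_add_iff_nonneg_right, mul_assoc] at hle'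
    have h0 : 0 < coForm P (P.coroot i) (P.coroot i) * coxeterNumber b * N :=
      mul_pos (mul_pos (coForm_coroot_pos i) (by exact_mod_cast coxeterNumber_pos b))
        (by exact_mod_cast hN)
    exact (mul_nonneg_iff_of_pos_left h0).mp hle'
  -- The walls of the alcove are `k = 0` for simple roots, of height 1, and `k = 1` for the highest
  -- root, where height minus `h` is `-1`.
  refine ⟨w, y', ⟨fun j ↦ ?_, ?_⟩, hw⟩
  · have := key j 0
    rw [RootPairing.Base.height_one_of_mem_support j.2] at this
    simpa using this
  · have := key (highestRoot b) 1
    have h2 : (b.height (highestRoot b) : ℝ) - coxeterNumber b * (1 : ℕ) = -1 := by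
      have : (b.height (highestRoot b) : ℝ) + 1 = coxeterNumber b := by
        exact_mod_cast height_highestRoot b
      push_cast
      linarith
    rw [h2] at this
    simp at this
    linarith

variable [P.IsReduced] [P.IsIrreducible]

lemma pair_root_pos_of_mem_openAlcove {N : ℕ} {y : coweightSubgroup P} (hy : y ∈ openAlcove b N)
    {i : ι} (hi : b.IsPos i) : 0 < pair P (P.root i) y ∧ pair P (P.root i) y < N := by
  constructor
  · rw [pair_root_eq_sum b]
    obtain ⟨j, hj⟩ := rootCoeff_ne_zero b i
    exact Finset.sum_pos' (fun j _ ↦ mul_nonneg (by exact_mod_cast rootCoeff_nonneg hi j)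
      (hy.1 j).le) ⟨j, Finset.mem_univ _, mul_pos
        (by exact_mod_cast (rootCoeff_nonneg hi j).lt_of_ne' hj) (hy.1 j)⟩
  · refine lt_of_le_of_lt ?_ hy.2
    rw [pair_root_eq_sum b, pair_root_eq_sum b (highestRoot b)]
    exact Finset.sum_le_sum fun j _ ↦ mul_le_mul_of_nonneg_right
      (by exact_mod_cast rootCoeff_le_highestRoot b i j) (hy.1 j).le

lemma pair_root_neg_of_mem_openAlcove {N : ℕ} {y : coweightSubgroup P} (hy : y ∈ openAlcove b N)
    {i : ι} (hi : ¬ b.IsPos i) : pair P (P.root i) y < 0 ∧ -N < pair P (P.root i) y := by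
  have h : P.root (P.reflectionPerm i i) = -P.root i := by simp
  have h1 := pair_root_pos_of_mem_openAlcove b hy ((isPos_neg_iff h).mpr hi)
  have h2 : pair P (P.root (P.reflectionPerm i i)) (y : T) = -pair P (P.root i) y := by
    rw [h]; simp [pair]
  rw [h2] at h1
  constructor <;> linarith [h1.1, h1.2]

/-- The action of the affine Weyl group on the translates of the open simplex is free. -/
lemma eq_one_of_mem_openAlcove {N : ℕ} (hN : 0 < N) {y y' : coweightSubgroup P}
    (hy : y ∈ openAlcove b N) (hy' : y' ∈ openAlcove b N) {w : weylPairs P}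
    (h : (coweightMap w y : CoweightQuotient P N) = (y' : CoweightQuotient P N)) :
    w = 1 ∧ y = y' := by
  have hN' : (0 : ℝ) < N := by exact_mod_cast hN
  obtain ⟨q, hq, h⟩ := mk_eq_mk_iff.mp h
  have hpair : ∀ i k, w.1.1 (P.root i) = P.root k →
      pair P (P.root k) y' = pair P (P.root i) y + N * pair P (P.root k) q := by
    intro i k hik
    rw [h, pair_add, pair_nsmul, coe_coweightMap]
    congr 1
    rw [← hik]
    exact toLinearMap_weylPairs w.2 _ _
  -- On both points every root lies strictly between `-N` and `N`, so the integers `⟨α, q⟩` lie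
  -- strictly between `-2` and `2`.
  have hq0 : q = 0 := by
    refine eq_zero_of_forall_abs_pair_le_one hq fun k ↦ ?_
    obtain ⟨i, hi, -⟩ := exists_index_weylPairs (w⁻¹).2 k
    have hik : w.1.1 (P.root i) = P.root k := by rw [← hi]; simp
    have h1 := hpair i k hik
    obtain ⟨z, hz⟩ := exists_int_of_mem_corootLattice hq k
    have hb : ∀ {y : coweightSubgroup P} (i : ι), y ∈ openAlcove b N →
        -N < pair P (P.root i) y ∧ pair P (P.root i) y < N := by
      intro y i hy
      by_cases hi : b.IsPos i
      · have := pair_root_pos_of_mem_openAlcove b hy hi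
        exact ⟨by linarith [this.1], this.2⟩
      · have := pair_root_neg_of_mem_openAlcove b hy hi
        exact ⟨this.2, by linarith [this.1]⟩
    have h2 := hb i hy
    have h3 := hb k hy'
    rw [hz] at h1 ⊢
    have h4 : (z : ℝ) < 2 := by
      by_contra! h'
      nlinarith [h2.1, h3.2]
    have h5 : (-2 : ℝ) < z := by
      by_contra! h'
      nlinarith [h2.2, h3.1]
    have h6 : z < 2 := by exact_mod_cast h4
    have h7 : -2 < z := by exact_mod_cast h5
    have h8 : |z| ≤ 1 := abs_le.mpr ⟨by omega, by omega⟩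
    exact_mod_cast h8
  have hw : w = 1 := by
    -- Without translation, `w α_j` takes on `y'` the positive value of `α_j` on `y`, so it is a
    -- positive root.
    refine Subtype.ext (eq_one_of_isPos b w.2 fun j m hm ↦ ?_)
    by_contra hneg
    have h1 := hpair j m hm
    rw [hq0] at h1
    have h2 := (pair_root_neg_of_mem_openAlcove b hy' hneg).1
    have h3 := hy.1 j
    simp [pair] at h1 h2 h3
    linarith
  refine ⟨hw, Subtype.ext ?_⟩
  rw [h, hq0, hw]
  simp

lemma finite_closedAlcove {N : ℕ} : (closedAlcove b N).Finite := by
  choose z hz using fun (y : coweightSubgroup P) (j : b.support) ↦ y.2 j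
  refine Set.Finite.of_finite_image (f := z) ?_ ?_
  · refine (Set.Finite.pi' (fun _ : b.support ↦ Set.finite_Icc (0 : ℤ) N)).subset ?_
    rintro _ ⟨y, hy, rfl⟩ j
    have h0 : ∀ j, 0 ≤ z y j := fun j ↦ by
      have := hy.1 j
      rw [hz] at this
      exact_mod_cast this
    refine ⟨h0 j, ?_⟩
    have h1 := hy.2
    rw [pair_highestRoot] at h1
    simp only [hz] at h1
    have h2 : ∑ j, (mark b j : ℤ) * z y j ≤ N := by exact_mod_cast h1
    have h3 : (1 : ℤ) ≤ mark b j := by exact_mod_cast mark_pos b j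
    calc z y j ≤ mark b j * z y j := le_mul_of_one_le_left (h0 j) h3
      _ ≤ ∑ j, (mark b j : ℤ) * z y j := Finset.single_le_sum
          (f := fun j ↦ (mark b j : ℤ) * z y j)
          (fun j _ ↦ mul_nonneg (by positivity) (h0 j)) (Finset.mem_univ j)
      _ ≤ N := h2
  · intro y _ y' _ h
    refine Subtype.ext (ext_pair_root b fun j ↦ ?_)
    rw [hz, hz, h]

lemma finite_coweightQuotient (b : P.Base) {N : ℕ} (hN : 0 < N) : Finite (CoweightQuotient P N) := by
  have := (finite_closedAlcove b (N := N)).to_subtype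
  refine Finite.of_surjective (fun p : weylPairs P × closedAlcove b N ↦
    quotientMap N p.1 ((p.2 : coweightSubgroup P) : CoweightQuotient P N)) fun a ↦ ?_
  induction a using QuotientAddGroup.induction_on with
  | H y =>
    obtain ⟨w, y', hy', h⟩ := exists_closedAlcove b hN y
    refine ⟨(w⁻¹, ⟨y', hy'⟩), ?_⟩
    simp only
    rw [← h, ← quotientMap_mk, ← quotientMap_mul, inv_mul_cancel, quotientMap_one]

/-- By freeness a reflection fixing the class would be the identity, yet it negates its co-root. -/
lemma isRegularClass_of_mem_openAlcove {N : ℕ} (hN : 0 < N) {y : coweightSubgroup P}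
    (hy : y ∈ openAlcove b N) : IsRegularClass (y : CoweightQuotient P N) := by
  intro i hi
  have h := (eq_one_of_mem_openAlcove b hN hy hy hi).1
  have h1 : P.coreflection i (P.coroot i) = P.coroot i :=
    congrArg (fun w : weylPairs P ↦ w.1.2 (P.coroot i)) h
  have : IsAddTorsionFree T := .of_isTorsionFree ℝ T
  rw [RootPairing.coreflection_apply_self, neg_eq_self] at h1
  exact P.flip.ne_zero i h1

/-- On a wall `α = kN` the reflection subtracts `kN α̌`, which is zero in the quotient, so it would
fix the class. -/
lemma mem_openAlcove_of_isRegularClass {N : ℕ} {y : coweightSubgroup P}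
    (hy : y ∈ closedAlcove b N) (h : IsRegularClass (y : CoweightQuotient P N)) :
    y ∈ openAlcove b N := by
  have key : ∀ (i : ι) (k : ℕ), pair P (P.root i) y ≠ k * N := by
    intro i k hik
    refine h i ?_
    rw [quotientMap_mk, mk_eq_mk_iff]
    refine ⟨k • P.coroot i, nsmul_mem (AddSubgroup.subset_closure (Set.mem_range_self i)) _, ?_⟩
    simp only [coe_coweightMap, reflElt, reflPair, coreflection_eq, hik]
    rw [mul_comm, mul_smul, Nat.cast_smul_eq_nsmul, Nat.cast_smul_eq_nsmul, sub_add_cancel]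
  exact ⟨fun j ↦ (hy.1 j).lt_of_ne' (by simpa using key j 0),
    hy.2.lt_of_ne (by simpa using key (highestRoot b) 1)⟩

/-- The alternating sum of the numbers of fixed points counts the co-weights in the open
simplex. -/
lemma sum_signPair_mul_card_fixed {N : ℕ} (hN : 0 < N) :
    ∑ w : weylPairs P, signPair w.1 *
      (Nat.card {a : CoweightQuotient P N // quotientMap N w a = a} : ℝ) =
      Nat.card (weylPairs P) * Nat.card (openAlcove b N) := by
  classical
  have := finite_coweightQuotient b hN
  let := Fintype.ofFinite (CoweightQuotient P N)
  have : Module.Finite ℝ V := Module.Finite.of_basis b.toWeightBasis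
  -- Signs summed over the stabilizer of a class: the stabilizer is trivial for a regular class, and
  -- otherwise multiplication by a reflection in it cancels the sum.
  have h1 : ∀ a : CoweightQuotient P N,
      ∑ w : weylPairs P, (if quotientMap N w a = a then signPair w.1 else 0) =
        if IsRegularClass a then 1 else 0 := by
    intro a
    split_ifs with ha
    · rw [Finset.sum_eq_single_of_mem 1 (Finset.mem_univ _)]
      · rw [if_pos (quotientMap_one a)]; exact signPair_one
      · intro w _ hw
        refine if_neg fun h ↦ hw ?_
        induction a using QuotientAddGroup.induction_on with
        | H y =>
          obtain ⟨u, y', hy', hu⟩ := exists_closedAlcove b hN y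
          have hreg : IsRegularClass (y' : CoweightQuotient P N) :=
            hu ▸ isRegularClass_quotientMap ha u
          have ho := mem_openAlcove_of_isRegularClass b hy' hreg
          have h2 : quotientMap N (u * w * u⁻¹) (y' : CoweightQuotient P N) = y' := by
            rw [← hu, ← quotientMap_mk, ← quotientMap_mul, inv_mul_cancel_right, quotientMap_mul,
              h]
          have h3 := (eq_one_of_mem_openAlcove b hN ho ho h2).1
          simpa [mul_inv_eq_one] using h3
    · obtain ⟨i, hi⟩ := not_forall.mp ha
      rw [not_not] at hi
      have h2 : ∑ w : weylPairs P, (if quotientMap N w a = a then signPair w.1 else 0) =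
          ∑ w : weylPairs P, -(if quotientMap N w a = a then signPair w.1 else 0) := by
        refine Fintype.sum_equiv (Equiv.mulRight (reflElt P i)) _ _ fun w ↦ ?_
        rw [Equiv.coe_mulRight, quotientMap_mul, hi, Subgroup.coe_mul, signPair_mul]
        have : signPair (reflElt P i).1 = -1 := signPair_reflPair i
        rw [this]
        split_ifs <;> simp
      rw [Finset.sum_neg_distrib] at h2
      linarith
  -- Each regular class is a Weyl translate of an open-alcove point in exactly one way.
  have h2 : Nat.card (weylPairs P × openAlcove b N) =
      Nat.card {a : CoweightQuotient P N // IsRegularClass a} := by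
    refine Nat.card_congr (Equiv.ofBijective (fun p ↦
      ⟨quotientMap N p.1 ((p.2 : coweightSubgroup P) : CoweightQuotient P N),
        isRegularClass_quotientMap (isRegularClass_of_mem_openAlcove b hN p.2.2) p.1⟩) ⟨?_, ?_⟩)
    · rintro ⟨w, y, hy⟩ ⟨w', y', hy'⟩ h
      have h := congrArg (quotientMap N w'⁻¹) (congrArg Subtype.val h)
      rw [← quotientMap_mul, ← quotientMap_mul, inv_mul_cancel, quotientMap_one] at h
      obtain ⟨h3, rfl⟩ := eq_one_of_mem_openAlcove b hN hy hy' h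
      rw [inv_mul_eq_one] at h3
      rw [h3]
    · rintro ⟨a, ha⟩
      induction a using QuotientAddGroup.induction_on with
      | H y =>
        obtain ⟨u, y', hy', hu⟩ := exists_closedAlcove b hN y
        have hreg : IsRegularClass (y' : CoweightQuotient P N) :=
          hu ▸ isRegularClass_quotientMap ha u
        refine ⟨(u⁻¹, ⟨y', mem_openAlcove_of_isRegularClass b hy' hreg⟩), Subtype.ext ?_⟩
        simp only
        rw [← hu, ← quotientMap_mk, ← quotientMap_mul, inv_mul_cancel, quotientMap_one]
  rw [← Nat.cast_mul, ← Nat.card_prod, h2]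
  have h3 : ∀ w : weylPairs P, signPair w.1 *
      (Nat.card {a : CoweightQuotient P N // quotientMap N w a = a} : ℝ) =
      ∑ a : CoweightQuotient P N, if quotientMap N w a = a then signPair w.1 else 0 := by
    intro w
    rw [Nat.card_eq_fintype_card, Fintype.card_subtype, ← Finset.sum_filter, Finset.sum_const,
      nsmul_eq_mul, mul_comm]
  rw [Finset.sum_congr rfl fun w _ ↦ h3 w, Finset.sum_comm, Finset.sum_congr rfl fun a _ ↦ h1 a,
    Nat.card_eq_fintype_card, Fintype.card_subtype]
  simp

lemma card_openAlcove {N : ℕ} :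
    (openAlcove b N).encard = (openPoints b (mark b) N).encard := by
  have : openAlcove b N = (fun k : b.support → ℕ ↦ (⟨ofCoords b fun j ↦ (k j : ℝ),
      (mem_coweightLattice_iff b).mpr fun j ↦ ⟨k j, by simp⟩⟩ : coweightSubgroup P)) ''
      openPoints b (mark b) N := by
    ext y
    constructor
    · rintro ⟨h1, h2⟩
      choose z hz using fun j : b.support ↦ y.2 j
      have h0 : ∀ j, 0 < z j := fun j ↦ by
        have := h1 j
        rw [hz] at this
        exact_mod_cast this
      have hz' : ∀ j : b.support, pair P (P.root j) y = (z j).toNat := fun j ↦ by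
        have : (((z j).toNat : ℤ) : ℝ) = z j := by rw [Int.toNat_of_nonneg (h0 j).le]
        rw [hz]
        exact_mod_cast this.symm
      refine ⟨fun j ↦ (z j).toNat, ⟨fun j ↦ by have := h0 j; change 0 < (z j).toNat; omega, ?_⟩,
        Subtype.ext (ext_pair_root b fun j ↦ by simp [hz'])⟩
      rw [pair_highestRoot] at h2
      simp only [hz'] at h2
      exact_mod_cast h2
    · rintro ⟨k, ⟨h1, h2⟩, rfl⟩
      refine ⟨fun j ↦ by simpa using h1 j, ?_⟩
      rw [pair_highestRoot]
      simp only [pair_root_ofCoords]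
      exact_mod_cast h2
  rw [this]
  refine Function.Injective.encard_image (fun k k' h ↦ funext fun j ↦ ?_) _
  have := congrArg (pair P (P.root j)) (congrArg Subtype.val h)
  simpa using this

end Alcove

/-! ### Fixed points under duality of finite abelian groups. -/

section FiniteDuality

variable {A B : Type*} [AddCommGroup A] [AddCommGroup B]

/-- Orthogonality: translating by an `a₀` with `e a₀ b ≠ 1` multiplies the sum by that number. -/
lemma sum_bicharacter [Fintype A] [DecidableEq B] (e : A → B → ℂ)
    (hl : ∀ a a' b, e (a + a') b = e a b * e a' b) (h0 : ∀ a, e a 0 = 1)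
    (hB : ∀ b, (∀ a, e a b = 1) → b = 0) (b : B) :
    ∑ a, e a b = if b = 0 then (Fintype.card A : ℂ) else 0 := by
  split_ifs with hb
  · simp [hb, h0]
  · obtain ⟨a₀, ha₀⟩ : ∃ a, e a b ≠ 1 := by
      by_contra! h
      exact hb (hB b h)
    have h1 : e a₀ b * ∑ a, e a b = ∑ a, e a b := by
      rw [Finset.mul_sum]
      exact Fintype.sum_equiv (Equiv.addLeft a₀) _ _ fun a ↦ (hl a₀ a b).symm
    by_contra hS
    exact ha₀ (mul_right_cancel₀ hS (h1.trans (one_mul _).symm))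

/-- Two finite groups in perfect duality have the same number of fixed points under dual
automorphisms. -/
lemma card_fixed_eq_of_bicharacter [Finite A] [Finite B] (e : A → B → ℂ)
    (hl : ∀ a a' b, e (a + a') b = e a b * e a' b) (hr : ∀ a b b', e a (b + b') = e a b * e a b')
    (hA0 : ∀ b, e 0 b = 1) (hB0 : ∀ a, e a 0 = 1)
    (hA : ∀ a, (∀ b, e a b = 1) → a = 0) (hB : ∀ b, (∀ a, e a b = 1) → b = 0)
    (f : A →+ A) (g : B →+ B) (hg : Function.Bijective g)
    (hfg : ∀ a b, e (f a) (g b) = e a b) :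
    Nat.card {a // f a = a} = Nat.card {b // g b = b} := by
  classical
  let := Fintype.ofFinite A
  let := Fintype.ofFinite B
  have sA := sum_bicharacter e hl hB0 hB
  have sB := sum_bicharacter (fun b a ↦ e a b) (fun b b' a ↦ hr a b b') hA0 hA
  have hcard : (Fintype.card A : ℂ) = Fintype.card B := by
    have h1 : ∑ a, ∑ b, e a b = Fintype.card B := by simp [sB]
    rw [Finset.sum_comm] at h1
    simpa [sA] using h1
  have hcard0 : (Fintype.card B : ℂ) ≠ 0 := by
    exact_mod_cast Fintype.card_ne_zero
  have hnegl : ∀ a b, e a b * e (-a) b = 1 := fun a b ↦ by rw [← hl, add_neg_cancel, hA0]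
  have hnegr : ∀ a b, e a b * e a (-b) = 1 := fun a b ↦ by rw [← hr, add_neg_cancel, hB0]
  have hneg : ∀ a b, e (-a) b = e a (-b) := fun a b ↦ by
    have h0 : e a b ≠ 0 := fun h ↦ by simpa [h] using hnegl a b
    exact mul_left_cancel₀ h0 ((hnegl a b).trans (hnegr a b).symm)
  -- The same double sum will count fixed points on either side: summing over `b` first detects `f a
  -- = a`, and after substituting `g b` for `b`, summing over `a` first detects `g b = b`.
  have key : ∀ a b, e (f a - a) (g b) = e a (b - g b) := fun a b ↦ by
    rw [sub_eq_add_neg, sub_eq_add_neg, hl, hr, hfg, hneg]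
  have h1 : ∑ a, ∑ b, e (f a - a) b = Fintype.card B * Nat.card {a // f a = a} := by
    simp only [sB, sub_eq_zero]
    rw [Nat.card_eq_fintype_card, Fintype.card_subtype, ← Finset.sum_filter, Finset.sum_const,
      nsmul_eq_mul, mul_comm]
  have h2 : ∑ a, ∑ b, e (f a - a) b = Fintype.card A * Nat.card {b // g b = b} := by
    have : ∀ a, ∑ b, e (f a - a) b = ∑ b, e a (b - g b) := fun a ↦
      (Fintype.sum_bijective g hg _ _ fun b ↦ (key a b).symm).symm
    rw [Finset.sum_congr rfl fun a _ ↦ this a, Finset.sum_comm]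
    simp only [sA, sub_eq_zero]
    rw [Nat.card_eq_fintype_card, Fintype.card_subtype, ← Finset.sum_filter, Finset.sum_const,
      nsmul_eq_mul, mul_comm]
    simp only [eq_comm]
  rw [h1, hcard] at h2
  exact_mod_cast mul_left_cancel₀ hcard0 h2

end FiniteDuality

/-! ### Duality between a root system and its dual; equality of the counts. -/

section LatticeDuality

variable {ι V T : Type*} [Finite ι] [AddCommGroup V] [Module ℝ V] [AddCommGroup T] [Module ℝ T]
  {P : RootPairing ι ℝ V T} [P.IsRootSystem]

lemma exp_two_pi_I_eq_one_iff (r : ℝ) :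
    Complex.exp (2 * Real.pi * Complex.I * r) = 1 ↔ ∃ z : ℤ, r = z := by
  rw [Complex.exp_eq_one_iff]
  refine exists_congr fun z ↦ ?_
  rw [mul_comm (z : ℂ), mul_right_inj' Complex.two_pi_I_ne_zero]
  exact_mod_cast Iff.rfl

lemma exists_int_pair {q : T} (hq : q ∈ corootLattice P) {v : V} (hv : v ∈ coweightLattice P.flip) :
    ∃ z : ℤ, pair P v q = z := by
  induction hq using AddSubgroup.closure_induction with
  | mem x hx => obtain ⟨i, rfl⟩ := hx; exact hv i
  | zero => exact ⟨0, by simp [pair]⟩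
  | add x y _ _ hx hy =>
    obtain ⟨a, ha⟩ := hx
    obtain ⟨b, hb⟩ := hy
    exact ⟨a + b, by rw [pair_add, ha, hb]; simp⟩
  | neg x _ hx =>
    obtain ⟨a, ha⟩ := hx
    exact ⟨-a, by rw [pair] at *; simp [ha]⟩

/-- The coefficient of a simple co-root in `x` is the value at `x` of the corresponding fundamental
weight. This gives nondegeneracy of the pairing of the quotients. -/
lemma mem_corootLattice_of_forall_int (b : P.Base) {x : T}
    (h : ∀ v ∈ coweightLattice P.flip, ∃ z : ℤ, pair P v x = z) : x ∈ corootLattice P := by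
  classical
  rw [← b.toCoweightBasis.sum_repr x]
  refine sum_mem fun j _ ↦ ?_
  obtain ⟨v, hv⟩ := exists_pair_root_eq (P := P.flip) b.flip fun k ↦ if k = j then 1 else 0
  obtain ⟨z, hz⟩ := h v ((mem_coweightLattice_iff b.flip).mpr fun k ↦
    ⟨if k = j then 1 else 0, by rw [hv]; split_ifs <;> simp⟩)
  have hv' : ∀ k : b.support, P.toLinearMap v (P.coroot k) = if k = j then 1 else 0 := by
    intro k
    convert! hv k
  rw [pair, ← b.toCoweightBasis.sum_repr x] at hz
  simp only [map_sum, map_smul, RootPairing.Base.toCoweightBasis_apply, smul_eq_mul, hv',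
    mul_ite, mul_one, mul_zero, Finset.sum_ite_eq', Finset.mem_univ, if_true] at hz
  rw [hz, Int.cast_smul_eq_zsmul, RootPairing.Base.toCoweightBasis_apply]
  exact zsmul_mem (AddSubgroup.subset_closure (Set.mem_range_self _)) _

lemma exp_two_pi_I_congr {r s : ℝ} (h : ∃ z : ℤ, r = s + z) :
    Complex.exp (2 * Real.pi * Complex.I * r) = Complex.exp (2 * Real.pi * Complex.I * s) := by
  obtain ⟨z, rfl⟩ := h
  rw [Complex.ofReal_add, mul_add, Complex.exp_add,
    (exp_two_pi_I_eq_one_iff (z : ℝ)).mpr ⟨z, rfl⟩, mul_one]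

variable (P) in
/-- The pairing of the two lattices modulo `N`. -/
def bichar (N : ℕ) (a : CoweightQuotient P N) (c : CoweightQuotient P.flip N) : ℂ :=
  Complex.exp (2 * Real.pi * Complex.I * ((pair P (c.out : V) (a.out : T) / N : ℝ) : ℂ))

variable {N : ℕ}

/-- Changing representatives by `N` times (co-)roots changes the pairing by a multiple of `N`, as
weights are integral on co-roots and roots on co-weights. -/
lemma bichar_mk (hN : 0 < N) (y : coweightSubgroup P) (v : coweightSubgroup P.flip) :
    bichar P N y v =
      Complex.exp (2 * Real.pi * Complex.I * ((pair P (v : V) (y : T) / N : ℝ) : ℂ)) := by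
  have hN' : (N : ℝ) ≠ 0 := by positivity
  symm
  refine exp_two_pi_I_congr ?_
  obtain ⟨q, hq, hq'⟩ := mk_eq_mk_iff.mp (QuotientAddGroup.out_eq' (y : CoweightQuotient P N))
  obtain ⟨u, hu, hu'⟩ :=
    mk_eq_mk_iff.mp (QuotientAddGroup.out_eq' (v : CoweightQuotient P.flip N))
  set y₀ := Quotient.out (y : CoweightQuotient P N)
  set v₀ := Quotient.out (v : CoweightQuotient P.flip N)
  obtain ⟨z₁, h₁⟩ := exists_int_pair hq v₀.2
  obtain ⟨z₂, h₂⟩ := exists_int_pair (P := P.flip) hu y.2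
  have h₂ : P.toLinearMap u (y : T) = z₂ := h₂
  rw [pair] at h₁
  refine ⟨z₁ + z₂, ?_⟩
  have h₃ : pair P (v : V) (y : T) = pair P (v₀ : V) (y₀ : T) + N * (z₁ + z₂) := by
    rw [hu', pair, map_add, LinearMap.add_apply, map_nsmul, LinearMap.smul_apply, h₂, hq', map_add,
      map_nsmul, h₁, pair]
    simp only [nsmul_eq_mul]
    ring
  rw [h₃]
  push_cast
  field_simp

lemma bichar_add_left (hN : 0 < N) (a a' : CoweightQuotient P N) (c : CoweightQuotient P.flip N) :
    bichar P N (a + a') c = bichar P N a c * bichar P N a' c := by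
  induction a using QuotientAddGroup.induction_on with | H y =>
  induction a' using QuotientAddGroup.induction_on with | H y' =>
  induction c using QuotientAddGroup.induction_on with | H v =>
  rw [← QuotientAddGroup.mk_add, bichar_mk hN, bichar_mk hN, bichar_mk hN, ← Complex.exp_add,
    ← mul_add, ← Complex.ofReal_add, ← add_div, AddSubgroup.coe_add, pair_add]

lemma bichar_add_right (hN : 0 < N) (a : CoweightQuotient P N)
    (c c' : CoweightQuotient P.flip N) :
    bichar P N a (c + c') = bichar P N a c * bichar P N a c' := by
  induction a using QuotientAddGroup.induction_on with | H y =>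
  induction c using QuotientAddGroup.induction_on with | H v =>
  induction c' using QuotientAddGroup.induction_on with | H v' =>
  rw [← QuotientAddGroup.mk_add, bichar_mk hN, bichar_mk hN, bichar_mk hN, ← Complex.exp_add,
    ← mul_add, ← Complex.ofReal_add, ← add_div, AddSubgroup.coe_add]
  simp only [pair, map_add, LinearMap.add_apply]

lemma bichar_zero_left (hN : 0 < N) (c : CoweightQuotient P.flip N) : bichar P N 0 c = 1 := by
  induction c using QuotientAddGroup.induction_on with | H v =>
  rw [← QuotientAddGroup.mk_zero, bichar_mk hN]
  simp [pair]

lemma bichar_zero_right (hN : 0 < N) (a : CoweightQuotient P N) : bichar P N a 0 = 1 := by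
  induction a using QuotientAddGroup.induction_on with | H y =>
  rw [← QuotientAddGroup.mk_zero, bichar_mk hN]
  simp [pair]

lemma mk_eq_zero_of_smul {y : coweightSubgroup P} (hN : 0 < N)
    (h : (1 / (N : ℝ)) • (y : T) ∈ corootLattice P) : (y : CoweightQuotient P N) = 0 := by
  have hN' : (N : ℝ) ≠ 0 := by positivity
  rw [QuotientAddGroup.eq_zero_iff, mem_scaledCoroots]
  exact ⟨_, h, by rw [← Nat.cast_smul_eq_nsmul ℝ, smul_smul, mul_one_div_cancel hN', one_smul]⟩

lemma eq_zero_of_bichar_left (b : P.Base) (hN : 0 < N) (a : CoweightQuotient P N)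
    (h : ∀ c, bichar P N a c = 1) : a = 0 := by
  induction a using QuotientAddGroup.induction_on with | H y =>
  refine mk_eq_zero_of_smul hN (mem_corootLattice_of_forall_int b fun v hv ↦ ?_)
  have := h ((⟨v, hv⟩ : coweightSubgroup P.flip) : CoweightQuotient P.flip N)
  rw [bichar_mk hN, exp_two_pi_I_eq_one_iff] at this
  rw [pair_smul, one_div_mul_eq_div]
  exact this

lemma eq_zero_of_bichar_right (b : P.Base) (hN : 0 < N) (c : CoweightQuotient P.flip N)
    (h : ∀ a, bichar P N a c = 1) : c = 0 := by
  induction c using QuotientAddGroup.induction_on with | H v =>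
  refine mk_eq_zero_of_smul (P := P.flip) hN
    (mem_corootLattice_of_forall_int (P := P.flip) b.flip fun y hy ↦ ?_)
  have := h ((⟨y, hy⟩ : coweightSubgroup P) : CoweightQuotient P N)
  rw [bichar_mk hN, exp_two_pi_I_eq_one_iff] at this
  rw [pair_smul, one_div_mul_eq_div]
  exact this

lemma bichar_quotientMap (hN : 0 < N) (w : weylPairs P) (a : CoweightQuotient P N)
    (c : CoweightQuotient P.flip N) :
    bichar P N (quotientMap N w a) (quotientMap N (weylPairsFlip P w) c) = bichar P N a c := by
  induction a using QuotientAddGroup.induction_on with | H y =>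
  induction c using QuotientAddGroup.induction_on with | H v =>
  rw [quotientMap_mk, quotientMap_mk, bichar_mk hN, bichar_mk hN]
  have h : pair P (coweightMap (weylPairsFlip P w) v : V) (coweightMap w y : T) = pair P v y :=
    toLinearMap_weylPairs w.2 _ _
  rw [h]

lemma quotientMap_bijective (w : weylPairs P) : Function.Bijective (quotientMap N w) :=
  Function.bijective_iff_has_inverse.mpr ⟨quotientMap N w⁻¹,
    fun a ↦ by rw [← quotientMap_mul, inv_mul_cancel, quotientMap_one],
    fun a ↦ by rw [← quotientMap_mul, mul_inv_cancel, quotientMap_one]⟩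

variable [P.IsCrystallographic] [P.IsReduced] [P.IsIrreducible] [Nonempty ι]

lemma finite_openAlcove (b : P.Base) : (openAlcove b N).Finite :=
  (finite_closedAlcove b).subset fun _ hy ↦ ⟨fun j ↦ (hy.1 j).le, hy.2.le⟩

/-- A root system and its dual have equally many points of each adjoint order in their open
simplices. -/
lemma encard_openPoints_flip (b : P.Base) (hN : 0 < N) :
    (openPoints b (comark b) N).encard = (openPoints b (mark b) N).encard := by
  have : Module.Finite ℝ V := Module.Finite.of_basis b.toWeightBasis
  have : Module.Finite ℝ T := Module.Finite.of_basis b.toCoweightBasis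
  have := finite_coweightQuotient b hN
  have := finite_coweightQuotient b.flip hN
  have h1 := sum_signPair_mul_card_fixed b hN
  have h2 := sum_signPair_mul_card_fixed b.flip hN
  have h3 : ∀ w : weylPairs P,
      Nat.card {a : CoweightQuotient P N // quotientMap N w a = a} =
      Nat.card {c : CoweightQuotient P.flip N // quotientMap N (weylPairsFlip P w) c = c} :=
    fun w ↦ card_fixed_eq_of_bicharacter (bichar P N) (bichar_add_left hN) (bichar_add_right hN)
      (bichar_zero_left hN) (bichar_zero_right hN) (eq_zero_of_bichar_left b hN)
      (eq_zero_of_bichar_right b hN) _ _ (quotientMap_bijective _) (bichar_quotientMap hN w)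
  rw [← Equiv.sum_comp (weylPairsFlip P)] at h2
  have h4 : ∀ w : weylPairs P, signPair (weylPairsFlip P w).1 = signPair w.1 :=
    fun w ↦ signPair_swap w.2
  simp only [← h3, h4] at h2
  rw [h1, ← Nat.card_congr (weylPairsFlip P)] at h2
  have h5 : (Nat.card (weylPairs P) : ℝ) ≠ 0 := by exact_mod_cast Nat.card_pos.ne'
  have h6 : Nat.card (openAlcove b N) = Nat.card (openAlcove b.flip N) := by
    exact_mod_cast mul_left_cancel₀ h5 h2
  have h7 : (openAlcove b.flip N).encard = (openAlcove b N).encard := by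
    rw [← (finite_openAlcove b).cast_ncard_eq, ← (finite_openAlcove b.flip).cast_ncard_eq,
      ← Nat.card_coe_set_eq, ← Nat.card_coe_set_eq, h6]
  rw [card_openAlcove, card_openAlcove] at h7
  exact h7

/-- The all-ones vector has the least weighted sum. Thus the counts for all `N` determine `1 + ∑
m_j`, and equal counts give equal Coxeter numbers. -/
lemma openPoints_nonempty_iff {b : P.Base} {m : b.support → ℕ} :
    (openPoints b m N).Nonempty ↔ 1 + ∑ j, m j ≤ N := by
  constructor
  · rintro ⟨k, h1, h2⟩
    have : ∑ j, m j ≤ ∑ j, m j * k j :=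
      Finset.sum_le_sum fun j _ ↦ Nat.le_mul_of_pos_right _ (h1 j)
    omega
  · intro h
    exact ⟨fun _ ↦ 1, fun _ ↦ one_pos, by simp only [mul_one]; omega⟩

/-- A root system and its dual have the same Coxeter number. -/
lemma sum_comark_eq (b : P.Base) : 1 + ∑ j, comark b j = coxeterNumber b := by
  have key : ∀ N : ℕ, 0 < N → (1 + ∑ j, comark b j ≤ N ↔ coxeterNumber b ≤ N) := by
    intro N hN
    rw [coxeterNumber, ← openPoints_nonempty_iff (P := P), ← openPoints_nonempty_iff (P := P),
      ← Set.encard_pos, ← Set.encard_pos, encard_openPoints_flip b hN]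
  exact le_antisymm ((key _ (coxeterNumber_pos b)).mpr le_rfl)
    ((key _ (by omega)).mp le_rfl)

lemma encard_monomialsLE_eq (b : P.Base) (M : ℕ) :
    (monomialsLE b M).encard = (openChamberEFO b (M + coxeterNumber b)).encard := by
  have h := coxeterNumber_pos b
  rw [encard_monomialsLE, ← encard_openPoints_add, sum_comark_eq,
    encard_openPoints_flip b (by omega), encard_openChamberEFO b (by omega)]

end LatticeDuality

/-! ### Vanishing of the `S`-functions. -/

section SFunction

variable {ι V T : Type*} [Finite ι] [AddCommGroup V] [Module ℝ V] [AddCommGroup T] [Module ℝ T]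
  {P : RootPairing ι ℝ V T}

lemma ofIdx_smul_eq (i : ι) (v : V) : RootPairing.weylGroup.ofIdx P i • v = P.reflection i v := rfl

lemma reflection_eq (i : ι) (v : V) : P.reflection i v = v - pair P v (P.coroot i) • P.root i :=
  P.reflection_apply i v

lemma pair_sub_left (v v' : V) (x : T) : pair P (v - v') x = pair P v x - pair P v' x := by
  simp [pair]

lemma pair_add_left (v v' : V) (x : T) : pair P (v + v') x = pair P v x + pair P v' x := by
  simp [pair]

lemma pair_smul_left (c : ℝ) (v : V) (x : T) : pair P (c • v) x = c * pair P v x := by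
  simp [pair]

lemma sign_mul (w w' : P.weylGroup) : sign P (w * w') = sign P w * sign P w' := by
  rw [sign, map_mul]
  exact map_mul LinearMap.det _ _

lemma sign_ofIdx [Module.Finite ℝ V] (i : ι) : sign P (RootPairing.weylGroup.ofIdx P i) = -1 :=
  det_reflection_eq i

variable [P.IsRootSystem]

/-- Replacing `w` by `w s_i` flips each sign and shifts the exponent by `N` times a root, whose
value at `x` is an integer; so the sum is its own negative. -/
lemma sFunction_eq_zero_of_pair_coroot [Module.Finite ℝ V] {μ : V} {x : T} {N : ℕ} {i : ι}
    (hμ : pair P μ (P.coroot i) = N) (hx : ∀ k, ∃ z : ℤ, N * pair P (P.root k) x = z) :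
    sFunction P μ x = 0 := by
  have h : sFunction P μ x = -sFunction P μ x := by
    conv_rhs => rw [sFunction, ← Finset.sum_neg_distrib]
    rw [sFunction]
    refine Fintype.sum_equiv (Equiv.mulRight (RootPairing.weylGroup.ofIdx P i)) _ _ fun w ↦ ?_
    rw [Equiv.coe_mulRight, sign_mul, sign_ofIdx, mul_smul, ofIdx_smul_eq, reflection_eq, hμ,
      smul_sub, smul_comm, RootPairing.weylGroup_apply_root, pair_sub_left, pair_smul_left]
    obtain ⟨z, hz⟩ := hx (P.weylGroupToPerm w i)
    rw [hz, exp_two_pi_I_congr (r := pair P (w • μ) x - z) (s := pair P (w • μ) x)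
      ⟨-z, by push_cast; ring⟩]
    push_cast
    ring
  exact self_eq_neg.mp h

lemma sFunction_smul_eq_zero {μ : V} {x : T} (h : sFunction P μ x = 0) (g : P.weylGroup) :
    sFunction P (g • μ) x = 0 := by
  have h1 : sFunction P μ x = sign P g * sFunction P (g • μ) x := by
    rw [sFunction, sFunction, Finset.mul_sum]
    symm
    refine Fintype.sum_equiv (Equiv.mulRight g) _ _ fun w ↦ ?_
    rw [Equiv.coe_mulRight, sign_mul, mul_smul]
    push_cast
    ring
  have h2 : sign P g ≠ 0 := by
    intro h0
    have h3 : sign P (g * g⁻¹) = 1 := by rw [mul_inv_cancel, sign, map_one]; simp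
    rw [sign_mul, h0, zero_mul] at h3
    exact zero_ne_one h3
  rw [h] at h1
  exact (mul_eq_zero.mp h1.symm).resolve_left (by exact_mod_cast h2)

variable (b : P.Base)

@[simp] lemma pair_fundamentalWeight (j k : b.support) [Decidable (j = k)] :
    pair P (fundamentalWeight b j) (P.coroot k) = if j = k then 1 else 0 := by
  have := LinearMap.congr_fun (P.toPerfPair.apply_symm_apply (b.toCoweightBasis.coord j))
    (P.coroot k)
  refine this.trans ?_
  rw [Basis.coord_apply, b.toCoweightBasis_repr_coroot]
  by_cases h : j = k
  · simp [h]
  · simp [h]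

lemma pair_rho (k : b.support) : pair P (rho b) (P.coroot k) = 1 := by
  classical
  have h : pair P (rho b) (P.coroot k) = ∑ j, pair P (fundamentalWeight b j) (P.coroot k) := by
    simp [pair, rho]
  rw [h]
  simp

lemma pair_dominantWeight (l : b.support →₀ ℕ) (k : b.support) :
    pair P (dominantWeight b l) (P.coroot k) = l k := by
  classical
  have h : pair P (dominantWeight b l) (P.coroot k) =
      ∑ j, (l j : ℝ) * pair P (fundamentalWeight b j) (P.coroot k) := by
    simp [pair, dominantWeight]
  rw [h]
  simp

variable [Nonempty ι]

lemma coroot_highest (v : V) :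
    pair P v (P.coroot (highestRoot b.flip)) =
      ∑ j : b.support, (comark b j : ℝ) * pair P v (P.coroot j) :=
  pair_highestRoot (P := P.flip) b.flip v

lemma mDegree_eq (l : b.support →₀ ℕ) : mDegree b l = ∑ j, l j * comark b j := by
  rw [mDegree, Finsupp.weight_apply, Finsupp.sum_fintype _ _ (by simp)]
  simp

variable [P.IsCrystallographic] [P.IsReduced] [P.IsIrreducible]

/-- The pairing of `λ` is its `m`-degree `M + 1` and that of `ρ` is the sum of the co-marks, which
is `h - 1` since dual root systems share their Coxeter number. -/
lemma pair_dominantWeight_add_rho (l : b.support →₀ ℕ) {M : ℕ} (hl : mDegree b l = M + 1) :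
    pair P (dominantWeight b l + rho b) (P.coroot (highestRoot b.flip)) =
      (M + coxeterNumber b : ℕ) := by
  rw [coroot_highest, ← sum_comark_eq, show M + (1 + ∑ j, comark b j) =
    mDegree b l + ∑ j, comark b j by omega, mDegree_eq, ← Finset.sum_add_distrib]
  push_cast
  refine Finset.sum_congr rfl fun j _ ↦ ?_
  rw [pair_add_left, pair_rho, pair_dominantWeight]
  ring

lemma exists_int_of_mem_adjointOrder {N : ℕ} (hN : 0 < N) {x : T} (hx : x ∈ adjointOrder P N)
    (i : ι) : ∃ z : ℤ, N * pair P (P.root i) x = z := by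
  have hN' : (N : ℝ) ≠ 0 := by positivity
  obtain ⟨y, hy, rfl⟩ := hx
  obtain ⟨z, hz⟩ := hy i
  exact ⟨z, by rw [pair_smul, hz]; field_simp⟩

/-- The `S`-functions of `m`-degree `M + 1` vanish at the regular points of adjoint order
`M + h`. -/
lemma sFunction_eq_zero (l : b.support →₀ ℕ) {M : ℕ} (hl : mDegree b l = M + 1) {x : T}
    (hx : x ∈ adjointOrder P (M + coxeterNumber b)) :
    sFunction P (dominantWeight b l + rho b) x = 0 := by
  have : Module.Finite ℝ V := Module.Finite.of_basis b.toWeightBasis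
  have h := coxeterNumber_pos b
  exact sFunction_eq_zero_of_pair_coroot (pair_dominantWeight_add_rho b l hl)
    (exists_int_of_mem_adjointOrder (by omega) hx)

end SFunction

/-! ### Dominance, the root cone and `ρ`. -/

section Dominant

variable {ι V T : Type*} [Finite ι] [AddCommGroup V] [Module ℝ V] [AddCommGroup T] [Module ℝ T]
  {P : RootPairing ι ℝ V T} [P.IsRootSystem] (b : P.Base)

/-- Take the conjugate with the largest pairing with `coRho`: a simple reflection lowers this by the
pairing with its co-root. -/
lemma exists_dominant_smul [Nonempty ι] (μ : V) :
    ∃ g : P.weylGroup, ∀ j : b.support, 0 ≤ pair P (g • μ) (P.coroot j) := by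
  obtain ⟨g, hg⟩ := Finite.exists_max fun g : P.weylGroup ↦ pair P (g • μ) (coRho b)
  refine ⟨g, fun j ↦ ?_⟩
  have := hg (RootPairing.weylGroup.ofIdx P j * g)
  rw [mul_smul, ofIdx_smul_eq, reflection_eq, pair_sub_left, pair_smul_left, pair_root_coRho,
    RootPairing.Base.height_one_of_mem_support j.2] at this
  simpa using this

/-- The cone of nonnegative combinations of simple roots. -/
def rootCone : AddSubmonoid V where
  carrier := {v | ∃ c : b.support → ℕ, v = ∑ j, (c j : ℝ) • P.root j}
  zero_mem' := ⟨0, by simp⟩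
  add_mem' := by
    rintro _ _ ⟨c, rfl⟩ ⟨d, rfl⟩
    exact ⟨c + d, by simp [add_smul, Finset.sum_add_distrib]⟩

variable {b} in
lemma root_mem_rootCone {i : ι} (hi : b.IsPos i) : P.root i ∈ rootCone b := by
  refine ⟨fun j ↦ (rootCoeff b i j).toNat, ?_⟩
  conv_lhs => rw [root_eq_sum_rootCoeff b i]
  refine Finset.sum_congr rfl fun j _ ↦ ?_
  rw [← Int.cast_smul_eq_zsmul ℝ]
  congr 1
  have := Int.toNat_of_nonneg (rootCoeff_nonneg hi j)
  exact_mod_cast this.symm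

lemma eq_zero_of_mem_rootCone_neg {v : V} (h : v ∈ rootCone b) (h' : -v ∈ rootCone b) : v = 0 := by
  obtain ⟨c, rfl⟩ := h
  obtain ⟨d, hd⟩ := h'
  have h1 : ∑ j, ((c j : ℝ) + d j) • b.toWeightBasis j = 0 := by
    simp only [add_smul, Finset.sum_add_distrib, RootPairing.Base.toWeightBasis_apply]
    rw [← hd, add_neg_cancel]
  have h2 := Fintype.linearIndependent_iff.mp b.toWeightBasis.linearIndependent _ h1
  refine Finset.sum_eq_zero fun j _ ↦ ?_
  have h3 : (c j : ℝ) = 0 := by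
    have := h2 j
    have h4 : (0 : ℝ) ≤ c j := by positivity
    have h5 : (0 : ℝ) ≤ d j := by positivity
    linarith
  rw [h3, zero_smul]

/-- Expanding one argument of `(v, v)` in simple roots leaves only nonpositive terms. -/
lemma eq_zero_of_mem_rootCone_of_pair_nonpos {v : V} (h : v ∈ rootCone b)
    (h' : ∀ j : b.support, pair P v (P.coroot j) ≤ 0) : v = 0 := by
  by_contra hv
  have h1 : 0 < coForm P.flip v v := coForm_pos (P := P.flip) hv
  obtain ⟨c, hc⟩ := h
  have key : ∀ s : Finset b.support,
      coForm P.flip (∑ j ∈ s, (c j : ℝ) • P.root j) v ≤ 0 := by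
    classical
    intro s
    induction s using Finset.induction_on with
    | empty => simp [coForm, pair]
    | insert j s hj ih =>
      rw [Finset.sum_insert hj, coForm_add_left, coForm_smul_left]
      have h2 : 2 * coForm P.flip (P.root j) v =
          coForm P.flip (P.root j) (P.root j) * pair P v (P.coroot j) :=
        two_mul_coForm_coroot (P := P.flip) (j : ι) v
      have h3 := mul_nonpos_of_nonneg_of_nonpos (coForm_nonneg (P := P.flip) (P.root j)) (h' j)
      have h4 : coForm P.flip (P.root j) v ≤ 0 := by linarith
      have h5 := mul_nonpos_of_nonneg_of_nonpos (Nat.cast_nonneg (α := ℝ) (c j)) h4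
      linarith
  have := key Finset.univ
  rw [← hc] at this
  linarith

/-- Half the sum of the positive roots. -/
def halfSum : V := letI := Fintype.ofFinite ι; open Classical in
  (1 / 2 : ℝ) • ∑ i with b.IsPos i, P.root i

variable [P.IsCrystallographic] [P.IsReduced]

open Classical in
-- A simple reflection permutes the positive roots other than its own. The multiplicative form
-- serves the Weyl denominator and, through `Multiplicative`, the half sum.
lemma image_reflectionPerm_pos [Fintype ι] (j : b.support) {β : Type*} [CommMonoid β] (f : ι → β) :
    ∏ i ∈ (Finset.univ.filter fun i ↦ b.IsPos i).erase j, f (P.reflectionPerm j i) =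
      ∏ i ∈ (Finset.univ.filter fun i ↦ b.IsPos i).erase j, f i := by
  have hmem : ∀ i ∈ (Finset.univ.filter fun i ↦ b.IsPos i).erase (j : ι),
      P.reflectionPerm j i ∈ (Finset.univ.filter fun i ↦ b.IsPos i).erase (j : ι) := by
    intro i hi
    simp only [Finset.mem_erase, Finset.mem_filter, Finset.mem_univ, true_and] at hi ⊢
    refine ⟨fun h ↦ ?_, hi.2.reflectionPerm j.2 hi.1⟩
    have h1 : P.root i = -P.root j := by
      have := congrArg P.root h
      rw [RootPairing.root_reflectionPerm] at this
      have := congrArg (P.reflection j) this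
      simpa using this
    exact (isPos_neg_iff h1).mp hi.2 (b.isPos_of_mem_support j.2)
  exact Finset.prod_nbij' (P.reflectionPerm j) (P.reflectionPerm j) hmem hmem (by simp) (by simp)
    (by simp)

/-- The reflection `s_j` only negates `α_j` among the positive roots, so it lowers the half sum by
`α_j`; hence the pairing with every simple co-root is one. -/
lemma halfSum_eq_rho : halfSum b = rho b := by
  classical
  let := Fintype.ofFinite ι
  have key : ∀ j : b.support, P.reflection j (halfSum b) = halfSum b - P.root j := by
    intro j
    have hj : (j : ι) ∈ Finset.univ.filter fun i ↦ b.IsPos i := by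
      simpa using b.isPos_of_mem_support j.2
    have h1 := image_reflectionPerm_pos b j (fun i ↦ Multiplicative.ofAdd (P.root i))
    rw [← ofAdd_sum, ← ofAdd_sum] at h1
    have h1 := Multiplicative.ofAdd.injective h1
    have h2 : halfSum b = (1 / 2 : ℝ) • ∑ i with b.IsPos i, P.root i := by
      rw [halfSum]
    rw [h2, ← Finset.add_sum_erase _ _ hj, map_smul, map_add, map_sum]
    simp only [← RootPairing.root_reflectionPerm]
    rw [h1]
    simp only [RootPairing.root_reflectionPerm, RootPairing.reflection_apply_self]
    module
  refine ext_pair_root (P := P.flip) b.flip fun j ↦ ?_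
  change pair P (halfSum b) (P.coroot j) = pair P (rho b) (P.coroot j)
  have hr : pair P (rho b) (P.coroot j) = 1 := pair_rho b j
  rw [hr]
  have h := key j
  rw [reflection_eq, sub_right_inj] at h
  have h2 : (pair P (halfSum b) (P.coroot j) - 1) • P.root j = 0 := by
    rw [sub_smul, h, one_smul, sub_self]
  rcases smul_eq_zero.mp h2 with h3 | h3
  · linarith
  · exact absurd h3 (P.ne_zero j)

end Dominant

/-! ### The group algebra: Laplacian, gradient product and leading terms. -/

section GroupAlgebra

open AddMonoidAlgebra (single)

variable {V : Type*} [AddCommGroup V]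

/-- The diagonal operator `e^v ↦ q(v) e^v` on the group algebra. -/
def diagOp (q : V → ℂ) : AddMonoidAlgebra ℂ V →ₗ[ℂ] AddMonoidAlgebra ℂ V where
  toFun f := .ofCoeff (Finsupp.onFinset f.coeff.support (fun v ↦ q v * f.coeff v) fun v h ↦ by
    rw [Finsupp.mem_support_iff]
    rintro h0
    exact h (by rw [h0, mul_zero]))
  map_add' f g := by
    ext v
    simp [mul_add]
  map_smul' c f := by
    ext v
    simp
    ring

@[simp] lemma coeff_diagOp (q : V → ℂ) (f : AddMonoidAlgebra ℂ V) (v : V) :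
    (diagOp q f).coeff v = q v * f.coeff v := rfl

@[simp] lemma diagOp_single (q : V → ℂ) (v : V) (a : ℂ) :
    diagOp q (single v a) = single v (q v * a) := by
  classical
  ext w
  simp only [coeff_diagOp, AddMonoidAlgebra.coeff_single, Finsupp.single_apply]
  split_ifs with h
  · rw [h]
  · simp

/-- A multiple of the gradient product attached to a quadratic form `q`: the defect of the
Leibniz rule for the second order operator `e^v ↦ q(v) e^v`. -/
def gradProd (q : V → ℂ) (f g : AddMonoidAlgebra ℂ V) : AddMonoidAlgebra ℂ V :=
  diagOp q (f * g) - f * diagOp q g - g * diagOp q f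

lemma gradProd_add_left (q : V → ℂ) (f f' g : AddMonoidAlgebra ℂ V) :
    gradProd q (f + f') g = gradProd q f g + gradProd q f' g := by
  simp only [gradProd, add_mul, mul_add, map_add]
  ring

lemma gradProd_sub_left (q : V → ℂ) (f f' g : AddMonoidAlgebra ℂ V) :
    gradProd q (f - f') g = gradProd q f g - gradProd q f' g := by
  simp only [gradProd, sub_mul, mul_sub, map_sub]
  ring

lemma gradProd_zero_left (q : V → ℂ) (g : AddMonoidAlgebra ℂ V) : gradProd q 0 g = 0 := by
  simp [gradProd]

variable [Module ℝ V] (B : V →ₗ[ℝ] V →ₗ[ℝ] ℂ) (hB : ∀ u v, B u v = B v u)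

include hB in
-- Polarization on exponentials: `B(u+v, u+v) - B(u, u) - B(v, v) = 2 B(u, v)`.
lemma gradProd_single (u : V) (a : ℂ) (g : AddMonoidAlgebra ℂ V) :
    gradProd (fun v ↦ B v v) (single u a) g = 2 * (single u a * diagOp (B u) g) := by
  induction g using AddMonoidAlgebra.induction_linear with
  | zero => simp [gradProd]
  | add f g hf hg =>
    have h : gradProd (fun v ↦ B v v) (single u a) (f + g) =
        gradProd (fun v ↦ B v v) (single u a) f + gradProd (fun v ↦ B v v) (single u a) g := by
      simp only [gradProd, add_mul, mul_add, map_add]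
      ring
    rw [h, hf, hg, map_add]
    ring
  | single v c =>
    rw [two_mul]
    simp only [gradProd, AddMonoidAlgebra.single_mul_single, diagOp_single, map_add,
      LinearMap.add_apply, add_comm v u, ← AddMonoidAlgebra.single_sub,
      ← AddMonoidAlgebra.single_add, hB v u]
    congr 1
    ring

include hB in
-- On exponentials the factor `B u` is additive in `u`, which is the derivation rule.
lemma gradProd_mul_left (f f' g : AddMonoidAlgebra ℂ V) :
    gradProd (fun v ↦ B v v) (f * f') g =
      f * gradProd (fun v ↦ B v v) f' g + f' * gradProd (fun v ↦ B v v) f g := by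
  induction f using AddMonoidAlgebra.induction_linear with
  | zero => simp [gradProd_zero_left]
  | add f₁ f₂ h₁ h₂ => rw [add_mul, gradProd_add_left, h₁, h₂, gradProd_add_left]; ring
  | single u a =>
    induction f' using AddMonoidAlgebra.induction_linear with
    | zero => simp [gradProd_zero_left]
    | add f₁ f₂ h₁ h₂ => rw [mul_add, gradProd_add_left, h₁, h₂, gradProd_add_left]; ring
    | single v c =>
      rw [AddMonoidAlgebra.single_mul_single, gradProd_single B hB, gradProd_single B hB,
        gradProd_single B hB]
      have h : diagOp (B (u + v)) g = diagOp (B u) g + diagOp (B v) g := by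
        ext w
        simp [add_mul]
      rw [h, ← AddMonoidAlgebra.single_mul_single]
      ring

include hB in
lemma gradProd_one_left (g : AddMonoidAlgebra ℂ V) : gradProd (fun v ↦ B v v) 1 g = 0 := by
  have := gradProd_mul_left B hB 1 1 g
  simpa using this

/-- `f` has its terms in `v - C`, and the coefficient of `e^v` is `a`. -/
def HasTop (C : AddSubmonoid V) (f : AddMonoidAlgebra ℂ V) (v : V) (a : ℂ) : Prop :=
  f.coeff v = a ∧ ∀ μ, f.coeff μ ≠ 0 → v - μ ∈ C

/-- As the cone contains no line, the top exponent of the product arises only from the two top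
exponents. -/
lemma HasTop.mul {C : AddSubmonoid V} (hC : ∀ v ∈ C, -v ∈ C → v = 0) {f g : AddMonoidAlgebra ℂ V}
    {v w : V} {a c : ℂ} (hf : HasTop C f v a) (hg : HasTop C g w c) :
    HasTop C (f * g) (v + w) (a * c) := by
  classical
  constructor
  · rw [← hf.1, ← hg.1]
    refine AddMonoidAlgebra.coeff_mul_add_of_uniqueAdd fun x y hx hy hxy ↦ ?_
    have h1 := hf.2 x (Finsupp.mem_support_iff.mp hx)
    have h2 := hg.2 y (Finsupp.mem_support_iff.mp hy)
    have h3 : -(v - x) = w - y := by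
      rw [neg_sub, sub_eq_sub_iff_add_eq_add, hxy, add_comm]
    have h4 := hC _ h1 (h3 ▸ h2)
    rw [h4, neg_zero] at h3
    exact ⟨(sub_eq_zero.mp h4).symm, (sub_eq_zero.mp h3.symm).symm⟩
  · intro μ hμ
    rw [AddMonoidAlgebra.coeff_mul] at hμ
    obtain ⟨x, hx, hx'⟩ := Finset.exists_ne_zero_of_sum_ne_zero hμ
    obtain ⟨y, hy, hy'⟩ := Finset.exists_ne_zero_of_sum_ne_zero hx'
    have hxy : x + y = μ := by
      by_contra h
      exact hy' (if_neg h)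
    have := C.add_mem (hf.2 x (Finsupp.mem_support_iff.mp hx))
      (hg.2 y (Finsupp.mem_support_iff.mp hy))
    rwa [← hxy, add_sub_add_comm]

lemma hasTop_one (C : AddSubmonoid V) : HasTop C 1 0 1 := by
  classical
  refine ⟨by simp [AddMonoidAlgebra.one_def], fun μ hμ ↦ ?_⟩
  rw [AddMonoidAlgebra.one_def, AddMonoidAlgebra.coeff_single, Finsupp.single_apply] at hμ
  have : 0 = μ := by
    by_contra h
    exact hμ (if_neg h)
  simp [← this]

lemma HasTop.prod {C : AddSubmonoid V} (hC : ∀ v ∈ C, -v ∈ C → v = 0) {κ : Type*}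
    (s : Finset κ) {f : κ → AddMonoidAlgebra ℂ V} {v : κ → V}
    (h : ∀ i ∈ s, HasTop C (f i) (v i) 1) : HasTop C (∏ i ∈ s, f i) (∑ i ∈ s, v i) 1 := by
  classical
  induction s using Finset.induction_on with
  | empty => simpa using hasTop_one C
  | insert i s hi ih =>
    rw [Finset.prod_insert hi, Finset.sum_insert hi, ← one_mul (1 : ℂ)]
    exact (h i (by simp)).mul hC (ih fun k hk ↦ h k (by simp [hk]))

/-- The action of a linear map on the group algebra. -/
abbrev actHom (s : V →ₗ[ℝ] V) : AddMonoidAlgebra ℂ V →ₐ[ℂ] AddMonoidAlgebra ℂ V :=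
  AddMonoidAlgebra.mapDomainAlgHom ℂ ℂ (s : V →+ V)

@[simp] lemma actHom_single (s : V →ₗ[ℝ] V) (v : V) (a : ℂ) :
    actHom s (single v a) = single (s v) a := by
  simp [actHom, AddMonoidAlgebra.mapDomain_single]

lemma coeff_actHom (s : V →ₗ[ℝ] V) (hs : Function.Injective s) (f : AddMonoidAlgebra ℂ V) (v : V) :
    (actHom s f).coeff (s v) = f.coeff v := by
  rw [AddMonoidAlgebra.mapDomainAlgHom_apply, AddMonoidAlgebra.coeff_mapDomain]
  exact Finsupp.mapDomain_apply hs _ _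

end GroupAlgebra

/-! ### Evaluation of exponential sums at a point. -/

section Eval

open AddMonoidAlgebra (single)

variable {ι V T : Type*} [AddCommGroup V] [Module ℝ V] [AddCommGroup T] [Module ℝ T]
  (P : RootPairing ι ℝ V T)

/-- The evaluation of an element of the group algebra at a point. -/
def evalAt (x : T) : AddMonoidAlgebra ℂ V →ₐ[ℂ] ℂ :=
  AddMonoidAlgebra.lift ℂ ℂ V
    { toFun v := Complex.exp (2 * Real.pi * Complex.I * (pair P v.toAdd x : ℂ))
      map_one' := by simp [pair]
      map_mul' v w := by
        rw [← Complex.exp_add]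
        congr 1
        simp [pair]
        ring }

@[simp] lemma evalAt_single (x : T) (v : V) (a : ℂ) :
    evalAt P x (single v a) =
      a * Complex.exp (2 * Real.pi * Complex.I * (pair P v x : ℂ)) := by
  simp [evalAt, AddMonoidAlgebra.lift_single]

lemma evalAt_eq_sum (x : T) (f : AddMonoidAlgebra ℂ V) :
    evalAt P x f = f.coeff.sum fun v a ↦
      a * Complex.exp (2 * Real.pi * Complex.I * (pair P v x : ℂ)) := by
  rw [evalAt, AddMonoidAlgebra.lift_apply]
  rfl

end Eval

/-! ### Antisymmetric elements and `S`-functions. -/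

section Antisymmetric

open AddMonoidAlgebra (single)

variable {ι V T : Type*} [Finite ι] [AddCommGroup V] [Module ℝ V] [AddCommGroup T] [Module ℝ T]
  {P : RootPairing ι ℝ V T}

/-- The elements of the group algebra that change sign under every reflection. -/
def IsAntisymm (P : RootPairing ι ℝ V T) (f : AddMonoidAlgebra ℂ V) : Prop :=
  ∀ i v, f.coeff (P.reflection i v) = -f.coeff v

lemma isAntisymm_of_support [P.IsCrystallographic] [P.IsReduced] (b : P.Base)
    {f : AddMonoidAlgebra ℂ V}
    (h : ∀ (j : b.support) v, f.coeff (P.reflection j v) = -f.coeff v) : IsAntisymm P f := by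
  intro i
  refine b.induction_reflect i (p := fun i ↦ ∀ v, f.coeff (P.reflection i v) = -f.coeff v)
    (fun i hi v ↦ ?_) (fun j hj ↦ h ⟨j, hj⟩) (fun i j hi hj v ↦ ?_)
  · rw [P.reflection_reflectionPerm, LinearEquiv.mul_apply, LinearEquiv.mul_apply, hi, hi, hi,
      neg_neg]
  · rw [P.reflection_reflectionPerm, LinearEquiv.mul_apply, LinearEquiv.mul_apply, h ⟨j, hj⟩, hi,
      h ⟨j, hj⟩, neg_neg]

lemma IsAntisymm.coeff_smul [Module.Finite ℝ V] {f : AddMonoidAlgebra ℂ V} (hf : IsAntisymm P f)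
    (g : P.weylGroup) (v : V) : f.coeff (g • v) = sign P g * f.coeff v := by
  obtain ⟨g, hg⟩ := g
  induction hg using RootPairing.weylGroup.induction generalizing v with
  | mem i =>
    have h := sign_ofIdx (P := P) i
    change sign P ⟨_, P.reflection_mem_weylGroup i⟩ = -1 at h
    rw [h]
    push_cast
    rw [neg_one_mul, ← hf i]
    rfl
  | one =>
    have h : sign P (1 : P.weylGroup) = 1 := by rw [sign, map_one]; simp
    change f.coeff ((1 : P.weylGroup) • v) = (sign P (1 : P.weylGroup) : ℂ) * f.coeff v
    rw [h, one_smul]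
    push_cast
    rw [one_mul]
  | mul g g' hg hg' ih ih' =>
    change f.coeff (((⟨g, hg⟩ : P.weylGroup) * ⟨g', hg'⟩) • v) =
      (sign P ((⟨g, hg⟩ : P.weylGroup) * ⟨g', hg'⟩) : ℂ) * f.coeff v
    rw [mul_smul, ih, ih', sign_mul]
    push_cast
    ring

lemma sign_mul_self (g : P.weylGroup) [Module.Finite ℝ V] : sign P g * sign P g = 1 := by
  obtain ⟨g, hg⟩ := g
  induction hg using RootPairing.weylGroup.induction with
  | mem i =>
    have h := sign_ofIdx (P := P) i
    change sign P ⟨_, P.reflection_mem_weylGroup i⟩ = -1 at h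
    rw [h]
    norm_num
  | one =>
    have h : sign P (1 : P.weylGroup) = 1 := by rw [sign, map_one]; simp
    change sign P (1 : P.weylGroup) * sign P (1 : P.weylGroup) = 1
    rw [h, one_mul]
  | mul g g' hg hg' ih ih' =>
    change sign P ((⟨g, hg⟩ : P.weylGroup) * ⟨g', hg'⟩) *
      sign P ((⟨g, hg⟩ : P.weylGroup) * ⟨g', hg'⟩) = 1
    rw [sign_mul, mul_mul_mul_comm, ih, ih', one_mul]

lemma IsAntisymm.coeff_smul_ne_zero [Module.Finite ℝ V] {f : AddMonoidAlgebra ℂ V}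
    (hf : IsAntisymm P f) (g : P.weylGroup) {v : V} : f.coeff (g • v) ≠ 0 ↔ f.coeff v ≠ 0 := by
  have h : (sign P g : ℂ) ≠ 0 := by
    intro h
    have h' := sign_mul_self g
    rw [Complex.ofReal_eq_zero.mp h] at h'
    simp at h'
  rw [hf.coeff_smul, mul_ne_zero_iff]
  exact and_iff_right h

variable [P.IsRootSystem]

/-- Averaging over the Weyl group writes `|W| f(x)` as the sum of the `S_v(x)` weighted by the
coefficients of `f`. -/
lemma IsAntisymm.evalAt_eq_zero [Module.Finite ℝ V] {f : AddMonoidAlgebra ℂ V}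
    (hf : IsAntisymm P f) {x : T} (h : ∀ v, f.coeff v ≠ 0 → sFunction P v x = 0) :
    evalAt P x f = 0 := by
  have h1 : ∀ g : P.weylGroup, evalAt P x f = ∑ v ∈ f.coeff.support, f.coeff v * ((sign P g : ℂ) *
      Complex.exp (2 * Real.pi * Complex.I * (pair P (g • v) x : ℂ))) := by
    intro g
    rw [evalAt_eq_sum, Finsupp.sum]
    symm
    refine Finset.sum_nbij' (g • ·) (g⁻¹ • ·) ?_ ?_ (by simp) (by simp) ?_
    · intro v hv
      rw [Finsupp.mem_support_iff] at hv ⊢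
      exact (hf.coeff_smul_ne_zero g).mpr hv
    · intro v hv
      rw [Finsupp.mem_support_iff] at hv ⊢
      exact (hf.coeff_smul_ne_zero g⁻¹).mpr hv
    · intro v _
      rw [hf.coeff_smul]
      ring
  have h2 : (Fintype.card P.weylGroup : ℂ) * evalAt P x f = 0 := by
    rw [← nsmul_eq_mul, ← Finset.card_univ, ← Finset.sum_const,
      Finset.sum_congr rfl fun g _ ↦ h1 g, Finset.sum_comm]
    refine Finset.sum_eq_zero fun v hv ↦ ?_
    rw [← Finset.mul_sum]
    exact mul_eq_zero_of_right _ (h v (Finsupp.mem_support_iff.mp hv))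
  exact (mul_eq_zero.mp h2).resolve_left (by exact_mod_cast Fintype.card_ne_zero)

end Antisymmetric

/-! ### The Weyl denominator. -/

section Denominator

open AddMonoidAlgebra (single)

variable {ι V T : Type*} [AddCommGroup V] [Module ℝ V] [AddCommGroup T] [Module ℝ T]
  {P : RootPairing ι ℝ V T}

/-- The factor `e^{α/2} - e^{-α/2}` of the Weyl denominator. -/
def denFactor (P : RootPairing ι ℝ V T) (i : ι) : AddMonoidAlgebra ℂ V :=
  single ((1 / 2 : ℝ) • P.root i) 1 - single (-((1 / 2 : ℝ) • P.root i)) 1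

open Classical in
/-- The Weyl denominator `∏ (e^{α/2} - e^{-α/2})`, over the positive roots `α`. -/
def denominator [Fintype ι] (b : P.Base) : AddMonoidAlgebra ℂ V :=
  ∏ i with b.IsPos i, denFactor P i

lemma actHom_denFactor (i j : ι) :
    actHom (P.reflection j : V →ₗ[ℝ] V) (denFactor P i) = denFactor P (P.reflectionPerm j i) := by
  simp [denFactor, map_sub, RootPairing.root_reflectionPerm, -AddMonoidAlgebra.mapDomainAlgHom_apply]

lemma denFactor_reflectionPerm_self (i : ι) :
    denFactor P (P.reflectionPerm i i) = -denFactor P i := by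
  simp [denFactor, RootPairing.root_reflectionPerm]

lemma hasTop_denFactor [Finite ι] {b : P.Base} [P.IsRootSystem] {i : ι} (hi : b.IsPos i) :
    HasTop (rootCone b) (denFactor P i) ((1 / 2 : ℝ) • P.root i) 1 := by
  classical
  have h0 : (1 / 2 : ℝ) • P.root i ≠ -((1 / 2 : ℝ) • P.root i) := by
    intro h
    have h1 : P.root i = 0 := by
      have : (1 / 2 : ℝ) • P.root i + (1 / 2 : ℝ) • P.root i = 0 := by
        nth_rewrite 1 [h]; rw [neg_add_cancel]
      rw [← this, ← add_smul]; norm_num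
    exact P.ne_zero i h1
  have hc : ∀ v, (denFactor P i).coeff v = (if (1 / 2 : ℝ) • P.root i = v then 1 else 0) -
      (if -((1 / 2 : ℝ) • P.root i) = v then 1 else 0) := by
    intro v
    simp [denFactor, Finsupp.single_apply]
  refine ⟨?_, fun μ hμ ↦ ?_⟩
  · rw [hc, if_pos rfl, if_neg h0.symm, sub_zero]
  · rw [hc] at hμ
    by_cases h1 : (1 / 2 : ℝ) • P.root i = μ
    · rw [h1, sub_self]; exact zero_mem _
    · by_cases h2 : -((1 / 2 : ℝ) • P.root i) = μ
      · rw [← h2, sub_neg_eq_add, ← add_smul]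
        norm_num
        exact root_mem_rootCone hi
      · rw [if_neg h1, if_neg h2, sub_zero] at hμ
        exact absurd rfl hμ

variable [Fintype ι] [P.IsRootSystem] [P.IsCrystallographic] [P.IsReduced] (b : P.Base)

lemma hasTop_denominator : HasTop (rootCone b) (denominator b) (rho b) 1 := by
  classical
  have h := HasTop.prod (C := rootCone b) (fun v ↦ eq_zero_of_mem_rootCone_neg b)
    (Finset.univ.filter fun i ↦ b.IsPos i) (f := denFactor P)
    (v := fun i ↦ (1 / 2 : ℝ) • P.root i) fun i hi ↦ hasTop_denFactor (Finset.mem_filter.mp hi).2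
  rw [← halfSum_eq_rho b, halfSum, Finset.smul_sum, denominator]
  convert h

/-- A simple reflection negates its own factor and permutes the others. -/
lemma isAntisymm_denominator : IsAntisymm P (denominator b) := by
  classical
  refine isAntisymm_of_support b fun j v ↦ ?_
  have hj : (j : ι) ∈ Finset.univ.filter fun i ↦ b.IsPos i := by
    simpa using b.isPos_of_mem_support j.2
  have h : actHom (P.reflection j : V →ₗ[ℝ] V) (denominator b) = -denominator b := by
    rw [denominator, map_prod]
    simp only [actHom_denFactor]
    rw [← Finset.mul_prod_erase _ _ hj, image_reflectionPerm_pos b j (denFactor P),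
      denFactor_reflectionPerm_self, neg_mul, Finset.mul_prod_erase _ _ hj]
  have h1 := coeff_actHom (P.reflection j : V →ₗ[ℝ] V) (P.reflection j).injective (denominator b) v
  rw [h] at h1
  rw [← h1]
  simp

/-- The exponents of the Weyl denominator are the conjugates of `ρ`. -/
lemma exists_smul_eq_rho [Nonempty ι] {v : V} (hv : (denominator b).coeff v ≠ 0) :
    ∃ g : P.weylGroup, g • v = rho b := by
  have : Module.Finite ℝ V := Module.Finite.of_basis b.toWeightBasis
  obtain ⟨g, hg⟩ := exists_dominant_smul b v
  refine ⟨g, ?_⟩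
  have h1 := ((isAntisymm_denominator b).coeff_smul_ne_zero g).mpr hv
  have h2 := (hasTop_denominator b).2 _ h1
  refine (sub_eq_zero.mp (eq_zero_of_mem_rootCone_of_pair_nonpos b h2 fun j ↦ ?_)).symm
  rw [pair_sub_left, pair_rho]
  -- An exponent fixed by a reflection has coefficient zero. So the pairings of a dominant exponent
  -- with the simple co-roots are positive integers, hence at least those of `ρ`.
  have h3 : pair P (g • v) (P.coroot j) ≠ 0 := by
    intro h0
    have h4 : P.reflection j (g • v) = g • v := by rw [reflection_eq, h0, zero_smul, sub_zero]
    have h5 := isAntisymm_denominator b j (g • v)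
    rw [h4] at h5
    exact h1 (self_eq_neg.mp h5)
  obtain ⟨c, hc⟩ := h2
  have h6 : ∃ z : ℤ, pair P (g • v) (P.coroot j) = z := by
    have h7 : g • v = rho b - ∑ j, (c j : ℝ) • P.root j := by rw [← hc]; abel
    refine ⟨1 - ∑ k : b.support, c k * P.pairingIn ℤ k j, ?_⟩
    rw [h7, pair_sub_left, pair_rho]
    push_cast
    congr 1
    rw [pair, map_sum, LinearMap.sum_apply]
    refine Finset.sum_congr rfl fun k _ ↦ ?_
    rw [map_smul, LinearMap.smul_apply, smul_eq_mul]
    congr 1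
    exact (P.algebraMap_pairingIn ℤ k j).symm
  obtain ⟨z, hz⟩ := h6
  have h8 := hg j
  rw [hz] at h3 h8 ⊢
  have h9 : 1 ≤ z := by
    have : (0 : ℤ) ≤ z := by exact_mod_cast h8
    have : z ≠ 0 := by exact_mod_cast h3
    omega
  have : (1 : ℝ) ≤ z := by exact_mod_cast h9
  linarith

/-- A factor vanishes at `x` only if `e^{2πi⟨α, x⟩} = 1`. -/
lemma evalAt_denominator_ne_zero {x : T}
    (hx : ∀ i, ¬ ∃ z : ℤ, pair P (P.root i) x = z) : evalAt P x (denominator b) ≠ 0 := by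
  rw [denominator, map_prod]
  refine Finset.prod_ne_zero_iff.mpr fun i _ h ↦ hx i ?_
  rw [denFactor, map_sub, evalAt_single, evalAt_single, sub_eq_zero, one_mul, one_mul] at h
  rw [← exp_two_pi_I_eq_one_iff]
  have h1 : (2 * Real.pi * Complex.I * (pair P (P.root i) x : ℂ)) =
      2 * Real.pi * Complex.I * (pair P ((1 / 2 : ℝ) • P.root i) x : ℂ) -
      2 * Real.pi * Complex.I * (pair P (-((1 / 2 : ℝ) • P.root i)) x : ℂ) := by
    rw [← mul_sub, ← neg_smul, pair_smul_left, pair_smul_left]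
    push_cast
    ring
  rw [h1, Complex.exp_sub, h, div_self (Complex.exp_ne_zero _)]

end Denominator

/-! ### The Casimir argument for the numerator of the character formula. -/

section WeylCharacter

open AddMonoidAlgebra (single)

variable {ι V T : Type*} [AddCommGroup V] [Module ℝ V] [AddCommGroup T] [Module ℝ T]
  {P : RootPairing ι ℝ V T} {B : V →ₗ[ℝ] V →ₗ[ℝ] ℂ} (hB : ∀ u v, B u v = B v u)

include hB in
/-- The product of a denominator factor with the operators attached to `±α`. -/
lemma gradProd_denFactor {i i' : ι} (hi : P.root i' = -P.root i) {χ A A' : AddMonoidAlgebra ℂ V}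
    (h : ∀ μ, A.coeff μ - A.coeff (μ + P.root i) = B (P.root i) μ * χ.coeff μ)
    (h' : ∀ μ, A'.coeff μ - A'.coeff (μ + P.root i') = B (P.root i') μ * χ.coeff μ) :
    gradProd (fun v ↦ B v v) (denFactor P i) χ = denFactor P i * (A + A') := by
  set a : V := (1 / 2 : ℝ) • P.root i with ha
  have haa : a + a = P.root i := by rw [ha, ← add_smul]; norm_num
  -- The difference equation for `A` read as multiplication by `1 - e^{-α}`; times `e^{α/2}` this
  -- becomes the denominator factor. The equation for `A'` is the same with `-α`.
  have h1 : A - single (-P.root i) 1 * A = diagOp (B (P.root i)) χ := by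
    ext μ
    simp only [AddMonoidAlgebra.coeff_sub, Finsupp.sub_apply, coeff_diagOp,
      AddMonoidAlgebra.coeff_single_mul_apply, one_mul, neg_neg]
    rw [← h, add_comm μ]
  have h2 : A' - single (P.root i) 1 * A' = -diagOp (B (P.root i)) χ := by
    ext μ
    have := h' μ
    simp only [AddMonoidAlgebra.coeff_sub, Finsupp.sub_apply, coeff_diagOp,
      AddMonoidAlgebra.coeff_single_mul_apply, one_mul, AddMonoidAlgebra.coeff_neg,
      Finsupp.neg_apply]
    rw [hi, map_neg, LinearMap.neg_apply, neg_mul, add_comm μ] at this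
    exact this
  have h3 : diagOp (B a) χ = (1 / 2 : ℂ) • diagOp (B (P.root i)) χ := by
    ext μ
    simp [ha]
    ring
  have h4 : diagOp (B (-a)) χ = -((1 / 2 : ℂ) • diagOp (B (P.root i)) χ) := by
    rw [← h3]
    ext μ
    simp
  have e1 : single (-a) (1 : ℂ) = single a 1 * single (-P.root i) 1 := by
    rw [AddMonoidAlgebra.single_mul_single, one_mul, ← haa]
    congr 1
    abel
  have e2 : single a (1 : ℂ) = single (-a) 1 * single (P.root i) 1 := by
    rw [AddMonoidAlgebra.single_mul_single, one_mul, ← haa]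
    congr 1
    abel
  have e3 : single a (1 : ℂ) * A - single (-a) 1 * A = single a 1 * diagOp (B (P.root i)) χ := by
    rw [← h1, e1]
    ring
  have e4 : single a (1 : ℂ) * A' - single (-a) 1 * A' =
      single (-a) 1 * diagOp (B (P.root i)) χ := by
    rw [← neg_neg (diagOp (B (P.root i)) χ), ← h2, e2]
    ring
  rw [denFactor, ← ha, gradProd_sub_left, gradProd_single B hB, gradProd_single B hB, h3, h4]
  have h5 : ∀ u y : AddMonoidAlgebra ℂ V, 2 * (u * ((1 / 2 : ℂ) • y)) = u * y := by
    intro u y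
    rw [mul_smul_comm, two_mul, ← add_smul]
    norm_num
  rw [mul_neg, mul_neg, h5, h5, ← e3, ← e4]
  ring

include hB in
-- Logarithmic derivatives add over a product.
lemma gradProd_prod {κ : Type*} (s : Finset κ) {f g : κ → AddMonoidAlgebra ℂ V}
    {χ : AddMonoidAlgebra ℂ V} (h : ∀ i ∈ s, gradProd (fun v ↦ B v v) (f i) χ = f i * g i) :
    gradProd (fun v ↦ B v v) (∏ i ∈ s, f i) χ = (∏ i ∈ s, f i) * ∑ i ∈ s, g i := by
  classical
  induction s using Finset.induction_on with
  | empty => simp [gradProd_one_left B hB]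
  | insert i s hi ih =>
    rw [Finset.prod_insert hi, Finset.sum_insert hi, gradProd_mul_left B hB,
      ih fun k hk ↦ h k (by simp [hk]), h i (by simp)]
    ring

open Classical in
lemma sum_eq_sum_pos [Fintype ι] {b : P.Base} {β : Type*} [AddCommMonoid β] (f : ι → β) :
    ∑ i, f i = ∑ i with b.IsPos i, (f i + f (P.reflectionPerm i i)) := by
  have hneg : ∀ i, b.IsPos (P.reflectionPerm i i) ↔ ¬ b.IsPos i := fun i ↦
    isPos_neg_iff (by simp [RootPairing.root_reflectionPerm])
  have hinv : ∀ i, P.reflectionPerm (P.reflectionPerm i i) (P.reflectionPerm i i) = i := by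
    intro i
    apply P.root.injective
    rw [P.root_reflectionPerm, P.reflection_apply_self, P.root_reflectionPerm,
      P.reflection_apply_self, neg_neg]
  rw [Finset.sum_add_distrib, ← Finset.sum_filter_add_sum_filter_not _ (fun i ↦ b.IsPos i)]
  congr 1
  refine Finset.sum_nbij' (fun i ↦ P.reflectionPerm i i) (fun i ↦ P.reflectionPerm i i) ?_ ?_ ?_ ?_
    ?_
  · intro i hi
    simpa [hneg] using hi
  · intro i hi
    simpa [hneg] using hi
  · intro i _; exact hinv i
  · intro i _; exact hinv i
  · intro i _; simp only [hinv]

variable {r : ι → ℝ} (hBr : ∀ i v, B (P.root i) v = (r i * pair P v (P.coroot i) : ℝ))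

include hB hBr in
lemma form_reflection [Finite ι] (i : ι) (v : V) : B (P.reflection i v) (P.reflection i v) = B v v := by
  have h2 : pair P (P.root i) (P.coroot i) = 2 := P.root_coroot_two i
  rw [reflection_eq]
  simp only [map_sub, map_smul, LinearMap.sub_apply, LinearMap.smul_apply]
  rw [hB v (P.root i), hBr, hBr, h2]
  simp only [Complex.real_smul]
  push_cast
  ring

include hB hBr in
lemma form_smul [Finite ι] (g : P.weylGroup) (v : V) : B (g • v) (g • v) = B v v := by
  obtain ⟨g, hg⟩ := g
  induction hg using RootPairing.weylGroup.induction generalizing v with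
  | mem i => exact form_reflection hB hBr i v
  | one => exact congrArg (fun v ↦ B v v) (one_smul P.weylGroup v)
  | mul g g' hg hg' ih ih' =>
    have h : (⟨g * g', mul_mem hg hg'⟩ : P.weylGroup) • v =
      (⟨g, hg⟩ : P.weylGroup) • (⟨g', hg'⟩ : P.weylGroup) • v :=
        mul_smul (⟨g, hg⟩ : P.weylGroup) (⟨g', hg'⟩ : P.weylGroup) v
    rw [h, ih, ih']

variable [Fintype ι] [P.IsRootSystem] [P.IsCrystallographic] [P.IsReduced] [Nonempty ι]
  (b : P.Base)

include hB hBr in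
-- All exponents are conjugates of `ρ`, and the form is invariant.
lemma diagOp_denominator :
    diagOp (fun v ↦ B v v) (denominator b) = B (rho b) (rho b) • denominator b := by
  ext v
  simp only [coeff_diagOp, AddMonoidAlgebra.coeff_smul, Finsupp.smul_apply, smul_eq_mul]
  by_cases h : (denominator b).coeff v = 0
  · simp [h]
  · obtain ⟨g, hg⟩ := exists_smul_eq_rho b h
    rw [← hg, form_smul hB hBr]

/-- The eigenvalue of the quadratic form determines a dominant exponent below a strictly
dominant one. -/
lemma eq_of_form_eq (hB : ∀ u v, B u v = B v u)
    (hBr : ∀ i v, B (P.root i) v = (r i * pair P v (P.coroot i) : ℝ)) (hr : ∀ i, 0 < r i)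
    {v w : V} (hvw : w - v ∈ rootCone b) (h : B v v = B w w)
    (hv : ∀ j : b.support, 0 ≤ pair P v (P.coroot j))
    (hw : ∀ j : b.support, 0 < pair P w (P.coroot j)) : v = w := by
  obtain ⟨c, hc⟩ := hvw
  -- Expanding `w - v` in simple roots makes this a sum of nonnegative coefficients times positive
  -- numbers, so all the coefficients vanish.
  have h1 : B (w - v) (w + v) = 0 := by
    simp only [map_sub, map_add, LinearMap.sub_apply]
    rw [h, hB w v]
    ring
  rw [hc, map_sum, LinearMap.sum_apply] at h1
  simp only [map_smul, LinearMap.smul_apply, hBr, Complex.real_smul] at h1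
  have h2 : ∑ j : b.support, (c j : ℝ) * (r j * pair P (w + v) (P.coroot j)) = 0 := by
    exact_mod_cast h1
  have hpos : ∀ j : b.support, 0 < r j * pair P (w + v) (P.coroot j) := by
    intro j
    rw [pair_add_left]
    exact mul_pos (hr j) (by linarith [hv j, hw j])
  have h3 := (Finset.sum_eq_zero_iff_of_nonneg
    (fun j _ ↦ mul_nonneg (Nat.cast_nonneg (c j)) (hpos j).le)).mp h2
  have h4 : w - v = 0 := by
    rw [hc]
    refine Finset.sum_eq_zero fun j hj ↦ ?_
    rw [(mul_eq_zero.mp (h3 j hj)).resolve_right (hpos j).ne', zero_smul]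
  exact (sub_eq_zero.mp h4).symm

/-- The argument of the Weyl character formula: if `χ` is invariant, with leading exponent `l`,
and satisfies the identities that the Casimir operator implies for a character, then the product
of `χ` with the Weyl denominator is a combination of the exponentials of the conjugates
of `l + ρ`; so `χ` vanishes at every regular point where the `S`-function of `l + ρ` does. -/
theorem evalAt_eq_zero_of_casimir (hB : ∀ u v, B u v = B v u)
    (hBr : ∀ i v, B (P.root i) v = (r i * pair P v (P.coroot i) : ℝ)) (hr : ∀ i, 0 < r i)
    {χ : AddMonoidAlgebra ℂ V} {A : ι → AddMonoidAlgebra ℂ V} {c : ℂ}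
    (hA : ∀ i μ, (A i).coeff μ - (A i).coeff (μ + P.root i) = B (P.root i) μ * χ.coeff μ)
    (hc : ∀ μ, c * χ.coeff μ = B μ μ * χ.coeff μ + ∑ i, (A i).coeff μ)
    (hχ : ∀ i μ, χ.coeff (P.reflection i μ) = χ.coeff μ)
    {l : V} (hl : ∀ j : b.support, 0 ≤ pair P l (P.coroot j)) {a : ℂ} (ha : a ≠ 0)
    (htop : HasTop (rootCone b) χ l a) {x : T}
    (hx : ∀ i, ¬ ∃ z : ℤ, pair P (P.root i) x = z) (hS : sFunction P (l + rho b) x = 0) :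
    evalAt P x χ = 0 := by
  classical
  have : Module.Finite ℝ V := Module.Finite.of_basis b.toWeightBasis
  have hgrad : gradProd (fun v ↦ B v v) (denominator b) χ = denominator b * ∑ i, A i := by
    rw [sum_eq_sum_pos (P := P) (b := b), denominator]
    refine gradProd_prod hB _ fun i _ ↦ ?_
    exact gradProd_denFactor hB (by simp [RootPairing.root_reflectionPerm]) (hA i) (hA _)
  have hlap : diagOp (fun v ↦ B v v) χ = c • χ - ∑ i, A i := by
    ext μ
    rw [coeff_diagOp, AddMonoidAlgebra.coeff_sub, Finsupp.sub_apply,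
      AddMonoidAlgebra.coeff_smul_apply, smul_eq_mul, hc, AddMonoidAlgebra.coeff_sum,
      Finsupp.finsetSum_apply]
    ring
  -- The gradient product supplies exactly the term `denominator b * ∑ A i` that the Laplacian of
  -- `χ` lacks for being `c χ`.
  have heig : diagOp (fun v ↦ B v v) (denominator b * χ) =
      (c + B (rho b) (rho b)) • (denominator b * χ) := by
    have h : diagOp (fun v ↦ B v v) (denominator b * χ) =
      gradProd (fun v ↦ B v v) (denominator b) χ +
        denominator b * diagOp (fun v ↦ B v v) χ + χ * diagOp (fun v ↦ B v v) (denominator b) := by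
      rw [gradProd]
      ring
    rw [h, hgrad, hlap, diagOp_denominator hB hBr, add_smul, mul_sub, mul_smul_comm, mul_smul_comm,
      mul_comm χ]
    ring
  have hcoef : ∀ v, (denominator b * χ).coeff v ≠ 0 → B v v = c + B (rho b) (rho b) := by
    intro v hv
    have := congrArg (fun f ↦ f.coeff v) heig
    simp only [coeff_diagOp, AddMonoidAlgebra.coeff_smul, Finsupp.smul_apply, smul_eq_mul] at this
    exact mul_right_cancel₀ hv this
  have htop' : HasTop (rootCone b) (denominator b * χ) (l + rho b) a := by
    have := (hasTop_denominator b).mul (fun v ↦ eq_zero_of_mem_rootCone_neg b) htop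
    rwa [one_mul, add_comm] at this
  have hanti : IsAntisymm P (denominator b * χ) := by
    intro i v
    have hinj : Function.Injective (P.reflection i : V →ₗ[ℝ] V) := (P.reflection i).injective
    have h1 : actHom (P.reflection i : V →ₗ[ℝ] V) (denominator b) = -denominator b := by
      ext μ
      obtain ⟨ν, rfl⟩ := (P.reflection i).surjective μ
      refine (coeff_actHom _ hinj _ ν).trans ?_
      rw [AddMonoidAlgebra.coeff_neg, Finsupp.neg_apply, isAntisymm_denominator b i, neg_neg]
    have h2 : actHom (P.reflection i : V →ₗ[ℝ] V) χ = χ := by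
      ext μ
      obtain ⟨ν, rfl⟩ := (P.reflection i).surjective μ
      exact (coeff_actHom _ hinj _ ν).trans (hχ i ν).symm
    have h3 : actHom (P.reflection i : V →ₗ[ℝ] V) (denominator b * χ) = -(denominator b * χ) := by
      rw [map_mul, h1, h2, neg_mul]
    have h4 := coeff_actHom _ hinj (denominator b * χ) v
    rw [h3] at h4
    rw [← h4]
    simp
  have hzero : evalAt P x (denominator b * χ) = 0 := by
    refine hanti.evalAt_eq_zero fun v hv ↦ ?_
    obtain ⟨g, hg⟩ := exists_dominant_smul b v
    have h1 := (hanti.coeff_smul_ne_zero g).mpr hv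
    -- The eigenvalue need not be computed: `l + ρ` is itself an exponent, so every exponent has its
    -- length.
    have h2 : g • v = l + rho b := by
      refine eq_of_form_eq b hB hBr hr (htop'.2 _ h1) ?_ hg fun j ↦ ?_
      · rw [hcoef _ h1, hcoef _ (htop'.1.trans_ne ha)]
      · rw [pair_add_left, pair_rho]
        linarith [hl j]
    have h3 := sFunction_smul_eq_zero hS g⁻¹
    rwa [← h2, inv_smul_smul] at h3
  rw [map_mul] at hzero
  exact (mul_eq_zero.mp hzero).resolve_left (evalAt_denominator_ne_zero b hx)

end WeylCharacter

/-! ### The real root system of `𝔤` and regularity. -/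

section LieRootSystem

variable {𝔤 : Type*} [LieRing 𝔤] [LieAlgebra ℂ 𝔤] [FiniteDimensional ℂ 𝔤] [LieAlgebra.IsSimple ℂ 𝔤]
  {H : LieSubalgebra ℂ 𝔤} [H.IsCartanSubalgebra]

lemma coe_pair (v : realDual H) (x : realCartan H) :
    (pair (realRootSystem H) v x : ℂ) = (v : Dual ℂ H) (x : H) :=
  have := RootPairing.IsValuedIn.trans (LieAlgebra.IsKilling.rootSystem H) ℝ ℤ
  RootPairing.restrictScalars_toLinearMap_apply_apply (P := LieAlgebra.IsKilling.rootSystem H) ℝ v x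

lemma coe_pairing (i j : H.root) : (((realRootSystem H).pairing i j : ℝ) : ℂ) =
    (LieAlgebra.IsKilling.rootSystem H).pairing i j :=
  coe_pair ((realRootSystem H).root i) ((realRootSystem H).coroot j)

lemma isCrystallographic_realRootSystem : (realRootSystem H).IsCrystallographic where
  exists_value i j := by
    obtain ⟨z, hz⟩ := RootPairing.exists_value (P := LieAlgebra.IsKilling.rootSystem H) (S := ℤ) i j
    refine ⟨z, ?_⟩
    have h := (coe_pairing i j).trans hz.symm
    rw [eq_intCast] at h ⊢
    exact_mod_cast h.symm

lemma isReduced_realRootSystem : (realRootSystem H).IsReduced where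
  eq_or_eq_neg i j h := by
    have h1 : ¬ LinearIndependent ℂ ![(LieAlgebra.IsKilling.rootSystem H).root i,
        (LieAlgebra.IsKilling.rootSystem H).root j] := by
      intro h2
      refine h (LinearIndependent.of_comp ((realDual H).subtype) ?_)
      have h3 : (realDual H).subtype ∘ ![(realRootSystem H).root i, (realRootSystem H).root j] =
          ![(LieAlgebra.IsKilling.rootSystem H).root i,
            (LieAlgebra.IsKilling.rootSystem H).root j] := by
        ext k x
        fin_cases k <;> rfl
      rw [h3]
      exact h2.restrict_scalars' ℝ
    rcases RootPairing.IsReduced.eq_or_eq_neg i j h1 with h2 | h2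
    · exact Or.inl (Subtype.ext h2)
    · exact Or.inr (Subtype.ext h2)

/-- For an invariant real subspace `q`, co-roots of roots outside `q` vanish on `q`. So the complex
span of the roots in `q` is invariant, hence everything, and a root outside `q` would pair to zero
with its own co-root. -/
lemma isIrreducible_realRootSystem : (realRootSystem H).IsIrreducible := by
  set P := realRootSystem H with hP
  set Q := LieAlgebra.IsKilling.rootSystem H with hQ
  have : Nontrivial (realDual H) := ⟨P.root (Classical.arbitrary _), 0, P.ne_zero _⟩
  refine RootPairing.IsIrreducible.mk' P fun q hq hq0 ↦ ?_
  let q' : P.invtRootSubmodule := ⟨q, P.mem_invtRootSubmodule_iff.mpr hq⟩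
  have hker : ∀ k, P.root k ∉ q → ∀ i, P.root i ∈ q → Q.pairing i k = 0 := by
    intro k hk i hi
    have h1 := RootPairing.invtRootSubmodule.le_ker_coroot' q' (k := k) hk hi
    have h2 : P.pairing i k = 0 := h1
    rw [← coe_pairing, h2, Complex.ofReal_zero]
  let U : Submodule ℂ (Dual ℂ H) := Submodule.span ℂ (Q.root '' {i | P.root i ∈ q})
  have hU : ∀ k, P.root k ∉ q → U ≤ LinearMap.ker (Q.coroot' k) := by
    intro k hk
    refine Submodule.span_le.mpr ?_
    rintro _ ⟨i, hi, rfl⟩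
    exact hker k hk i hi
  have hinv : ∀ k, U ∈ Module.End.invtSubmodule (Q.reflection k) := by
    intro k v hv
    rw [Submodule.mem_comap, LinearEquiv.coe_coe, RootPairing.reflection_apply]
    by_cases hk : P.root k ∈ q
    · exact U.sub_mem hv (U.smul_mem _ (Submodule.subset_span ⟨k, hk, rfl⟩))
    · rw [LinearMap.mem_ker.mp (hU k hk hv), zero_smul, sub_zero]
      exact hv
  have hU0 : U ≠ ⊥ := by
    intro h0
    have h1 : q' = ⊥ := by
      rw [RootPairing.invtRootSubmodule.eq_bot_iff]
      intro i hi
      have h2 : Q.root i ∈ U := Submodule.subset_span ⟨i, hi, rfl⟩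
      rw [h0, Submodule.mem_bot] at h2
      exact Q.ne_zero i h2
    exact hq0 (congrArg Subtype.val h1)
  have htop : U = ⊤ := RootPairing.IsIrreducible.eq_top_of_invtSubmodule_reflection U hinv hU0
  have h2 : q' = ⊤ := by
    rw [RootPairing.invtRootSubmodule.eq_top_iff]
    rintro _ ⟨k, rfl⟩
    by_contra hk
    have h3 : Q.root k ∈ LinearMap.ker (Q.coroot' k) := hU k hk (htop ▸ Submodule.mem_top)
    have h4 : Q.pairing k k = 0 := h3
    rw [RootPairing.pairing_same] at h4
    exact two_ne_zero h4
  exact congrArg Subtype.val h2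

lemma weight_apply_eq_pair (i : H.root) (x : realCartan H) :
    ((i : LieModule.Weight ℂ H 𝔤) : H → ℂ) (x : H) =
      (pair (realRootSystem H) ((realRootSystem H).root i) x : ℂ) :=
  (coe_pair ((realRootSystem H).root i) x).symm

/-- A point is regular if and only if no root takes an integral value on it. -/
lemma isRegular_iff (x : realCartan H) :
    IsRegular x ↔ ∀ i, ¬ ∃ z : ℤ, pair (realRootSystem H) ((realRootSystem H).root i) x = z := by
  have hH : LieAlgebra.rootSpace H (0 : H → ℂ) = H.toLieSubmodule :=
    LieAlgebra.rootSpace_zero_eq ℂ 𝔤 H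
  have hle : H.toSubmodule ≤ centralizer x := by
    have : Nontrivial 𝔤 := (LieModule.nontrivial_of_isIrreducible ℂ 𝔤 𝔤)
    have h0 : ((0 : LieModule.Weight ℂ H 𝔤) : H → ℂ) = 0 := rfl
    have h : (LieAlgebra.rootSpace H ((0 : LieModule.Weight ℂ H 𝔤) : H → ℂ)).toSubmodule ≤
        centralizer x :=
      le_iSup₂_of_le (f := fun (α : LieModule.Weight ℂ H 𝔤)
        (_ : Complex.exp (2 * Real.pi * Complex.I * α (x : H)) = 1) ↦
          (LieAlgebra.rootSpace H α).toSubmodule) 0 (by simp) le_rfl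
    rw [h0, hH] at h
    exact h
  constructor
  · rintro hx i hi
    have hi' : Complex.exp (2 * Real.pi * Complex.I * (i : LieModule.Weight ℂ H 𝔤) (x : H)) = 1 := by
      rw [weight_apply_eq_pair, exp_two_pi_I_eq_one_iff]
      exact hi
    have h1 : (LieAlgebra.rootSpace H ((i : LieModule.Weight ℂ H 𝔤) : H → ℂ)).toSubmodule ≤
        centralizer x :=
      le_iSup₂_of_le (f := fun (α : LieModule.Weight ℂ H 𝔤)
        (_ : Complex.exp (2 * Real.pi * Complex.I * α (x : H)) = 1) ↦
          (LieAlgebra.rootSpace H α).toSubmodule) (i : LieModule.Weight ℂ H 𝔤) hi' le_rfl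
    -- Equal dimensions put the root space of `i` inside `H`, the zero root space, from which it is
    -- disjoint.
    have h2 : H.toSubmodule = centralizer x :=
      Submodule.eq_of_le_of_finrank_eq hle hx.symm
    have hne : (((i : LieModule.Weight ℂ H 𝔤) : H → ℂ)) ≠ 0 := H.isNonZero_coe_root i
    have h3 := LieModule.disjoint_genWeightSpace ℂ H 𝔤 hne
    have h4 : LieAlgebra.rootSpace H ((i : LieModule.Weight ℂ H 𝔤) : H → ℂ) ≤
        LieAlgebra.rootSpace H (0 : H → ℂ) := by
      rw [hH]
      intro y hy
      have hy' : y ∈ H.toSubmodule := by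
        rw [h2]
        exact h1 hy
      exact hy'
    exact (i : LieModule.Weight ℂ H 𝔤).genWeightSpace_ne_bot' (h3.eq_bot_of_le h4)
  · intro hx
    have h : centralizer x = H.toSubmodule := by
      refine le_antisymm (iSup₂_le fun α hα ↦ ?_) hle
      have h0 : α.IsZero := by
        by_contra hne
        have hmem : α ∈ H.root := by simpa using hne
        refine hx ⟨α, hmem⟩ ?_
        rw [← exp_two_pi_I_eq_one_iff, ← weight_apply_eq_pair]
        exact hα
      rw [h0.eq, hH]
      exact le_rfl
    rw [IsRegular, h]
    rfl

end LieRootSystem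

/-! ### Interior points of the simplex. -/

section Alcove

variable {ι V T : Type*} [Finite ι] [AddCommGroup V] [Module ℝ V] [AddCommGroup T] [Module ℝ T]
  {P : RootPairing ι ℝ V T} [P.IsRootSystem] [P.IsCrystallographic] [P.IsReduced]
  [P.IsIrreducible] [Nonempty ι] (b : P.Base)

lemma pair_root_mem_Ioo {x : T} (hx : x ∈ openChamber b) {i : ι} (hi : b.IsPos i) :
    0 < pair P (P.root i) x ∧ pair P (P.root i) x < 1 := by
  have hx1 : ∀ j : b.support, 0 < pair P (P.root j) x := fun j ↦ hx.1 j j.2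
  constructor
  · rw [pair_root_eq_sum b]
    obtain ⟨j, hj⟩ := rootCoeff_ne_zero b i
    refine Finset.sum_pos' (fun k _ ↦ mul_nonneg (by exact_mod_cast rootCoeff_nonneg hi k)
      (hx1 k).le) ⟨j, Finset.mem_univ _, mul_pos ?_ (hx1 j)⟩
    have := lt_of_le_of_ne (rootCoeff_nonneg hi j) (Ne.symm hj)
    exact_mod_cast this
  · refine lt_of_le_of_lt ?_ hx.2
    rw [pair_root_eq_sum b, pair_root_eq_sum b (highestRoot b)]
    refine Finset.sum_le_sum fun k _ ↦ mul_le_mul_of_nonneg_right ?_ (hx1 k).le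
    exact_mod_cast rootCoeff_le_highestRoot b i k

lemma not_exists_int_of_mem_openChamber {x : T} (hx : x ∈ openChamber b) (i : ι) :
    ¬ ∃ z : ℤ, pair P (P.root i) x = z := by
  have key : ∀ i, b.IsPos i → ¬ ∃ z : ℤ, pair P (P.root i) x = z := by
    rintro i hi ⟨z, hz⟩
    obtain ⟨h1, h2⟩ := pair_root_mem_Ioo b hx hi
    rw [hz] at h1 h2
    have h3 : (0 : ℤ) < z := by exact_mod_cast h1
    have h4 : z < (1 : ℤ) := by exact_mod_cast h2
    omega
  by_cases hi : b.IsPos i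
  · exact key i hi
  · have h1 : P.root (P.reflectionPerm i i) = -P.root i := by
      rw [P.root_reflectionPerm, P.reflection_apply_self]
    rintro ⟨z, hz⟩
    refine key _ ((isPos_neg_iff h1).mpr hi) ⟨-z, ?_⟩
    rw [h1, ← neg_one_smul ℝ, pair_smul_left, hz]
    push_cast
    ring

lemma mem_openChamber_iff {x : T} : x ∈ openChamber b ↔
    x ∈ chamber b ∧ ∀ i, ¬ ∃ z : ℤ, pair P (P.root i) x = z := by
  refine ⟨fun h ↦ ⟨⟨fun j hj ↦ (h.1 j hj).le, h.2.le⟩, not_exists_int_of_mem_openChamber b h⟩,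
    fun ⟨h, h'⟩ ↦ ⟨fun j hj ↦ lt_of_le_of_ne (h.1 j hj) fun h0 ↦ h' j ⟨0, by simpa using h0.symm⟩,
      lt_of_le_of_ne h.2 fun h1 ↦ h' (highestRoot b) ⟨1, by simpa using h1⟩⟩⟩

end Alcove

/-! ### Exponentials of nilpotent elements. -/

section Exponential

variable {A : Type*} [Ring A] [Algebra ℂ A]

/-- The third iterated commutator vanishes, so the binomial expansion has three terms. -/
lemma pow_mul_eq {N X Y Z : A} (h1 : N * X = X * N + Y) (h2 : N * Y = Y * N + Z)
    (h3 : N * Z = Z * N) (k : ℕ) :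
    N ^ (k + 2) * X = X * N ^ (k + 2) + (k + 2 : ℂ) • (Y * N ^ (k + 1)) +
      ((k + 2) * (k + 1) / 2 : ℂ) • (Z * N ^ k) := by
  induction k with
  | zero =>
    simp only [zero_add, pow_two, pow_one, pow_zero, mul_one, Nat.cast_zero]
    rw [mul_assoc, h1, mul_add, h2, ← mul_assoc, h1, add_mul, mul_assoc]
    have e1 : ((0 : ℂ) + 2) • (Y * N) = Y * N + Y * N := by rw [zero_add, two_smul]
    have e2 : (((0 : ℂ) + 2) * (0 + 1) / 2) • Z = Z := by norm_num
    rw [← zero_add (2 : ℂ), e1, ← zero_add (2 : ℂ)]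
    norm_num
    abel
  | succ k ih =>
    rw [show k + 1 + 2 = (k + 2) + 1 from rfl, pow_succ' N (k + 2), mul_assoc, ih, mul_add, mul_add,
      ← mul_assoc, h1, mul_smul_comm, mul_smul_comm, ← mul_assoc N Y, h2, ← mul_assoc N Z, h3,
      add_mul, add_mul, mul_assoc X, mul_assoc Y, mul_assoc Z, ← pow_succ', ← pow_succ',
      ← pow_succ', smul_add]
    push_cast
    module

/-- Conjugation by the exponential of a nilpotent element. -/
lemma exists_isUnit_conj {N : A} (hN : IsNilpotent N) : ∃ u : A, IsUnit u ∧
    ∀ X Y Z, N * X = X * N + Y → N * Y = Y * N + Z → N * Z = Z * N →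
      u * X = (X + Y + (1 / 2 : ℂ) • Z) * u := by
  obtain ⟨n, hn⟩ := hN
  have h0 : ∀ k, N ^ (n + k) = 0 := fun k ↦ by rw [pow_add, hn, zero_mul]
  have hsum : ∑ i ∈ Finset.range (n + 2), (i.factorial : ℂ)⁻¹ • N ^ i =
      1 + N + ∑ i ∈ Finset.range n, ((i + 2).factorial : ℂ)⁻¹ • N ^ (i + 2) := by
    rw [Finset.sum_range_succ', Finset.sum_range_succ']
    simp
    abel
  have hsum1 : ∑ i ∈ Finset.range (n + 2), (i.factorial : ℂ)⁻¹ • N ^ i =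
      1 + ∑ i ∈ Finset.range n, ((i + 1).factorial : ℂ)⁻¹ • N ^ (i + 1) := by
    rw [Finset.sum_range_succ, h0 1, Finset.sum_range_succ', smul_zero, add_zero]
    simp
    abel
  have hsum2 : ∑ i ∈ Finset.range (n + 2), (i.factorial : ℂ)⁻¹ • N ^ i =
      ∑ i ∈ Finset.range n, (i.factorial : ℂ)⁻¹ • N ^ i := by
    rw [Finset.sum_range_succ, Finset.sum_range_succ, h0 1, ← add_zero n, h0 0]
    simp
  -- With `N ^ n = 0` this is the full exponential. The two extra zero terms allow the three ways of
  -- splitting the sum that match `X`, `Y` and `Z`.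
  refine ⟨∑ i ∈ Finset.range (n + 2), (i.factorial : ℂ)⁻¹ • N ^ i, ?_, fun X Y Z h1 h2 h3 ↦ ?_⟩
  · rw [hsum1]
    have h4 : ∑ i ∈ Finset.range n, ((i + 1).factorial : ℂ)⁻¹ • N ^ (i + 1) =
        N * ∑ i ∈ Finset.range n, ((i + 1).factorial : ℂ)⁻¹ • N ^ i := by
      rw [Finset.mul_sum]
      refine Finset.sum_congr rfl fun i _ ↦ ?_
      rw [mul_smul_comm, pow_succ']
    rw [h4]
    refine IsNilpotent.isUnit_one_add (Commute.isNilpotent_mul_right ?_ ⟨n, hn⟩)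
    exact Commute.sum_right _ _ _ fun i _ ↦ ((Commute.refl N).pow_right i).smul_right _
  · have h5 : (∑ i ∈ Finset.range n, ((i + 2).factorial : ℂ)⁻¹ • N ^ (i + 2)) * X =
        X * (∑ i ∈ Finset.range n, ((i + 2).factorial : ℂ)⁻¹ • N ^ (i + 2)) +
        Y * (∑ i ∈ Finset.range n, ((i + 1).factorial : ℂ)⁻¹ • N ^ (i + 1)) +
        (1 / 2 : ℂ) • (Z * ∑ i ∈ Finset.range n, (i.factorial : ℂ)⁻¹ • N ^ i) := by
      simp only [Finset.sum_mul, Finset.mul_sum, Finset.smul_sum, ← Finset.sum_add_distrib]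
      refine Finset.sum_congr rfl fun i _ ↦ ?_
      rw [smul_mul_assoc, pow_mul_eq h1 h2 h3, mul_smul_comm, mul_smul_comm, smul_add,
        smul_add, smul_smul, smul_smul]
      have f0 : (i.factorial : ℂ) ≠ 0 := by exact_mod_cast i.factorial_ne_zero
      have f1 : ((i : ℂ) + 1) ≠ 0 := by exact_mod_cast i.succ_ne_zero
      have f2 : ((i : ℂ) + 2) ≠ 0 := by exact_mod_cast (i + 1).succ_ne_zero
      have g1 : ((i + 1).factorial : ℂ) = (i + 1) * i.factorial := by
        rw [Nat.factorial_succ]; push_cast; ring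
      have g2 : ((i + 2).factorial : ℂ) = (i + 2) * ((i + 1) * i.factorial) := by
        rw [Nat.factorial_succ, Nat.factorial_succ]; push_cast; ring
      have s1 : ((i + 2).factorial : ℂ)⁻¹ * (i + 2) = ((i + 1).factorial : ℂ)⁻¹ := by
        rw [g1, g2]
        field_simp
      have s2 : ((i + 2).factorial : ℂ)⁻¹ * ((i + 2) * (i + 1) / 2) =
          1 / 2 * (i.factorial : ℂ)⁻¹ := by
        rw [g2]
        field_simp
      rw [s1, s2, mul_smul_comm, smul_smul]
    rw [add_mul, add_mul, smul_mul_assoc]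
    nth_rewrite 3 [hsum1]
    nth_rewrite 3 [hsum2]
    rw [hsum]
    simp only [add_mul, mul_add, one_mul, mul_one, h1, h5]
    abel

/-- The exponential lift of the reflection attached to an `𝔰𝔩₂`-triple. -/
lemma exists_isUnit_reflect {E F K : A} (hE : IsNilpotent E) (hF : IsNilpotent F)
    (hEF : E * F = F * E + K) (hKE : K * E = E * K + (2 : ℂ) • E)
    (hKF : K * F = F * K - (2 : ℂ) • F) :
    ∃ θ : A, IsUnit θ ∧ ∀ (X : A) (a : ℂ), X * E = E * X + a • E → X * F = F * X - a • F →
      θ * X = (X - a • K) * θ := by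
  obtain ⟨u, hu, hu'⟩ := exists_isUnit_conj hE
  obtain ⟨v, hv, hv'⟩ := exists_isUnit_conj hF.neg
  -- The classical lift `exp(E) exp(-F) exp(E)` of the reflection.
  refine ⟨u * v * u, (hu.mul hv).mul hu, fun X a hXE hXF ↦ ?_⟩
  have e1 : u * X = (X - a • E) * u := by
    rw [hu' X (-(a • E)) 0 (by rw [hXE]; abel) (by simp) (by simp), smul_zero, add_zero,
      sub_eq_add_neg]
  have e2 : u * K = (K - (2 : ℂ) • E) * u := by
    rw [hu' K (-((2 : ℂ) • E)) 0 (by rw [hKE]; abel) (by simp) (by simp), smul_zero, add_zero,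
      sub_eq_add_neg]
  have e3 : u * E = E * u := by
    have := hu' E 0 0 (by simp) (by simp) (by simp)
    simpa using this
  have e4 : v * X = (X - a • F) * v := by
    rw [hv' X (-(a • F)) 0 (by rw [mul_neg, hXF, neg_mul]; abel) (by simp) (by simp), smul_zero,
      add_zero, sub_eq_add_neg]
  have e5 : v * E = (E + K - F) * v := by
    rw [hv' E K (-((2 : ℂ) • F)) (by rw [mul_neg, hEF, neg_mul]; abel)
      (by rw [mul_neg, hKF, neg_mul]; abel) (by simp)]
    congr 1
    module
  have e6 : v * (X - a • E) = (X - a • E - a • K) * v := by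
    rw [mul_sub, e4, mul_smul_comm, e5, ← smul_mul_assoc, ← sub_mul]
    congr 1
    module
  have e7 : u * (X - a • E - a • K) = (X - a • K) * u := by
    rw [mul_sub, mul_sub, e1, mul_smul_comm, mul_smul_comm, e2, e3, ← smul_mul_assoc,
      ← smul_mul_assoc, ← sub_mul, ← sub_mul]
    congr 1
    module
  rw [mul_assoc, e1, mul_assoc u v, ← mul_assoc v, e6, ← mul_assoc, ← mul_assoc, e7]
  simp only [mul_assoc]

end Exponential

/-! ### Reflection invariance of weight multiplicities. -/

section WeightSpaces

variable {𝔤 : Type*} [LieRing 𝔤] [LieAlgebra ℂ 𝔤] [FiniteDimensional ℂ 𝔤] [LieAlgebra.IsSimple ℂ 𝔤]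
  {H : LieSubalgebra ℂ 𝔤} [H.IsCartanSubalgebra]
  {L : Type*} [AddCommGroup L] [Module ℂ L] [LieRingModule 𝔤 L] [LieModule ℂ 𝔤 L]
  [FiniteDimensional ℂ L]

variable (𝔤 L) in
/-- The action on a representation, as a linear map. -/
def repEnd : 𝔤 →ₗ[ℂ] Module.End ℂ L where
  toFun x := LieModule.toEnd ℂ 𝔤 L x
  map_add' x y := by ext; simp
  map_smul' c x := by ext; simp

@[simp] lemma repEnd_apply (x : 𝔤) (m : L) : repEnd 𝔤 L x m = ⁅x, m⁆ := rfl

lemma repEnd_mul (x y : 𝔤) :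
    repEnd 𝔤 L x * repEnd 𝔤 L y = repEnd 𝔤 L y * repEnd 𝔤 L x + repEnd 𝔤 L ⁅x, y⁆ := by
  ext m
  simp only [Module.End.mul_apply, LinearMap.add_apply, repEnd_apply]
  rw [leibniz_lie]
  abel

lemma exists_isUnit_weightSpace {α : LieModule.Weight ℂ H 𝔤} (hα : α.IsNonZero) :
    ∃ θ : Module.End ℂ L, IsUnit θ ∧ ∀ μ : Dual ℂ H, ∀ m ∈ LieModule.weightSpace L (μ : H → ℂ),
      θ m ∈ LieModule.weightSpace L
        ((μ - μ (LieAlgebra.IsKilling.coroot α) • α.toLinear : Dual ℂ H) : H → ℂ) := by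
  obtain ⟨h, e, f, ht, he, hf⟩ := LieAlgebra.IsKilling.exists_isSl2Triple_of_weight_isNonZero hα
  have hh := ht.h_eq_coroot hα he hf
  have hα2 := LieAlgebra.IsKilling.root_apply_coroot hα
  have hE : IsNilpotent (repEnd 𝔤 L e) := LieModule.isNilpotent_toEnd_of_mem_rootSpace L H hα he
  have hF : IsNilpotent (repEnd 𝔤 L f) :=
    LieModule.isNilpotent_toEnd_of_mem_rootSpace (χ := -α) L H hα.neg hf
  obtain ⟨θ, hθ, hθ'⟩ := exists_isUnit_reflect hE hF (K := repEnd 𝔤 L h)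
    (by rw [repEnd_mul, ht.lie_e_f]) (by rw [repEnd_mul, ht.lie_h_e_smul ℂ, map_smul])
    (by rw [repEnd_mul, ht.lie_h_f_nsmul, map_neg, map_nsmul, sub_eq_add_neg, ofNat_smul_eq_nsmul ℂ 2])
  have hθ2 : ∀ x : H, θ * repEnd 𝔤 L x = (repEnd 𝔤 L x - α x • repEnd 𝔤 L h) * θ := by
    intro x
    refine hθ' _ _ ?_ ?_
    · have : ⁅(x : 𝔤), e⁆ = α x • e := LieAlgebra.IsKilling.lie_eq_smul_of_mem_rootSpace he x
      rw [repEnd_mul, this, map_smul]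
    · have : ⁅(x : 𝔤), f⁆ = (-α x) • f :=
        LieAlgebra.IsKilling.lie_eq_smul_of_mem_rootSpace hf x
      rw [repEnd_mul, this, map_smul, neg_smul, sub_eq_add_neg]
  refine ⟨θ, hθ, fun μ m hm ↦ ?_⟩
  rw [LieModule.mem_weightSpace] at hm ⊢
  intro x
  have hm' : ∀ y : H, repEnd 𝔤 L y m = μ y • m := hm
  set c := LieAlgebra.IsKilling.coroot α with hc
  -- Applied to the reflected element: since `α` negates there, `θ` carries its action on `m` to the
  -- action of `x` on `θ m`.
  have h1 := LinearMap.congr_fun (hθ2 (x - α x • c)) m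
  have h2 : (((x - α x • c : H) : 𝔤)) = (x : 𝔤) - α x • (c : 𝔤) := rfl
  have h3 : α (x - α x • c) = -α x := by
    have : (α.toLinear : Dual ℂ H) (x - α x • c) = -α x := by
      rw [map_sub, map_smul]
      change α x - α x • α c = _
      rw [hα2, smul_eq_mul]
      ring
    exact this
  rw [Module.End.mul_apply, Module.End.mul_apply, hm', h3, h2, map_sub (repEnd 𝔤 L),
    map_smul (repEnd 𝔤 L), hh, neg_smul, sub_neg_eq_add, sub_add_cancel, map_smul θ] at h1
  change repEnd 𝔤 L x (θ m) = _
  rw [← h1]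
  congr 1
  simp
  ring

lemma finrank_weightSpace_reflect {α : LieModule.Weight ℂ H 𝔤} (hα : α.IsNonZero) (μ : Dual ℂ H) :
    finrank ℂ (LieModule.weightSpace L
      ((μ - μ (LieAlgebra.IsKilling.coroot α) • α.toLinear : Dual ℂ H) : H → ℂ)) =
    finrank ℂ (LieModule.weightSpace L (μ : H → ℂ)) := by
  have key : ∀ μ : Dual ℂ H, finrank ℂ (LieModule.weightSpace L (μ : H → ℂ)) ≤
      finrank ℂ (LieModule.weightSpace L
      ((μ - μ (LieAlgebra.IsKilling.coroot α) • α.toLinear : Dual ℂ H) : H → ℂ)) := by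
    intro μ
    obtain ⟨θ, hθ, hθ'⟩ := exists_isUnit_weightSpace (L := L) hα
    have hinj : Function.Injective θ := ((Module.End.isUnit_iff θ).mp hθ).injective
    refine LinearMap.finrank_le_finrank_of_injective (f := θ.restrict (hθ' μ)) ?_
    intro x y hxy
    exact Subtype.ext (hinj (congrArg Subtype.val hxy))
  refine le_antisymm ?_ (key μ)
  have h := key (μ - μ (LieAlgebra.IsKilling.coroot α) • α.toLinear)
  have hα2 := LieAlgebra.IsKilling.root_apply_coroot hα
  have heq : (μ - μ (LieAlgebra.IsKilling.coroot α) • α.toLinear) -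
      (μ - μ (LieAlgebra.IsKilling.coroot α) • α.toLinear) (LieAlgebra.IsKilling.coroot α) •
        α.toLinear = μ := by
    ext x
    simp [hα2]
    ring
  rw [heq] at h
  exact h


end WeightSpaces

/-! ### Traces on subspaces. -/

section Compression

variable {L : Type*} [AddCommGroup L] [Module ℂ L]

/-- A projection onto a subspace. -/
def projTo (W : Submodule ℂ L) : L →ₗ[ℂ] W :=
  (LinearMap.exists_leftInverse_of_injective W.subtype W.ker_subtype).choose

lemma projTo_coe (W : Submodule ℂ L) (w : W) : projTo W w = w :=
  LinearMap.congr_fun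
    (LinearMap.exists_leftInverse_of_injective W.subtype W.ker_subtype).choose_spec w

/-- The trace of the compression of an endomorphism to a subspace. -/
def trOn (W : Submodule ℂ L) : Module.End ℂ L →ₗ[ℂ] ℂ where
  toFun T := LinearMap.trace ℂ W (projTo W ∘ₗ T ∘ₗ W.subtype)
  map_add' S T := by rw [LinearMap.add_comp, LinearMap.comp_add, map_add]
  map_smul' c T := by rw [LinearMap.smul_comp, LinearMap.comp_smul, map_smul, RingHom.id_apply]

lemma trOn_eq [FiniteDimensional ℂ L] (W : Submodule ℂ L) {T : Module.End ℂ L} {c : ℂ}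
    (h : ∀ w ∈ W, T w = c • w) : trOn W T = c * finrank ℂ W := by
  have h1 : projTo W ∘ₗ T ∘ₗ W.subtype = c • LinearMap.id := by
    ext w
    simp [h w w.2, projTo_coe]
  change LinearMap.trace ℂ W (projTo W ∘ₗ T ∘ₗ W.subtype) = _
  rw [h1, map_smul, LinearMap.trace_id, smul_eq_mul]

lemma trOn_mul_comm [FiniteDimensional ℂ L] {W W' : Submodule ℂ L} {S T : Module.End ℂ L}
    (hT : ∀ w ∈ W, T w ∈ W') (hS : ∀ w ∈ W', S w ∈ W) : trOn W (S * T) = trOn W' (T * S) := by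
  have h1 : projTo W ∘ₗ (S * T) ∘ₗ W.subtype = S.restrict hS ∘ₗ T.restrict hT := by
    ext w
    exact congrArg Subtype.val (projTo_coe W ⟨S (T w), hS _ (hT _ w.2)⟩)
  have h2 : projTo W' ∘ₗ (T * S) ∘ₗ W'.subtype = T.restrict hT ∘ₗ S.restrict hS := by
    ext w
    exact congrArg Subtype.val (projTo_coe W' ⟨T (S w), hT _ (hS _ w.2)⟩)
  change LinearMap.trace ℂ W (projTo W ∘ₗ (S * T) ∘ₗ W.subtype) =
    LinearMap.trace ℂ W' (projTo W' ∘ₗ (T * S) ∘ₗ W'.subtype)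
  rw [h1, h2, LinearMap.trace_comp_comm']

end Compression

/-! ### The Casimir operator and Schur's lemma. -/

section Casimir

variable {𝔤 : Type*} [LieRing 𝔤] [LieAlgebra ℂ 𝔤] [FiniteDimensional ℂ 𝔤] [LieAlgebra.IsSimple ℂ 𝔤]
  {L : Type*} [AddCommGroup L] [Module ℂ L] [LieRingModule 𝔤 L] [LieModule ℂ 𝔤 L]
  [FiniteDimensional ℂ L]

/-- The Casimir operator of a pair of families that are dual for the Killing form commutes with
the action. -/
lemma casimir_comm {κ : Type*} [Fintype κ] [DecidableEq κ] {u u' : κ → 𝔤}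
    (hdual : ∀ i j, killingForm ℂ 𝔤 (u' i) (u j) = if i = j then 1 else 0)
    (hspan : Submodule.span ℂ (Set.range u) = ⊤) (x : 𝔤) :
    repEnd 𝔤 L x * ∑ i, repEnd 𝔤 L (u i) * repEnd 𝔤 L (u' i) =
      (∑ i, repEnd 𝔤 L (u i) * repEnd 𝔤 L (u' i)) * repEnd 𝔤 L x := by
  have h1 : ∀ z, ∑ i, killingForm ℂ 𝔤 (u' i) z • u i = z := by
    intro z
    have hz : z ∈ Submodule.span ℂ (Set.range u) := hspan ▸ Submodule.mem_top
    induction hz using Submodule.span_induction with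
    | mem z hz =>
      obtain ⟨j, rfl⟩ := hz
      simp [hdual]
    | zero => simp
    | add y z _ _ hy hz => simp only [map_add, add_smul, Finset.sum_add_distrib, hy, hz]
    | smul c z _ hz => simp only [map_smul, smul_assoc, ← Finset.smul_sum, hz]
  have h2 : ∀ z, ∑ i, killingForm ℂ 𝔤 z (u i) • u' i = z := by
    intro z
    rw [← sub_eq_zero, ← Submodule.mem_bot (R := ℂ), ← LieAlgebra.IsKilling.ker_killingForm_eq_bot,
      LinearMap.mem_ker]
    refine LinearMap.ext_on_range hspan fun j ↦ ?_
    simp [hdual]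
  have h3 : ∀ i, repEnd 𝔤 L ⁅x, u i⁆ = ∑ j, killingForm ℂ 𝔤 (u' j) ⁅x, u i⁆ • repEnd 𝔤 L (u j) := by
    intro i
    conv_lhs => rw [← h1 ⁅x, u i⁆, map_sum]
    simp only [map_smul]
  -- By invariance of the Killing form, `x` acts on the dual family by the negative transpose of its
  -- matrix on the family, so the two parts of the commutator cancel.
  have h4 : ∀ i, repEnd 𝔤 L ⁅x, u' i⁆ =
      -∑ j, killingForm ℂ 𝔤 (u' i) ⁅x, u j⁆ • repEnd 𝔤 L (u' j) := by
    intro i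
    conv_lhs => rw [← h2 ⁅x, u' i⁆, map_sum]
    rw [← Finset.sum_neg_distrib]
    refine Finset.sum_congr rfl fun j _ ↦ ?_
    rw [map_smul, ← neg_smul]
    congr 1
    exact LieModule.traceForm_apply_lie_apply' ℂ 𝔤 𝔤 x (u' i) (u j)
  have h5 : ∀ i, repEnd 𝔤 L x * (repEnd 𝔤 L (u i) * repEnd 𝔤 L (u' i)) =
      repEnd 𝔤 L (u i) * repEnd 𝔤 L (u' i) * repEnd 𝔤 L x +
      (repEnd 𝔤 L ⁅x, u i⁆ * repEnd 𝔤 L (u' i) + repEnd 𝔤 L (u i) * repEnd 𝔤 L ⁅x, u' i⁆) := by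
    intro i
    rw [← mul_assoc, repEnd_mul x, add_mul, mul_assoc, repEnd_mul x (u' i), mul_add, mul_assoc]
    abel
  rw [Finset.mul_sum, Finset.sum_mul, Finset.sum_congr rfl fun i _ ↦ h5 i, Finset.sum_add_distrib,
    add_eq_left, Finset.sum_add_distrib]
  simp only [h3, h4, Finset.sum_mul, mul_neg, Finset.mul_sum, Finset.sum_neg_distrib]
  rw [Finset.sum_comm, ← sub_eq_add_neg, sub_eq_zero]
  refine Finset.sum_congr rfl fun i _ ↦ Finset.sum_congr rfl fun j _ ↦ ?_
  rw [smul_mul_assoc, mul_smul_comm]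

/-- Schur's lemma: an operator that commutes with the action is a scalar. -/
lemma exists_eq_smul_of_comm [LieModule.IsIrreducible ℂ 𝔤 L]
    {T : Module.End ℂ L} (hT : ∀ x, repEnd 𝔤 L x * T = T * repEnd 𝔤 L x) :
    ∃ c : ℂ, ∀ m, T m = c • m := by
  have := LieModule.nontrivial_of_isIrreducible ℂ 𝔤 L
  obtain ⟨c, hc⟩ := Module.End.exists_eigenvalue T
  let N : LieSubmodule ℂ 𝔤 L :=
    { Module.End.eigenspace T c with
      lie_mem := by
        intro x m hm
        have hm' : T m = c • m := Module.End.mem_eigenspace_iff.mp hm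
        refine Module.End.mem_eigenspace_iff.mpr ?_
        have := LinearMap.congr_fun (hT x) m
        rw [Module.End.mul_apply, Module.End.mul_apply, hm', map_smul] at this
        exact this.symm }
  have hN : N = ⊤ := by
    refine (eq_bot_or_eq_top N).resolve_left fun h0 ↦ hc ?_
    have : (N : Submodule ℂ L) = ⊥ := by rw [h0]; rfl
    exact this
  refine ⟨c, fun m ↦ Module.End.mem_eigenspace_iff.mp ?_⟩
  have : m ∈ N := hN ▸ LieSubmodule.mem_top m
  exact this

end Casimir

/-! ### Dual root vectors for the Killing form. -/

section Roots

variable {𝔤 : Type*} [LieRing 𝔤] [LieAlgebra ℂ 𝔤] [FiniteDimensional ℂ 𝔤] [LieAlgebra.IsSimple ℂ 𝔤]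
  {H : LieSubalgebra ℂ 𝔤} [H.IsCartanSubalgebra]

lemma exists_killingForm_eq_one (i : H.root) : ∃ e f : 𝔤,
    e ∈ LieAlgebra.rootSpace H ((i : LieModule.Weight ℂ H 𝔤) : H → ℂ) ∧
    f ∈ LieAlgebra.rootSpace H (-((i : LieModule.Weight ℂ H 𝔤) : H → ℂ)) ∧
    killingForm ℂ 𝔤 e f = 1 := by
  obtain ⟨e, he, he0⟩ := (i : LieModule.Weight ℂ H 𝔤).exists_ne_zero
  obtain ⟨f, hf, hef⟩ : ∃ f ∈ LieAlgebra.rootSpace H (-((i : LieModule.Weight ℂ H 𝔤) : H → ℂ)),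
      killingForm ℂ 𝔤 e f ≠ 0 := by
    contrapose! he0
    simpa using LieAlgebra.mem_ker_killingForm_of_mem_rootSpace_of_forall_rootSpace_neg ℂ 𝔤 H he he0
  exact ⟨e, (killingForm ℂ 𝔤 e f)⁻¹ • f, he, Submodule.smul_mem _ _ hf, by simp [hef]⟩

variable (H) in
/-- Root vectors. -/
def rootVec (i : H.root) : 𝔤 := (exists_killingForm_eq_one i).choose

variable (H) in
/-- Opposite root vectors, dual to the root vectors for the Killing form. -/
def oppVec (i : H.root) : 𝔤 := (exists_killingForm_eq_one i).choose_spec.choose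

lemma rootVec_mem (i : H.root) :
    rootVec H i ∈ LieAlgebra.rootSpace H ((i : LieModule.Weight ℂ H 𝔤) : H → ℂ) :=
  (exists_killingForm_eq_one i).choose_spec.choose_spec.1

lemma oppVec_mem (i : H.root) :
    oppVec H i ∈ LieAlgebra.rootSpace H (-((i : LieModule.Weight ℂ H 𝔤) : H → ℂ)) :=
  (exists_killingForm_eq_one i).choose_spec.choose_spec.2.1

lemma killingForm_rootVec_oppVec (i : H.root) :
    killingForm ℂ 𝔤 (rootVec H i) (oppVec H i) = 1 :=
  (exists_killingForm_eq_one i).choose_spec.choose_spec.2.2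

lemma killingForm_oppVec_rootVec (i j : H.root) [Decidable (i = j)] :
    killingForm ℂ 𝔤 (oppVec H i) (rootVec H j) = if i = j then 1 else 0 := by
  split_ifs with h
  · rw [← h, LieModule.traceForm_comm, killingForm_rootVec_oppVec]
  · refine LieAlgebra.killingForm_apply_eq_zero_of_mem_rootSpace_of_add_ne_zero ℂ 𝔤 H
      (oppVec_mem i) (rootVec_mem j) fun h0 ↦ h ?_
    rw [neg_add_eq_zero] at h0
    exact Subtype.ext (DFunLike.coe_injective h0)

lemma mem_rootSpace_zero (x : H) : (x : 𝔤) ∈ LieAlgebra.rootSpace H (0 : H → ℂ) := by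
  rw [LieAlgebra.rootSpace_zero_eq]
  exact x.2

lemma killingForm_cartan_rootVec (x : H) (i : H.root) :
    killingForm ℂ 𝔤 x (rootVec H i) = 0 :=
  LieAlgebra.killingForm_apply_eq_zero_of_mem_rootSpace_of_add_ne_zero ℂ 𝔤 H
    (mem_rootSpace_zero x) (rootVec_mem i) (by rw [zero_add]; exact H.isNonZero_coe_root i)

lemma killingForm_oppVec_cartan (x : H) (i : H.root) :
    killingForm ℂ 𝔤 (oppVec H i) x = 0 :=
  LieAlgebra.killingForm_apply_eq_zero_of_mem_rootSpace_of_add_ne_zero ℂ 𝔤 H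
    (oppVec_mem i) (mem_rootSpace_zero x)
    (by rw [add_zero, neg_ne_zero]; exact H.isNonZero_coe_root i)

/-- The vector of the Cartan subalgebra that represents a functional, for the Killing form. -/
abbrev dualVec (μ : Dual ℂ H) : H := (LieAlgebra.IsKilling.cartanEquivDual H).symm μ

lemma killingForm_dualVec (μ : Dual ℂ H) (x : H) : killingForm ℂ 𝔤 (dualVec μ) x = μ x := by
  have := LinearMap.congr_fun ((LieAlgebra.IsKilling.cartanEquivDual H).apply_symm_apply μ) x
  exact this

lemma exists_eq_smul_rootVec (i : H.root) {x : 𝔤}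
    (hx : x ∈ LieAlgebra.rootSpace H ((i : LieModule.Weight ℂ H 𝔤) : H → ℂ)) :
    ∃ c : ℂ, c • rootVec H i = x := by
  have h3 := LieAlgebra.IsKilling.finrank_rootSpace_eq_one (i : LieModule.Weight ℂ H 𝔤)
    (H.isNonZero_coe_root i)
  let v : LieAlgebra.rootSpace H ((i : LieModule.Weight ℂ H 𝔤) : H → ℂ) := ⟨rootVec H i, rootVec_mem i⟩
  have hv : v ≠ 0 := by
    intro h0
    have h1 : rootVec H i = 0 := congrArg Subtype.val h0
    have := killingForm_rootVec_oppVec i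
    rw [h1] at this
    simp at this
  obtain ⟨c, hc⟩ := (finrank_eq_one_iff_of_nonzero' v hv).mp h3 ⟨x, hx⟩
  exact ⟨c, congrArg Subtype.val hc⟩

lemma span_cartan_rootVec {κ : Type*} (h : Basis κ ℂ H) :
    Submodule.span ℂ (Set.range (Sum.elim (fun k ↦ (h k : 𝔤)) (rootVec H))) = ⊤ := by
  have h1 : ⨆ α : LieModule.Weight ℂ H 𝔤, LieAlgebra.rootSpace H α = ⊤ :=
    LieModule.iSup_genWeightSpace_eq_top' ℂ H 𝔤
  have h2 : ⨆ α : LieModule.Weight ℂ H 𝔤, (LieAlgebra.rootSpace H α).toSubmodule = ⊤ := by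
    rw [← LieSubmodule.iSup_toSubmodule, h1]
    rfl
  rw [eq_top_iff, ← h2]
  refine iSup_le fun α ↦ ?_
  by_cases hα : α.IsZero
  · rw [hα.eq, LieAlgebra.rootSpace_zero_eq]
    intro x hx
    have h3 : (⟨x, hx⟩ : H) ∈ Submodule.span ℂ (Set.range h) := h.span_eq ▸ Submodule.mem_top
    have h4 := Submodule.mem_map_of_mem (f := H.toSubmodule.subtype) h3
    rw [Submodule.map_span, ← Set.range_comp] at h4
    refine Submodule.span_mono ?_ h4
    rintro _ ⟨k, rfl⟩
    exact ⟨Sum.inl k, rfl⟩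
  · have hα' : α ∈ H.root := by simpa using hα
    intro x hx
    obtain ⟨c, rfl⟩ := exists_eq_smul_rootVec ⟨α, hα'⟩ hx
    exact Submodule.smul_mem _ _ (Submodule.subset_span ⟨Sum.inr ⟨α, hα'⟩, rfl⟩)

end Roots

/-! ### The dual of the Killing form on real weights. -/

section KillingForm

variable {𝔤 : Type*} [LieRing 𝔤] [LieAlgebra ℂ 𝔤] [FiniteDimensional ℂ 𝔤] [LieAlgebra.IsSimple ℂ 𝔤]
  (H : LieSubalgebra ℂ 𝔤) [H.IsCartanSubalgebra]

/-- The form on `𝔱*` dual to the Killing form. -/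
def killingDual : realDual H →ₗ[ℝ] realDual H →ₗ[ℝ] ℂ :=
  LinearMap.mk₂ ℝ (fun u v ↦ (u : Dual ℂ H) (dualVec (v : Dual ℂ H)))
    (fun _ _ _ ↦ rfl) (fun _ _ _ ↦ rfl)
    (fun u v w ↦ by simp [dualVec])
    (fun c u v ↦ by
      have h : ((c • v : realDual H) : Dual ℂ H) = (c : ℂ) • (v : Dual ℂ H) := rfl
      rw [h, dualVec, map_smul, map_smul]
      rfl)

variable {H}

lemma killingDual_apply (u v : realDual H) :
    killingDual H u v = (u : Dual ℂ H) (dualVec (v : Dual ℂ H)) := rfl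

lemma apply_dualVec_comm (μ ν : Dual ℂ H) : μ (dualVec ν) = ν (dualVec μ) := by
  rw [← killingForm_dualVec μ, ← killingForm_dualVec ν, LieModule.traceForm_comm]

lemma killingDual_comm (u v : realDual H) : killingDual H u v = killingDual H v u :=
  apply_dualVec_comm _ _

variable (H) in
/-- Half the squared length of a root, for the form dual to the Killing form. -/
def halfLength (i : H.root) : ℝ :=
  2 / ∑ j, pair (realRootSystem H) ((realRootSystem H).root j) ((realRootSystem H).coroot i) ^ 2

lemma sum_pair_sq_pos (i : H.root) :
    0 < ∑ j, pair (realRootSystem H) ((realRootSystem H).root j) ((realRootSystem H).coroot i) ^ 2 := by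
  refine Finset.sum_pos' (fun j _ ↦ sq_nonneg _) ⟨i, Finset.mem_univ _, ?_⟩
  have : pair (realRootSystem H) ((realRootSystem H).root i) ((realRootSystem H).coroot i) = 2 :=
    (realRootSystem H).root_coroot_two i
  rw [this]
  norm_num

lemma halfLength_pos (i : H.root) : 0 < halfLength H i := div_pos two_pos (sum_pair_sq_pos i)

/-- With `d = (α, α)`, the co-root is `2/d` times the vector dual to `α`, and its Killing length is
`4/d`. That length is also `∑ β(α̌)²`, so `d/2` is real and positive. -/
lemma killingDual_root (i : H.root) (v : realDual H) :
    killingDual H ((realRootSystem H).root i) v =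
      (halfLength H i * pair (realRootSystem H) v ((realRootSystem H).coroot i) : ℝ) := by
  set α : LieModule.Weight ℂ H 𝔤 := (i : LieModule.Weight ℂ H 𝔤) with hα
  set d : ℂ := α (dualVec α.toLinear) with hd
  have hd0 : d ≠ 0 :=
    LieAlgebra.IsKilling.root_apply_cartanEquivDual_symm_ne_zero (H.isNonZero_coe_root i)
  have h2 : α (LieAlgebra.IsKilling.coroot α) = 2 :=
    LieAlgebra.IsKilling.root_apply_coroot (H.isNonZero_coe_root i)
  have h1 : killingDual H ((realRootSystem H).root i) v = (v : Dual ℂ H) (dualVec α.toLinear) := by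
    rw [killingDual_comm]
    rfl
  have h3 : (v : Dual ℂ H) (LieAlgebra.IsKilling.coroot α) = 2 * d⁻¹ * killingDual H ((realRootSystem H).root i) v := by
    rw [h1, LieAlgebra.IsKilling.coroot, map_nsmul, map_smul, nsmul_eq_mul, smul_eq_mul, mul_assoc]
    rfl
  have h4 : (pair (realRootSystem H) v ((realRootSystem H).coroot i) : ℂ) =
      (v : Dual ℂ H) (LieAlgebra.IsKilling.coroot α) := coe_pair _ _
  have h5 : killingForm ℂ 𝔤 (LieAlgebra.IsKilling.coroot α) (LieAlgebra.IsKilling.coroot α) =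
      4 * d⁻¹ := by
    have := LieAlgebra.IsKilling.traceForm_coroot α (LieAlgebra.IsKilling.coroot α)
    rw [h2, nsmul_eq_mul, smul_eq_mul] at this
    refine Eq.trans ?_ (this.trans ?_)
    · rfl
    · push_cast
      rw [mul_comm _ (2 : ℂ), ← mul_assoc]
      norm_num
      rfl
  have h6 : killingForm ℂ 𝔤 (LieAlgebra.IsKilling.coroot α) (LieAlgebra.IsKilling.coroot α) =
      ((∑ j, pair (realRootSystem H) ((realRootSystem H).root j)
        ((realRootSystem H).coroot i) ^ 2 : ℝ) : ℂ) := by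
    have := congrArg (fun f ↦ f (LieAlgebra.IsKilling.coroot α) (LieAlgebra.IsKilling.coroot α))
      (LieAlgebra.IsKilling.restrict_killingForm_eq_sum (K := ℂ) (H := H))
    refine Eq.trans ?_ (this.trans ?_)
    · rfl
    · rw [← Finset.sum_coe_sort]
      simp only [LinearMap.sum_apply, Complex.ofReal_sum]
      refine Finset.sum_congr rfl fun j _ ↦ ?_
      rw [Complex.ofReal_pow, ← weight_apply_eq_pair, sq]
      rfl
  set S := ∑ j, pair (realRootSystem H) ((realRootSystem H).root j)
        ((realRootSystem H).coroot i) ^ 2 with hS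
  have hS0 : (S : ℂ) ≠ 0 := by exact_mod_cast (sum_pair_sq_pos i).ne'
  rw [Complex.ofReal_mul, h4, h3, halfLength, ← hS]
  push_cast
  rw [← h6, h5] at *
  field_simp
  norm_num

end KillingForm

/-! ### Formal characters and the Casimir identities. -/

section FormalCharacter

attribute [local instance] isCrystallographic_realRootSystem isReduced_realRootSystem
  isIrreducible_realRootSystem

variable {𝔤 : Type*} [LieRing 𝔤] [LieAlgebra ℂ 𝔤] [FiniteDimensional ℂ 𝔤] [LieAlgebra.IsSimple ℂ 𝔤]
  (H : LieSubalgebra ℂ 𝔤) [H.IsCartanSubalgebra]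
  (L : Type*) [AddCommGroup L] [Module ℂ L] [LieRingModule 𝔤 L] [LieModule ℂ 𝔤 L]
  [FiniteDimensional ℂ L]

/-- The weight space of a real weight. -/
abbrev wtSpace (v : realDual H) : Submodule ℂ L :=
  (LieModule.weightSpace L ((v : Dual ℂ H) : H → ℂ)).toSubmodule

lemma finite_wtSpace_ne_bot : {v : realDual H | wtSpace H L v ≠ ⊥}.Finite := by
  have h := LieModule.finite_genWeightSpace_ne_bot ℂ H L
  refine Set.Finite.of_finite_image (f := fun v : realDual H ↦ ((v : Dual ℂ H) : H → ℂ))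
    (h.subset ?_) fun u _ v _ huv ↦ Subtype.ext (DFunLike.coe_injective huv)
  rintro _ ⟨v, hv, rfl⟩ h0
  have h1 := LieModule.weightSpace_le_genWeightSpace L ((v : Dual ℂ H) : H → ℂ)
  rw [h0, le_bot_iff] at h1
  refine hv ?_
  rw [wtSpace, h1]
  rfl

/-- The formal character of a representation. -/
def formalCharacter : AddMonoidAlgebra ℂ (realDual H) :=
  .ofCoeff (Finsupp.ofSupportFinite (fun v ↦ (finrank ℂ (wtSpace H L v) : ℂ))
    ((finite_wtSpace_ne_bot H L).subset fun v hv h0 ↦ hv (by simp [h0])))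

/-- The generating function of the traces of `e f` on the weight spaces, where `e` and `f` are
opposite root vectors. -/
def traceSeries (i : H.root) : AddMonoidAlgebra ℂ (realDual H) :=
  .ofCoeff (Finsupp.ofSupportFinite
    (fun v ↦ trOn (wtSpace H L v) (repEnd 𝔤 L (rootVec H i) * repEnd 𝔤 L (oppVec H i)))
    ((finite_wtSpace_ne_bot H L).subset fun v hv h0 ↦ hv (by
      have h := trOn_eq (wtSpace H L v)
        (T := repEnd 𝔤 L (rootVec H i) * repEnd 𝔤 L (oppVec H i)) (c := 0) (by
          intro w hw
          rw [h0, Submodule.mem_bot] at hw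
          simp [hw])
      rw [zero_mul] at h
      exact h)))

variable {H L}

lemma coeff_formalCharacter (v : realDual H) :
    (formalCharacter H L).coeff v = finrank ℂ (wtSpace H L v) := rfl

lemma coeff_traceSeries (i : H.root) (v : realDual H) :
    (traceSeries H L i).coeff v =
      trOn (wtSpace H L v) (repEnd 𝔤 L (rootVec H i) * repEnd 𝔤 L (oppVec H i)) := rfl

lemma mem_wtSpace {v : realDual H} {m : L} :
    m ∈ wtSpace H L v ↔ ∀ x : H, repEnd 𝔤 L x m = (v : Dual ℂ H) x • m :=
  LieModule.mem_weightSpace _ _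

lemma lie_mem_wtSpace {χ : H → ℂ} {e : 𝔤} (he : e ∈ LieAlgebra.rootSpace H χ) {u v : realDual H}
    (huv : ∀ x, (v : Dual ℂ H) x = (u : Dual ℂ H) x + χ x) {m : L} (hm : m ∈ wtSpace H L u) :
    repEnd 𝔤 L e m ∈ wtSpace H L v := by
  rw [mem_wtSpace] at hm ⊢
  intro x
  have h1 : ⁅(x : 𝔤), e⁆ = χ x • e := LieAlgebra.IsKilling.lie_eq_smul_of_mem_rootSpace he x
  have h2 := LinearMap.congr_fun (repEnd_mul (L := L) (x : 𝔤) e) m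
  rw [h1, map_smul] at h2
  simp only [Module.End.mul_apply, LinearMap.add_apply, LinearMap.smul_apply] at h2
  rw [h2, hm, map_smul, huv, add_smul]

/-- By cyclicity, the trace of `e f` on the weight space of `v + α` is that of `f e` on the one of
`v`, and `[e, f]` acts there by the scalar `(α, v)`. -/
lemma traceSeries_sub (i : H.root) (v : realDual H) :
    (traceSeries H L i).coeff v - (traceSeries H L i).coeff (v + (realRootSystem H).root i) =
      killingDual H ((realRootSystem H).root i) v * (formalCharacter H L).coeff v := by
  have h1 : trOn (wtSpace H L (v + (realRootSystem H).root i))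
      (repEnd 𝔤 L (rootVec H i) * repEnd 𝔤 L (oppVec H i)) =
      trOn (wtSpace H L v) (repEnd 𝔤 L (oppVec H i) * repEnd 𝔤 L (rootVec H i)) := by
    refine trOn_mul_comm (fun w hw ↦ lie_mem_wtSpace (oppVec_mem i) (fun x ↦ ?_) hw)
      (fun w hw ↦ lie_mem_wtSpace (rootVec_mem i) (fun x ↦ rfl) hw)
    change (v : Dual ℂ H) x = (v : Dual ℂ H) x + (i : LieModule.Weight ℂ H 𝔤) x +
      -(i : LieModule.Weight ℂ H 𝔤) x
    ring
  rw [coeff_traceSeries, coeff_traceSeries, h1, repEnd_mul, map_add, add_sub_cancel_left,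
    LieAlgebra.IsKilling.lie_eq_killingForm_smul_of_mem_rootSpace_of_mem_rootSpace_neg
      (rootVec_mem i) (oppVec_mem i), killingForm_rootVec_oppVec, one_smul, killingDual_comm,
    coeff_formalCharacter]
  exact trOn_eq _ fun w hw ↦ mem_wtSpace.mp hw _

/-- The trace of the scalar Casimir operator on a weight space: the Cartan part contributes `(v, v)`
times the dimension, the root vectors the trace series. -/
lemma exists_casimir [LieModule.IsIrreducible ℂ 𝔤 L] : ∃ c : ℂ, ∀ v : realDual H,
    c * (formalCharacter H L).coeff v = killingDual H v v * (formalCharacter H L).coeff v +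
      ∑ i, (traceSeries H L i).coeff v := by
  classical
  let h := Module.finBasis ℂ H
  have hdual : ∀ i j, killingForm ℂ 𝔤
      (Sum.elim (fun k ↦ (dualVec (h.coord k) : 𝔤)) (oppVec H) i)
      (Sum.elim (fun k ↦ (h k : 𝔤)) (rootVec H) j) = if i = j then 1 else 0 := by
    rintro (k | i) (l | j)
    · simp [killingForm_dualVec, Finsupp.single_apply, eq_comm]
    · simp [killingForm_cartan_rootVec]
    · simp [killingForm_oppVec_cartan]
    · simp [killingForm_oppVec_rootVec]
  obtain ⟨c, hc⟩ := exists_eq_smul_of_comm (L := L)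
    (casimir_comm (L := L) hdual (span_cartan_rootVec h))
  refine ⟨c, fun v ↦ ?_⟩
  have h1 : ∀ k, trOn (wtSpace H L v) (repEnd 𝔤 L (h k) * repEnd 𝔤 L (dualVec (h.coord k))) =
      (v : Dual ℂ H) (h k) * (v : Dual ℂ H) (dualVec (h.coord k)) * finrank ℂ (wtSpace H L v) := by
    intro k
    refine trOn_eq _ fun w hw ↦ ?_
    rw [mem_wtSpace] at hw
    rw [Module.End.mul_apply, hw, map_smul, hw, smul_smul, mul_comm]
  have h2 : ∑ k, (v : Dual ℂ H) (h k) * (v : Dual ℂ H) (dualVec (h.coord k)) =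
      killingDual H v v := by
    rw [killingDual_apply]
    conv_rhs => rw [← h.sum_repr (dualVec (v : Dual ℂ H)), map_sum]
    refine Finset.sum_congr rfl fun k _ ↦ ?_
    rw [map_smul, smul_eq_mul, mul_comm, apply_dualVec_comm, h.coord_apply]
  have h3 := trOn_eq (wtSpace H L v) fun w _ ↦ hc w
  rw [Fintype.sum_sum_type, map_add, map_sum, map_sum] at h3
  simp only [Sum.elim_inl, Sum.elim_inr, h1] at h3
  rw [← Finset.sum_mul, h2] at h3
  exact h3.symm

lemma formalCharacter_reflection (i : H.root) (v : realDual H) :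
    (formalCharacter H L).coeff ((realRootSystem H).reflection i v) =
      (formalCharacter H L).coeff v := by
  rw [coeff_formalCharacter, coeff_formalCharacter]
  have h1 : (((realRootSystem H).reflection i v : realDual H) : Dual ℂ H) =
      (v : Dual ℂ H) - (v : Dual ℂ H) (LieAlgebra.IsKilling.coroot (i : LieModule.Weight ℂ H 𝔤)) •
        (i : LieModule.Weight ℂ H 𝔤).toLinear := by
    have h2 : (pair (realRootSystem H) v ((realRootSystem H).coroot i) : ℂ) =
      (v : Dual ℂ H) (LieAlgebra.IsKilling.coroot (i : LieModule.Weight ℂ H 𝔤)) := coe_pair _ _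
    rw [reflection_eq, ← h2]
    rfl
  have h3 := finrank_weightSpace_reflect (L := L) (H.isNonZero_coe_root i) (v : Dual ℂ H)
  rw [← h1] at h3
  exact_mod_cast h3

variable {b : (realRootSystem H).Base} {l : realDual H}

lemma closure_root_le_rootCone :
    AddSubmonoid.closure ((realRootSystem H).root '' {i | b.IsPos i}) ≤ rootCone b := by
  rw [AddSubmonoid.closure_le]
  rintro _ ⟨i, hi, rfl⟩
  exact root_mem_rootCone hi

lemma IsHighestWeight.hasTop (h : IsHighestWeight b l L) :
    HasTop (rootCone b) (formalCharacter H L) l (finrank ℂ (wtSpace H L l)) := by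
  refine ⟨rfl, fun v hv ↦ ?_⟩
  have hv' : LieModule.weightSpace L ((v : Dual ℂ H) : H → ℂ) ≠ ⊥ := by
    intro h0
    refine hv ?_
    rw [coeff_formalCharacter, wtSpace, h0]
    simp
  obtain ⟨β, hβ, h1⟩ := h.2 _ hv'
  have h2 : l - v = β := by
    apply Subtype.ext
    change (l : Dual ℂ H) - (v : Dual ℂ H) = β
    rw [h1]
    abel
  rw [h2]
  exact closure_root_le_rootCone hβ

lemma IsHighestWeight.exists_weight_eq (h : IsHighestWeight b l L) (μ : LieModule.Weight ℂ H L)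
    (hμ : finrank ℂ (LieModule.weightSpace L (μ : H → ℂ)) ≠ 0) :
    ∃ v : realDual H, (μ : H → ℂ) = (v : Dual ℂ H) ∧ (formalCharacter H L).coeff v ≠ 0 := by
  have hμ' : LieModule.weightSpace L ((μ.toLinear : Dual ℂ H) : H → ℂ) ≠ ⊥ := by
    intro h0
    refine hμ ?_
    have h1 : (LieModule.weightSpace L (μ : H → ℂ)).toSubmodule = ⊥ := by
      rw [← LieModule.Weight.coe_coe, h0]
      rfl
    exact Submodule.finrank_eq_zero.mpr h1
  obtain ⟨β, -, h1⟩ := h.2 _ hμ'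
  have h2 : (μ : H → ℂ) = (((l - β : realDual H) : Dual ℂ H) : H → ℂ) := by
    rw [← LieModule.Weight.coe_coe, h1]
    rfl
  refine ⟨l - β, h2, ?_⟩
  rw [coeff_formalCharacter, wtSpace, ← h2]
  exact_mod_cast hμ

/-- All weights with a nonzero weight space differ from `l` by sums of roots, so they are real; the
other terms of the character carry the factor zero. -/
lemma IsHighestWeight.character_eq (h : IsHighestWeight b l L) (x : realCartan H) :
    character H L x = evalAt (realRootSystem H) x (formalCharacter H L) := by
  rw [evalAt_eq_sum, Finsupp.sum, character,
    ← Finset.sum_coe_sort (formalCharacter H L).coeff.support]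
  symm
  have hne : ∀ v : (formalCharacter H L).coeff.support,
      LieModule.genWeightSpace L ((v.1 : Dual ℂ H) : H → ℂ) ≠ ⊥ := by
    intro v h0
    have h1 := LieModule.weightSpace_le_genWeightSpace L ((v.1 : Dual ℂ H) : H → ℂ)
    rw [h0, le_bot_iff] at h1
    refine Finsupp.mem_support_iff.mp v.2 ?_
    rw [coeff_formalCharacter, wtSpace, h1]
    simp
  refine Finset.sum_of_injOn
    (fun v : (formalCharacter H L).coeff.support ↦ (⟨_, hne v⟩ : LieModule.Weight ℂ H L)) ?_ ?_ ?_ ?_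
  · intro u _ v _ huv
    refine Subtype.ext (Subtype.ext (DFunLike.coe_injective ?_))
    exact congrArg (fun μ : LieModule.Weight ℂ H L ↦ (μ : H → ℂ)) huv
  · intro v _
    exact Finset.mem_coe.mpr (Finset.mem_univ _)
  · intro μ _ hμ
    by_contra h0
    have h1 : finrank ℂ (LieModule.weightSpace L (μ : H → ℂ)) ≠ 0 := by
      intro h1
      rw [h1] at h0
      simp at h0
    obtain ⟨v, hv, hv'⟩ := h.exists_weight_eq μ h1
    exact hμ ⟨⟨v, Finsupp.mem_support_iff.mpr hv'⟩, Finset.mem_coe.mpr (Finset.mem_univ _),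
      DFunLike.coe_injective hv.symm⟩
  · intro v _
    rw [coe_pair, coeff_formalCharacter]
    rfl

/-- The characters of `m`-degree `M + 1` vanish at the regular points of adjoint order `M + h`. -/
lemma character_eq_zero [LieModule.IsIrreducible ℂ 𝔤 L] (b : (realRootSystem H).Base)
    (l : b.support →₀ ℕ) (hL : IsHighestWeight b (dominantWeight b l) L) {x : realCartan H}
    (hx : x ∈ openChamber b)
    (hS : sFunction (realRootSystem H) (dominantWeight b l + rho b) x = 0) :
    character H L x = 0 := by
  rw [hL.character_eq]
  obtain ⟨c, hc⟩ := exists_casimir (H := H) (L := L)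
  refine evalAt_eq_zero_of_casimir b killingDual_comm killingDual_root halfLength_pos
    traceSeries_sub hc formalCharacter_reflection (fun j ↦ ?_) ?_ hL.hasTop
    (not_exists_int_of_mem_openChamber b hx) hS
  · rw [pair_dominantWeight]
    positivity
  · have h1 := hL.1
    have : finrank ℂ (wtSpace H L (dominantWeight b l)) ≠ 0 := by
      rw [Submodule.finrank_eq_zero.ne]
      intro h0
      exact h1 (LieSubmodule.toSubmodule_injective h0)
    exact_mod_cast this

end FormalCharacter

end EFO

end

theorem theorem6p1 {𝔤 : Type*} [LieRing 𝔤] [LieAlgebra ℂ 𝔤] [FiniteDimensional ℂ 𝔤]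
    [LieAlgebra.IsSimple ℂ 𝔤] (H : LieSubalgebra ℂ 𝔤) [H.IsCartanSubalgebra]
    (b : (EFO.realRootSystem H).Base) (M : ℕ) :
    -- the regular points of `F` of adjoint order `M + h` are the points of `F°_{M+h}`
    {x ∈ EFO.chamberEFO b (M + EFO.coxeterNumber b) | EFO.IsRegular x} =
        EFO.openChamberEFO b (M + EFO.coxeterNumber b) ∧
      -- they are as many as the monomials of `m`-degree at most `M`, and as the points of `F_M`
      (EFO.openChamberEFO b (M + EFO.coxeterNumber b)).Finite ∧
      (EFO.monomialsLE b M).encard = (EFO.openChamberEFO b (M + EFO.coxeterNumber b)).encard ∧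
      (EFO.openChamberEFO b (M + EFO.coxeterNumber b)).encard = (EFO.chamberEFO b M).encard ∧
      -- they are common zeros of the `S`-functions and characters of `m`-degree `M + 1`
      ∀ x ∈ EFO.openChamberEFO b (M + EFO.coxeterNumber b),
        ∀ l : b.support →₀ ℕ, EFO.mDegree b l = M + 1 →
          EFO.sFunction (EFO.realRootSystem H) (EFO.dominantWeight b l + EFO.rho b) x = 0 ∧
          ∀ (L : Type*) [AddCommGroup L] [Module ℂ L] [LieRingModule 𝔤 L] [LieModule ℂ 𝔤 L]
            [FiniteDimensional ℂ L] [LieModule.IsIrreducible ℂ 𝔤 L],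
            EFO.IsHighestWeight b (EFO.dominantWeight b l) L → EFO.character H L x = 0 := by
  have := EFO.isCrystallographic_realRootSystem (H := H)
  have := EFO.isReduced_realRootSystem (H := H)
  have := EFO.isIrreducible_realRootSystem (H := H)
  refine ⟨?_, EFO.finite_openChamberEFO_add b M, EFO.encard_monomialsLE_eq b M,
    (EFO.encard_openChamberEFO_add b M).trans (EFO.encard_chamberEFO b M).symm,
    fun x hx l hl ↦ ?_⟩
  · ext x
    simp only [EFO.chamberEFO, EFO.openChamberEFO, Set.mem_ofPred_eq, Set.mem_inter_iff,
      EFO.mem_openChamber_iff, EFO.isRegular_iff]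
    tauto
  · have hS := EFO.sFunction_eq_zero b l hl hx.2
    exact ⟨hS, fun L _ _ _ _ _ _ hL ↦ EFO.character_eq_zero b l hL hx.1 hS⟩
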